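/- **Theorem (Chern–Weil map for $G$-differential simplicial algebras).** Let $G$ be a Lie group with Lie algebra $\mathfrak g$. *Definitions.* A *$G$-differential algebra* is a unital, associative, super-commutative $\mathbb N$-graded real algebra $A=\bigoplus_k A^k$ with a differential $d$ of degree $1$, an action of $G$ by automorphisms of the differential graded algebra, and a linear map $X\mapsto i_X$ from $\mathfrak g$ to derivations of degree $-1$, such that $i_Xi_Y+i_Yi_X=0$, $g\circ i_X\circ g^{-1}=i_{\mathrm{Ad}_gX}$ and $i_Xd+di_X=L_X$, where $L_Xa=\frac{d}{dt}\big|_{t=0}\exp(tX)\cdot a$ is the infinitesimal action (the derivative is taken with respect to a given Hausdorff vector space topology on $A$). An element $a$ is *basic* if $i_Xa=L_Xa=0$ for all $X$. A *connection* on $A$ is an element $\theta\in(A^1\otimes\mathfrak g)^G$ with $i_X\theta=1\otimes X$ for all $X\in\mathfrak g$. A *$G$-differential simplicial algebra* $A_\bullet$ is a sequence $(A_n)_{n\ge 0}$ of $G$-differential algebras with face maps $\epsilon^n_i:A_{n-1}\to A_n$ and degeneracy maps $\eta^n_i:A_{n+1}\to A_n$ that are morphisms of $G$-differential algebras and satisfy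 the cosimplicial identities; a *pseudo-connection* on $A_\bullet$ is a connection on $A_0$. The basic elements form $A_\bullet^{basic}=(A_n^{basic})_n$. On $\bigoplus_nA_n^{basic}$ one has the total differential $(-1)^nd+\partial$ on $A_n$, where $\partial=\sum_i(-1)^i\epsilon_i$, with space of cocycles $Z(A_\bullet^{basic})$ and cohomology $H^*(A_\bullet^{basic})$; an element of $A_n^k$ has total degree $n+k$, and the cup product of $a\in A_m^k$ and $b\in A_n^l$ is $a\vee b=(-1)^{kn}\,\mathrm{fr}(a)\,\mathrm{bk}(b)\in A_{m+n}^{k+l}$, with $\mathrm{fr}:A_m\to A_{m+n}$ and $\mathrm{bk}:A_n\to A_{m+n}$ the maps of the front $m$-face and the back $n$-face. The *fat realization* $\|A_\bullet\|$ consists of the sequences $k_n\in\Omega(\Delta_n)\otimes A_n$ of bounded degree ($\Omega(\Delta_n)$ being the smooth forms on the standard simplex, with barycentric coordinates $t_0,\dots,t_n$) that are compatible with all face and degeneracy maps, and $I:(k_n)_n\mapsto\big(\int_{\Delta_n}k_n\big)_n$ is the integration map. For a pseudo-connection $\theta$ let $\theta_n=\sum_{i=0}^nt_i\otimes p_i^n(\theta)$,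 where $p_i^n:A_0\to A_n$ is the map given by the $i$-th vertex, and let $\Omega_n=d\theta_n+\tfrac12[\theta_n,\theta_n]\in(\Omega(\Delta_n)\otimes A_n)^2\otimes\mathfrak g$. For $f\in S(\mathfrak g^*)$ put $c_{\tilde\theta}(f)=(f(\Omega_n))_n$. *Statement.* Let $A_\bullet$ be a $G$-differential simplicial algebra. 1. For every pseudo-connection $\theta$ and every $f\in S(\mathfrak g^*)^G$, $c_{\tilde\theta}(f)$ is a basic element of $\|A_\bullet\|$, and $z_\theta(f)=I(c_{\tilde\theta}(f))$ defines a linear map $$z_\theta:S(\mathfrak g^*)^G\to Z(A_\bullet^{basic}),$$ that is, a cochain map for the zero differential on $S(\mathfrak g^*)^G$. It maps $S^k(\mathfrak g^*)^G$ to cocycles of total degree $2k$. The induced map $w_\theta=[z_\theta]:S(\mathfrak g^*)^G\to H^*(A_\bullet^{basic})$ is a unital algebra homomorphism for the cup product. 2. The map $w_\theta$ does not depend on the pseudo-connection: $w_\theta=w_{\theta'}$ for any two pseudo-connections $\theta,\theta'$ on $A_\bullet$. -/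

import Mathlib

open scoped TensorProduct Manifold ContDiff Topology DirectSum
open CategoryTheory

universe u v

noncomputable section

namespace ChernWeil

/-! ## Graded algebras: parity and symmetric evaluation -/

section Graded

variable {B : Type*} [Ring B] [Algebra ℝ B]

/-- The parity involution `a ↦ (-1)^k a` for `a` homogeneous of degree `k`. -/
def parity (deg : ℕ → Submodule ℝ B) [GradedAlgebra deg] : B →ₗ[ℝ] B :=
  (DirectSum.toModule ℝ ℕ B fun k => (-1 : ℝ) ^ k • (deg k).subtype) ∘ₗ
    (DirectSum.decomposeLinearEquiv deg).toLinearMap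

theorem parity_of_mem (deg : ℕ → Submodule ℝ B) [GradedAlgebra deg] {k : ℕ} {a : B}
    (ha : a ∈ deg k) : parity deg a = (-1 : ℝ) ^ k • a := by
  lift a to deg k using ha
  simp only [parity, LinearMap.comp_apply, LinearEquiv.coe_coe,
    DirectSum.decomposeLinearEquiv_apply, DirectSum.decompose_coe]
  rw [← DirectSum.lof_eq_of ℝ, DirectSum.toModule_lof]
  rfl

/-- The algebra homomorphism `S(V) → B` extending a linear map `V → B` with pairwise commuting
values; `B` itself need not be commutative. -/
def symLift {V : Type*} [AddCommGroup V] [Module ℝ V] (φ : V →ₗ[ℝ] B)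
    (h : ∀ x y, φ x * φ y = φ y * φ x) : SymmetricAlgebra ℝ V →ₐ[ℝ] B :=
  letI : CommSemiring (Algebra.adjoin ℝ (Set.range φ)) :=
    { (Algebra.adjoin ℝ (Set.range φ)).toSemiring with
      mul_comm := (Algebra.isMulCommutative_adjoin ℝ (s := Set.range φ)
        (by rintro _ ⟨x, rfl⟩ _ ⟨y, rfl⟩; exact h x y)).is_comm.comm }
  (Algebra.adjoin ℝ (Set.range φ)).val.comp
    (SymmetricAlgebra.lift
      (φ.codRestrict (Subalgebra.toSubmodule (Algebra.adjoin ℝ (Set.range φ)))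
        fun x => Algebra.subset_adjoin ⟨x, rfl⟩))

theorem symLift_ι {V : Type*} [AddCommGroup V] [Module ℝ V] (φ : V →ₗ[ℝ] B)
    (h : ∀ x y, φ x * φ y = φ y * φ x) (x : V) :
    symLift φ h (SymmetricAlgebra.ι ℝ V x) = φ x := by
  let : CommSemiring (Algebra.adjoin ℝ (Set.range φ)) :=
    { (Algebra.adjoin ℝ (Set.range φ)).toSemiring with
      mul_comm := (Algebra.isMulCommutative_adjoin ℝ (s := Set.range φ)
        (by rintro _ ⟨x, rfl⟩ _ ⟨y, rfl⟩; exact h x y)).is_comm.comm }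
  exact congrArg Subtype.val (SymmetricAlgebra.lift_ι_apply
    (A := Algebra.adjoin ℝ (Set.range φ))
      (φ.codRestrict (Subalgebra.toSubmodule (Algebra.adjoin ℝ (Set.range φ)))
        fun x => Algebra.subset_adjoin ⟨x, rfl⟩) x)

end Graded

/-! ## Smooth differential forms on the standard simplex -/

section Simplex

/-- The standard `n`-simplex `{t_0 + ... + t_n = 1, t_i ≥ 0}` in the chart `(t_1, ..., t_n)`. -/
def Simplex (n : ℕ) : Set (Fin n → ℝ) := {x | (∀ i, 0 ≤ x i) ∧ ∑ i, x i ≤ 1}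

/-- The barycentric coordinates `(t_0, ..., t_n)` of a point. -/
def bary {n : ℕ} (x : Fin n → ℝ) : Fin (n + 1) → ℝ := Fin.cons (1 - ∑ i, x i) x

theorem bary_nonneg {n : ℕ} {x : Fin n → ℝ} (hx : x ∈ Simplex n) (i : Fin (n + 1)) :
    0 ≤ bary x i := by
  refine Fin.cases ?_ (fun j => ?_) i
  · simpa [bary] using hx.2
  · simpa [bary] using hx.1 j

theorem sum_bary {n : ℕ} (x : Fin n → ℝ) : ∑ i, bary x i = 1 := by
  simp [bary, Fin.sum_univ_succ]

theorem contDiff_bary {n : ℕ} (i : Fin (n + 1)) :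
    ContDiff ℝ ∞ fun x : Fin n → ℝ => bary x i := by
  refine Fin.cases ?_ (fun j => ?_) i
  · simp only [bary, Fin.cons_zero]; fun_prop
  · simp only [bary, Fin.cons_succ]; fun_prop

/-- The affine map of simplices sending the vertex `i` to the vertex `φ i`, that is
`t_j ∘ φ_* = ∑_{φ i = j} t_i`. -/
def simplexMap {m n : ℕ} (φ : Fin (m + 1) →o Fin (n + 1)) (x : Fin m → ℝ) : Fin n → ℝ :=
  fun j => ∑ i with φ i = j.succ, bary x i

theorem bary_simplexMap {m n : ℕ} (φ : Fin (m + 1) →o Fin (n + 1)) (x : Fin m → ℝ)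
    (j : Fin (n + 1)) : bary (simplexMap φ x) j = ∑ i with φ i = j, bary x i := by
  have key : ∑ j, ∑ i with φ i = j, bary x i = 1 := by
    rw [Finset.sum_fiberwise, sum_bary]
  refine Fin.cases ?_ (fun k => ?_) j
  · rw [Fin.sum_univ_succ] at key
    simp only [bary, Fin.cons_zero, simplexMap] at key ⊢
    linarith
  · simp [bary, simplexMap]

theorem simplexMap_mem {m n : ℕ} (φ : Fin (m + 1) →o Fin (n + 1)) {x : Fin m → ℝ}
    (hx : x ∈ Simplex m) : simplexMap φ x ∈ Simplex n := by
  refine ⟨fun j => Finset.sum_nonneg fun i _ => bary_nonneg hx i, ?_⟩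
  have h0 : 0 ≤ bary (simplexMap φ x) 0 := by
    rw [bary_simplexMap]
    exact Finset.sum_nonneg fun i _ => bary_nonneg hx i
  simpa [bary] using h0

theorem convex_simplex (n : ℕ) : Convex ℝ (Simplex n) := by
  intro x hx y hy a b ha hb hab
  refine ⟨fun i => ?_, ?_⟩
  · have := hx.1 i
    have := hy.1 i
    simp only [Pi.add_apply, Pi.smul_apply, smul_eq_mul]
    positivity
  · simp only [Pi.add_apply, Pi.smul_apply, smul_eq_mul, Finset.sum_add_distrib,
      ← Finset.mul_sum]
    nlinarith [hx.2, hy.2]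

theorem uniqueDiffOn_simplex (n : ℕ) : UniqueDiffOn ℝ (Simplex n) := by
  refine uniqueDiffOn_convex (convex_simplex n) ?_
  refine ⟨fun _ => 1 / (n + 1), mem_interior.2
    ⟨{x | (∀ i, 0 < x i) ∧ ∑ i, x i < 1}, fun x hx => ⟨fun i => (hx.1 i).le, hx.2.le⟩, ?_, ?_⟩⟩
  · have h1 : IsOpen {x : Fin n → ℝ | ∀ i, 0 < x i} := by
      simp only [Set.ofPred_forall]
      exact isOpen_iInter_of_finite fun i => isOpen_lt continuous_const (continuous_apply i)
    have h2 : Continuous fun x : Fin n → ℝ => ∑ i, x i := by fun_prop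
    exact h1.inter (isOpen_lt h2 continuous_const)
  · refine ⟨fun i => by positivity, ?_⟩
    simp only [Finset.sum_const, Finset.card_univ, Fintype.card_fin, nsmul_eq_mul]
    rw [mul_one_div, div_lt_one (by positivity)]
    linarith

theorem isCompact_simplex (n : ℕ) : IsCompact (Simplex n) := by
  have hcl : IsClosed (Simplex n) := by
    have h1 : IsClosed {x : Fin n → ℝ | ∀ i, 0 ≤ x i} := by
      simp only [Set.ofPred_forall]
      exact isClosed_iInter fun i => isClosed_le continuous_const (continuous_apply i)
    have h2 : Continuous fun x : Fin n → ℝ => ∑ i, x i := by fun_prop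
    exact h1.inter (isClosed_le h2 continuous_const)
  refine (isCompact_univ_pi fun _ : Fin n => isCompact_Icc (a := (0 : ℝ)) (b := 1)).of_isClosed_subset
    hcl fun x hx i _ => ⟨hx.1 i, ?_⟩
  exact (Finset.single_le_sum (fun j _ => hx.1 j) (Finset.mem_univ i)).trans hx.2

/-- The algebra `C^∞(Δ_n)` of functions on the simplex that are restrictions of smooth functions. -/
def SmoothFn (n : ℕ) : Subalgebra ℝ (Simplex n → ℝ) where
  carrier := {f | ∃ F : (Fin n → ℝ) → ℝ, ContDiff ℝ ∞ F ∧ ∀ x, f x = F x}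
  mul_mem' := by
    rintro f g ⟨F, hF, hf⟩ ⟨K, hK, hg⟩
    exact ⟨fun x => F x * K x, hF.mul hK, fun x => by simp [hf, hg]⟩
  add_mem' := by
    rintro f g ⟨F, hF, hf⟩ ⟨K, hK, hg⟩
    exact ⟨fun x => F x + K x, hF.add hK, fun x => by simp [hf, hg]⟩
  algebraMap_mem' r := ⟨fun _ => r, contDiff_const, fun _ => rfl⟩

/-- Extension of a function on the simplex by zero. -/
def extendZero {n : ℕ} (f : Simplex n → ℝ) : (Fin n → ℝ) → ℝ := Function.extend Subtype.val f 0

theorem extendZero_coe {n : ℕ} (f : Simplex n → ℝ) (x : Simplex n) : extendZero f x = f x :=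
  Subtype.val_injective.extend_apply _ _ _

theorem fderivWithin_extendZero {n : ℕ} {f : Simplex n → ℝ} {F : (Fin n → ℝ) → ℝ}
    (hF : ContDiff ℝ ∞ F) (hf : ∀ x, f x = F x) (x : Simplex n) :
    fderivWithin ℝ (extendZero f) (Simplex n) x = fderiv ℝ F x := by
  have heq : Set.EqOn (extendZero f) F (Simplex n) := fun y hy => by
    rw [show extendZero f y = f ⟨y, hy⟩ from extendZero_coe f ⟨y, hy⟩, hf]
  rw [fderivWithin_congr heq (heq x.2)]
  exact fderivWithin_eq_fderiv (uniqueDiffOn_simplex n x x.2)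
    ((hF.differentiable (by simp)) _)

/-- The partial derivative `∂ / ∂ t_{i+1}` in the chart `(t_1, ..., t_n)`, at the boundary taken
within the simplex. -/
def partialDeriv {n : ℕ} (i : Fin n) : SmoothFn n →ₗ[ℝ] SmoothFn n where
  toFun f := ⟨fun x => fderivWithin ℝ (extendZero f.1) (Simplex n) x (Pi.single i 1), by
    obtain ⟨F, hF, hf⟩ := f.2
    refine ⟨fun x => fderiv ℝ F x (Pi.single i 1), ?_, fun x => ?_⟩
    · exact (hF.fderiv_right (m := ∞) (by simp)).clm_apply contDiff_const
    · simp only [fderivWithin_extendZero hF hf]⟩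
  map_add' f g := by
    obtain ⟨F, hF, hf⟩ := f.2
    obtain ⟨K, hK, hg⟩ := g.2
    ext x
    have hFK : ∀ x, (f + g).1 x = (F + K) x := fun x => by simp [hf, hg]
    change fderivWithin ℝ (extendZero (f + g).1) (Simplex n) x _ =
      fderivWithin ℝ (extendZero f.1) (Simplex n) x _ +
      fderivWithin ℝ (extendZero g.1) (Simplex n) x _
    rw [fderivWithin_extendZero (hF.add hK) hFK, fderivWithin_extendZero hF hf,
      fderivWithin_extendZero hK hg]
    exact congrArg (fun L => L (Pi.single i 1)) (fderiv_add (hF.differentiable (by simp) _)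
      (hK.differentiable (by simp) _))
  map_smul' r f := by
    obtain ⟨F, hF, hf⟩ := f.2
    ext x
    have hrF : ∀ x, (r • f).1 x = (r • F) x := fun x => by simp [hf]
    change fderivWithin ℝ (extendZero (r • f).1) (Simplex n) x _ =
      r • fderivWithin ℝ (extendZero f.1) (Simplex n) x _
    rw [fderivWithin_extendZero (hF.const_smul r) hrF, fderivWithin_extendZero hF hf]
    exact congrArg (fun L => L (Pi.single i 1))
      (fderiv_const_smul (hF.differentiable (by simp) _) r)

/-- Pull-back of smooth functions along the affine map of simplices given by `φ`. -/
def pullFn {m n : ℕ} (φ : Fin (m + 1) →o Fin (n + 1)) : SmoothFn n →ₐ[ℝ] SmoothFn m where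
  toFun f := ⟨fun x => f.1 ⟨simplexMap φ x, simplexMap_mem φ x.2⟩, by
    obtain ⟨F, hF, hf⟩ := f.2
    refine ⟨fun x => F (simplexMap φ x), hF.comp (contDiff_pi.2 fun j => ?_), fun x => hf _⟩
    exact ContDiff.sum fun i _ => contDiff_bary i⟩
  map_one' := rfl
  map_mul' _ _ := rfl
  map_zero' := rfl
  map_add' _ _ := rfl
  commutes' _ := rfl

/-- The barycentric coordinate `t_i` as a smooth function on the simplex. -/
def coord {n : ℕ} (i : Fin (n + 1)) : SmoothFn n :=
  ⟨fun x => bary x.1 i, fun x => bary x i, contDiff_bary i, fun _ => rfl⟩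

theorem integrableOn_extendZero {n : ℕ} (f : SmoothFn n) :
    MeasureTheory.IntegrableOn (extendZero f.1) (Simplex n) := by
  obtain ⟨F, hF, hf⟩ := f.2
  have h := (hF.continuous.continuousOn (s := Simplex n)).integrableOn_compact
    (μ := MeasureTheory.volume) (isCompact_simplex n)
  refine h.congr_fun (fun y hy => ?_) (isCompact_simplex n).measurableSet
  rw [show extendZero f.1 y = f.1 ⟨y, hy⟩ from extendZero_coe f.1 ⟨y, hy⟩, hf]

/-- Lebesgue integral `∫ f dt_1 ... dt_n` over the simplex. -/
def integralFn (n : ℕ) : SmoothFn n →ₗ[ℝ] ℝ where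
  toFun f := ∫ x in Simplex n, extendZero f.1 x
  map_add' f g := by
    rw [← MeasureTheory.integral_add (integrableOn_extendZero f) (integrableOn_extendZero g)]
    refine MeasureTheory.setIntegral_congr_fun (isCompact_simplex n).measurableSet fun y hy => ?_
    have h := fun k : Simplex n → ℝ => extendZero_coe k ⟨y, hy⟩
    simp only at h
    simp only [h]
    rfl
  map_smul' r f := by
    rw [RingHom.id_apply, ← MeasureTheory.integral_smul]
    refine MeasureTheory.setIntegral_congr_fun (isCompact_simplex n).measurableSet fun y hy => ?_
    have h := fun k : Simplex n → ℝ => extendZero_coe k ⟨y, hy⟩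
    simp only at h
    simp only [h]
    rfl

/-- The exterior algebra on `dt_1, ..., dt_n`; the standard basis vector `i` of `Fin n → ℝ` stands
for `dt_{i+1}`. -/
abbrev Covectors (n : ℕ) : Type := ExteriorAlgebra ℝ (Fin n → ℝ)

/-- The coordinate covectors `dt_0, ..., dt_n`, where `dt_0 = - dt_1 - ... - dt_n`. -/
def dbary {n : ℕ} : Fin (n + 1) → (Fin n → ℝ) :=
  Fin.cons (fun _ => -1) fun j => Pi.single j 1

/-- The linear map `dt_j ↦ ∑_{φ i = j} dt_i`. -/
def pullCovector {m n : ℕ} (φ : Fin (m + 1) →o Fin (n + 1)) : (Fin n → ℝ) →ₗ[ℝ] (Fin m → ℝ) :=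
  Fintype.linearCombination ℝ fun j => ∑ i with φ i = j.succ, dbary i

/-- Smooth differential forms `Ω(Δ_n) = C^∞(Δ_n) ⊗ Λ(dt_1, ..., dt_n)`. -/
def Forms (n : ℕ) : Type := SmoothFn n ⊗[ℝ] Covectors n

instance (n : ℕ) : Ring (Forms n) := inferInstanceAs (Ring (SmoothFn n ⊗[ℝ] Covectors n))

instance (n : ℕ) : Algebra ℝ (Forms n) :=
  inferInstanceAs (Algebra ℝ (SmoothFn n ⊗[ℝ] Covectors n))

/-- The identification of `Forms n` with the tensor product of algebras defining it. -/
def formEquiv (n : ℕ) : (SmoothFn n ⊗[ℝ] Covectors n) ≃ₐ[ℝ] Forms n := AlgEquiv.refl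

/-- The forms of degree `k`. -/
def formDeg (n k : ℕ) : Submodule ℝ (Forms n) where
  carrier := ((⋀[ℝ]^k (Fin n → ℝ)).baseChange (SmoothFn n) : Set (SmoothFn n ⊗[ℝ] Covectors n))
  add_mem' h h' := Submodule.add_mem ((⋀[ℝ]^k (Fin n → ℝ)).baseChange (SmoothFn n)) h h'
  zero_mem' := Submodule.zero_mem ((⋀[ℝ]^k (Fin n → ℝ)).baseChange (SmoothFn n))
  smul_mem' r _ h := Submodule.smul_of_tower_mem
    ((⋀[ℝ]^k (Fin n → ℝ)).baseChange (SmoothFn n)) r h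

instance formGraded (n : ℕ) : GradedAlgebra (formDeg n) :=
  letI g : GradedAlgebra fun k => (⋀[ℝ]^k (Fin n → ℝ)).baseChange (SmoothFn n) :=
    GradedAlgebra.baseChange (S := SmoothFn n) fun k => ⋀[ℝ]^k (Fin n → ℝ)
  { one_mem := g.one_mem
    mul_mem := g.mul_mem
    decompose' := g.decompose'
    left_inv := g.left_inv
    right_inv := g.right_inv }

/-- The exterior differential `d(f λ) = ∑_i (∂f/∂t_i) dt_i ∧ λ`. -/
def dForm (n : ℕ) : Forms n →ₗ[ℝ] Forms n :=
  (formEquiv n).toLinearMap ∘ₗ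
    (∑ i, TensorProduct.map (partialDeriv i)
      (LinearMap.mulLeft ℝ (ExteriorAlgebra.ι ℝ (Pi.single i (1 : ℝ))))) ∘ₗ
    (formEquiv n).symm.toLinearMap

/-- Pull-back of forms along the affine map of simplices given by `φ`. -/
def pullForm {m n : ℕ} (φ : Fin (m + 1) →o Fin (n + 1)) : Forms n →ₐ[ℝ] Forms m :=
  (formEquiv m).toAlgHom.comp
    ((Algebra.TensorProduct.map (pullFn φ) (ExteriorAlgebra.map (pullCovector φ))).comp
      (formEquiv n).symm.toAlgHom)

/-- The smooth function `f` as a form of degree `0`. -/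
def fnForm (n : ℕ) : SmoothFn n →ₐ[ℝ] Forms n :=
  (formEquiv n).toAlgHom.comp Algebra.TensorProduct.includeLeft

/-- The coefficient of `dt_1 ∧ ... ∧ dt_n`. -/
def topCoeff (n : ℕ) : Covectors n →ₗ[ℝ] ℝ :=
  ExteriorAlgebra.liftAlternating (Pi.single n Matrix.detRowAlternating)

/-- Integration over the simplex oriented by `dt_1 ∧ ... ∧ dt_n`; it vanishes on forms of degree
less than `n`. -/
def integralForm (n : ℕ) : Forms n →ₗ[ℝ] ℝ :=
  (TensorProduct.lid ℝ ℝ).toLinearMap ∘ₗ TensorProduct.map (integralFn n) (topCoeff n) ∘ₗ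
    (formEquiv n).symm.toLinearMap

end Simplex

/-! ## Lie groups and `G`-differential algebras -/

section LieGroup

variable (d : ℕ) (G : Type v) [TopologicalSpace G] [ChartedSpace (EuclideanSpace ℝ (Fin d)) G]
  [Group G]

/-- The Lie algebra of a Lie group of dimension `d`. -/
abbrev LieAlg : Type := GroupLieAlgebra (𝓡 d) G

instance [LieGroup (𝓡 d) ∞ G] : LieGroup (𝓡 d) (minSmoothness ℝ 3) G := by
  rw [minSmoothness_of_isRCLikeNormedField]
  infer_instance

variable {d G}

/-- The adjoint action: the derivative at `1` of `x ↦ g x g⁻¹`. -/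
def Ad (g : G) : LieAlg d G →ₗ[ℝ] LieAlg d G :=
  (mfderiv (𝓡 d) (𝓡 d) (fun x : G => g * x * g⁻¹) 1 :
    LieAlg d G →L[ℝ] LieAlg d G).toLinearMap

/-- `γ` is the smooth one-parameter subgroup `t ↦ exp (t X)`. -/
structure IsOneParameterSubgroup (γ : ℝ → G) (X : LieAlg d G) : Prop where
  map_add : ∀ s t, γ (s + t) = γ s * γ t
  smooth : ContMDiff 𝓘(ℝ, ℝ) (𝓡 d) ∞ γ
  velocity : (mfderiv 𝓘(ℝ, ℝ) (𝓡 d) γ 0 (1 : ℝ) : EuclideanSpace ℝ (Fin d)) = X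

variable (d G)

/-- A `G`-differential algebra: a (unital, `ℕ`-graded, super-commutative) differential algebra over
`ℝ` with a `G`-action and contractions. The vector space topology is only used to make sense of
the infinitesimal action `L_X a = d/dt (exp (t X) a)` at `t = 0`. -/
structure GDiffAlg where
  carrier : Type u
  [ring : Ring carrier]
  [algebra : Algebra ℝ carrier]
  [topology : TopologicalSpace carrier]
  [topologicalAddGroup : IsTopologicalAddGroup carrier]
  [continuousSMul : ContinuousSMul ℝ carrier]
  [t2 : T2Space carrier]
  /-- homogeneous elements -/
  deg : ℕ → Submodule ℝ carrier
  [graded : GradedAlgebra deg]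
  super_comm : ∀ {i j : ℕ} {a b : carrier}, a ∈ deg i → b ∈ deg j →
    a * b = (-1 : ℝ) ^ (i * j) • (b * a)
  /-- the differential -/
  diff : carrier →ₗ[ℝ] carrier
  diff_mem : ∀ {i : ℕ} {a : carrier}, a ∈ deg i → diff a ∈ deg (i + 1)
  diff_diff : ∀ a, diff (diff a) = 0
  diff_mul : ∀ {i : ℕ} {a : carrier} (b : carrier), a ∈ deg i →
    diff (a * b) = diff a * b + (-1 : ℝ) ^ i • (a * diff b)
  /-- the action of `G` -/
  act : G →* (carrier →ₐ[ℝ] carrier)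
  act_mem : ∀ (g : G) {i : ℕ} {a : carrier}, a ∈ deg i → act g a ∈ deg i
  act_diff : ∀ (g : G) (a : carrier), act g (diff a) = diff (act g a)
  /-- the contractions -/
  contr : LieAlg d G →ₗ[ℝ] carrier →ₗ[ℝ] carrier
  contr_mem : ∀ (X : LieAlg d G) {i : ℕ} {a : carrier}, a ∈ deg (i + 1) → contr X a ∈ deg i
  contr_zero : ∀ (X : LieAlg d G) {a : carrier}, a ∈ deg 0 → contr X a = 0
  contr_mul : ∀ (X : LieAlg d G) {i : ℕ} {a : carrier} (b : carrier), a ∈ deg i →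
    contr X (a * b) = contr X a * b + (-1 : ℝ) ^ i • (a * contr X b)
  contr_contr : ∀ (X Y : LieAlg d G) (a : carrier), contr X (contr Y a) + contr Y (contr X a) = 0
  act_contr : ∀ (g : G) (X : LieAlg d G) (a : carrier),
    act g (contr X (act g⁻¹ a)) = contr (Ad g X) a
  infinitesimal : ∀ (X : LieAlg d G) (γ : ℝ → G), IsOneParameterSubgroup γ X →
    ∀ a : carrier, Filter.Tendsto (fun t : ℝ => t⁻¹ • (act (γ t) a - a)) (𝓝[≠] 0)
      (𝓝 (contr X (diff a) + diff (contr X a)))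

attribute [instance] GDiffAlg.ring GDiffAlg.algebra GDiffAlg.topology
  GDiffAlg.topologicalAddGroup GDiffAlg.continuousSMul GDiffAlg.t2 GDiffAlg.graded

variable {d G}

namespace GDiffAlg

instance : CoeSort (GDiffAlg.{u} d G) (Type u) := ⟨carrier⟩

/-- The infinitesimal action `L_X = i_X d + d i_X`. -/
def lie (B : GDiffAlg.{u} d G) (X : LieAlg d G) : B →ₗ[ℝ] B :=
  B.contr X ∘ₗ B.diff + B.diff ∘ₗ B.contr X

/-- The subspace of basic elements. -/
def basic (B : GDiffAlg.{u} d G) : Submodule ℝ B :=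
  ⨅ X : LieAlg d G, LinearMap.ker (B.lie X) ⊓ LinearMap.ker (B.contr X)

/-- Homomorphisms of `G`-differential algebras. -/
@[ext]
structure Hom (B C : GDiffAlg.{u} d G) where
  toAlgHom : B →ₐ[ℝ] C
  map_deg : ∀ {i : ℕ} {a : B}, a ∈ B.deg i → toAlgHom a ∈ C.deg i
  map_diff : ∀ a, toAlgHom (B.diff a) = C.diff (toAlgHom a)
  map_act : ∀ g a, toAlgHom (B.act g a) = C.act g (toAlgHom a)
  map_contr : ∀ X a, toAlgHom (B.contr X a) = C.contr X (toAlgHom a)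

instance : Category.{u} (GDiffAlg.{u} d G) where
  Hom := Hom
  id B := ⟨AlgHom.id ℝ B, id, fun _ => rfl, fun _ _ => rfl, fun _ _ => rfl⟩
  comp f g := ⟨g.toAlgHom.comp f.toAlgHom, fun h => g.map_deg (f.map_deg h),
    fun a => by simp [f.map_diff, g.map_diff], fun _ a => by simp [f.map_act, g.map_act],
    fun _ a => by simp [f.map_contr, g.map_contr]⟩

/-- The algebra homomorphism underlying a morphism. -/
def homAlg {B C : GDiffAlg.{u} d G} (f : B ⟶ C) : B →ₐ[ℝ] C := Hom.toAlgHom f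

end GDiffAlg

/-! ## The graded tensor products `Ω(Δ_m) ⊗ B` -/

/-- The differential algebra `Ω(Δ_m) ⊗ B`, with `(ω ⊗ a)(ω' ⊗ a') = (-1)^{|a||ω'|} ωω' ⊗ aa'`. -/
abbrev Mixed (m : ℕ) (B : GDiffAlg.{u} d G) : Type u :=
  GradedTensorProduct ℝ (formDeg m) B.deg

namespace Mixed

variable {m n : ℕ} {B C : GDiffAlg.{u} d G}

/-- The tensor product `f ⊗ g` of two linear maps (without signs). -/
def map (f : Forms m →ₗ[ℝ] Forms n) (g : B →ₗ[ℝ] C) : Mixed m B →ₗ[ℝ] Mixed n C :=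
  (GradedTensorProduct.of ℝ (formDeg n) C.deg).toLinearMap ∘ₗ TensorProduct.map f g ∘ₗ
    (GradedTensorProduct.of ℝ (formDeg m) B.deg).symm.toLinearMap

theorem map_tmul (f : Forms m →ₗ[ℝ] Forms n) (g : B →ₗ[ℝ] C) (w : Forms m) (a : B) :
    map f g (GradedTensorProduct.tmul ℝ w a : Mixed m B) =
      (GradedTensorProduct.tmul ℝ (f w) (g a) : Mixed n C) := rfl

/-- The subspace of elements of total degree `N`. -/
def totalDeg (m : ℕ) (B : GDiffAlg.{u} d G) (N : ℕ) : Submodule ℝ (Mixed m B) :=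
  Submodule.span ℝ {x | ∃ p q : ℕ, p + q = N ∧ ∃ w ∈ formDeg m p, ∃ a ∈ B.deg q,
    x = GradedTensorProduct.tmul ℝ w a}

/-- `d(ω ⊗ a) = dω ⊗ a + (-1)^{|ω|} ω ⊗ da`. -/
def diff (m : ℕ) (B : GDiffAlg.{u} d G) : Mixed m B →ₗ[ℝ] Mixed m B :=
  map (dForm m) LinearMap.id + map (parity (formDeg m)) B.diff

/-- `i_X(ω ⊗ a) = (-1)^{|ω|} ω ⊗ i_X a`. -/
def contr (m : ℕ) (B : GDiffAlg.{u} d G) (X : LieAlg d G) : Mixed m B →ₗ[ℝ] Mixed m B :=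
  map (parity (formDeg m)) (B.contr X)

/-- `L_X = i_X d + d i_X`. -/
def lie (m : ℕ) (B : GDiffAlg.{u} d G) (X : LieAlg d G) : Mixed m B →ₗ[ℝ] Mixed m B :=
  contr m B X ∘ₗ diff m B + diff m B ∘ₗ contr m B X

/-- The map `φ^* ⊗ id`. -/
def pull (φ : SimplexCategory.mk m ⟶ SimplexCategory.mk n) (B : GDiffAlg.{u} d G) :
    Mixed n B →ₗ[ℝ] Mixed m B :=
  map (pullForm φ.toOrderHom).toLinearMap LinearMap.id

/-- The map `id ⊗ f`. -/
def push (m : ℕ) (f : B ⟶ C) : Mixed m B →ₗ[ℝ] Mixed m C :=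
  map LinearMap.id (GDiffAlg.homAlg f).toLinearMap

/-- Integration over the simplex, `ω ⊗ a ↦ (∫ ω) a`. -/
def integral (m : ℕ) (B : GDiffAlg.{u} d G) : Mixed m B →ₗ[ℝ] B :=
  (TensorProduct.lid ℝ B).toLinearMap ∘ₗ TensorProduct.map (integralForm m) LinearMap.id ∘ₗ
    (GradedTensorProduct.of ℝ (formDeg m) B.deg).symm.toLinearMap

/-! ### Elements of even total degree commute -/

theorem ι_mul_of_mem {V : Type*} [AddCommGroup V] [Module ℝ V] (v : V) {q : ℕ}
    {y : ExteriorAlgebra ℝ V} (hy : y ∈ ⋀[ℝ]^q V) :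
    ExteriorAlgebra.ι ℝ v * y = (-1 : ℝ) ^ q • (y * ExteriorAlgebra.ι ℝ v) := by
  induction hy using Submodule.pow_induction_on_left' with
  | algebraMap r => simp [Algebra.commutes]
  | add x y i hx hy ihx ihy => rw [mul_add, ihx, ihy, add_mul, smul_add]
  | mem_mul m hm i x hx ih =>
    obtain ⟨u, rfl⟩ := hm
    have h := ExteriorAlgebra.ι_add_mul_swap (R := ℝ) v u
    rw [← mul_assoc, eq_neg_of_add_eq_zero_left h, neg_mul, mul_assoc, ih, mul_smul_comm,
      pow_succ, mul_assoc, mul_neg_one, neg_smul]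

theorem exterior_super_comm {V : Type*} [AddCommGroup V] [Module ℝ V] {p q : ℕ}
    {x y : ExteriorAlgebra ℝ V} (hx : x ∈ ⋀[ℝ]^p V) (hy : y ∈ ⋀[ℝ]^q V) :
    x * y = (-1 : ℝ) ^ (p * q) • (y * x) := by
  induction hx using Submodule.pow_induction_on_left' with
  | algebraMap r => simp [Algebra.commutes]
  | add x y i hx hy ihx ihy => rw [add_mul, ihx, ihy, mul_add, smul_add]
  | mem_mul m hm i x hx ih =>
    obtain ⟨u, rfl⟩ := hm
    rw [mul_assoc, ih, mul_smul_comm, ← mul_assoc, ι_mul_of_mem u hy, smul_mul_assoc, smul_smul,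
      mul_assoc, ← pow_add]
    congr 2
    rw [Nat.succ_eq_add_one]
    ring

theorem baseChange_super_comm {S V : Type*} [CommRing S] [Algebra ℝ S] [AddCommGroup V]
    [Module ℝ V] {p q : ℕ} {x y : S ⊗[ℝ] ExteriorAlgebra ℝ V}
    (hx : x ∈ (⋀[ℝ]^p V).baseChange S) (hy : y ∈ (⋀[ℝ]^q V).baseChange S) :
    x * y = (-1 : ℝ) ^ (p * q) • (y * x) := by
  rw [Submodule.baseChange_eq_span] at hx hy
  induction hx using Submodule.span_induction with
  | zero => simp
  | add a b _ _ ha hb => rw [add_mul, ha, hb, mul_add, smul_add]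
  | smul s a _ ha => rw [smul_mul_assoc, ha, mul_smul_comm, smul_comm]
  | mem a ha =>
    obtain ⟨a, ha, rfl⟩ := ha
    induction hy using Submodule.span_induction with
    | zero => simp
    | add b c _ _ hb hc => rw [add_mul, mul_add, hb, hc, smul_add]
    | smul s b _ hb => rw [smul_mul_assoc, mul_smul_comm, hb, smul_comm]
    | mem b hb =>
      obtain ⟨b, hb, rfl⟩ := hb
      simp only [TensorProduct.mk_apply, Algebra.TensorProduct.tmul_mul_tmul, mul_one]
      rw [exterior_super_comm ha hb, TensorProduct.tmul_smul]

theorem form_super_comm {p q : ℕ} {x y : Forms m} (hx : x ∈ formDeg m p) (hy : y ∈ formDeg m q) :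
    x * y = (-1 : ℝ) ^ (p * q) • (y * x) :=
  baseChange_super_comm (S := SmoothFn m) (V := Fin m → ℝ) hx hy

theorem dForm_mem {p : ℕ} {x : Forms m} (hx : x ∈ formDeg m p) : dForm m x ∈ formDeg m (p + 1) := by
  obtain ⟨x, rfl⟩ := (formEquiv m).surjective x
  replace hx : x ∈ (⋀[ℝ]^p (Fin m → ℝ)).baseChange (SmoothFn m) := hx
  rw [Submodule.baseChange_eq_span] at hx
  obtain ⟨l, rfl⟩ := (Finsupp.mem_span_iff_linearCombination _ _ _).1 hx
  rw [Finsupp.linearCombination_apply, Finsupp.sum, map_sum, map_sum]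
  refine Submodule.sum_mem _ fun y _ => ?_
  obtain ⟨_, y, hy, rfl⟩ := y
  simp only [dForm, LinearMap.comp_apply, LinearMap.sum_apply, map_sum]
  refine Submodule.sum_mem _ fun i _ => ?_
  have h : ExteriorAlgebra.ι ℝ (Pi.single i (1 : ℝ)) * y ∈ ⋀[ℝ]^(p + 1) (Fin m → ℝ) := by
    change _ ∈ LinearMap.range (ExteriorAlgebra.ι ℝ) ^ (p + 1)
    rw [pow_succ']
    exact Submodule.mul_mem_mul ⟨_, rfl⟩ hy
  have h2 := Submodule.tmul_mem_baseChange_of_mem (partialDeriv i (l ⟨_, y, hy, rfl⟩)) h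
  simpa [TensorProduct.smul_tmul'] using! h2

theorem tmul_smul_smul (r s : ℝ) (w : Forms m) (a : B) :
    (GradedTensorProduct.tmul ℝ (r • w) (s • a) : Mixed m B) =
      (r * s) • GradedTensorProduct.tmul ℝ w a := by
  rw [GradedTensorProduct.tmul, TensorProduct.smul_tmul_smul]
  rfl

theorem tmul_mul_tmul {p q : ℕ} (w : Forms m) {w' : Forms m} {a : B} (a' : B) (ha : a ∈ B.deg q)
    (hw : w' ∈ formDeg m p) :
    (GradedTensorProduct.tmul ℝ w a * GradedTensorProduct.tmul ℝ w' a' : Mixed m B) =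
      (-1 : ℝ) ^ (q * p) • GradedTensorProduct.tmul ℝ (w * w') (a * a') := by
  have h := GradedTensorProduct.tmul_coe_mul_coe_tmul (R := ℝ) (formDeg m) B.deg w ⟨a, ha⟩
    ⟨w', hw⟩ a'
  refine h.trans ?_
  rcases Nat.even_or_odd (q * p) with h | h <;> simp [h.neg_one_pow]

theorem totalDeg_comm {M N : ℕ} (hM : Even M) {x y : Mixed m B} (hx : x ∈ totalDeg m B M)
    (hy : y ∈ totalDeg m B N) : x * y = y * x := by
  induction hx using Submodule.span_induction with
  | zero => simp
  | add a b _ _ ha hb => rw [add_mul, ha, hb, mul_add]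
  | smul s a _ ha => rw [smul_mul_assoc, ha, mul_smul_comm]
  | mem x hx =>
    obtain ⟨p, q, hpq, w, hw, a, ha, rfl⟩ := hx
    induction hy using Submodule.span_induction with
    | zero => simp
    | add b c _ _ hb hc => rw [add_mul, mul_add, hb, hc]
    | smul s b _ hb => rw [smul_mul_assoc, mul_smul_comm, hb]
    | mem y hy =>
      obtain ⟨p', q', hpq', w', hw', a', ha', rfl⟩ := hy
      rw [tmul_mul_tmul w a' ha hw', tmul_mul_tmul w' a ha' hw, form_super_comm hw hw',
        B.super_comm ha ha']
      rw [tmul_smul_smul, smul_smul, ← pow_add, ← pow_add]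
      congr 1
      have e : Even (q * p' + (p * p' + q * q') + q' * p) := by
        have : q * p' + (p * p' + q * q') + q' * p = (p + q) * (p' + q') := by ring
        rw [this, hpq]
        exact hM.mul_right _
      refine neg_one_pow_congr ?_
      rw [Nat.even_add] at e
      exact e

theorem totalDeg_mul {M N : ℕ} {x y : Mixed m B} (hx : x ∈ totalDeg m B M)
    (hy : y ∈ totalDeg m B N) : x * y ∈ totalDeg m B (M + N) := by
  induction hx using Submodule.span_induction with
  | zero => simp
  | add a b _ _ ha hb => rw [add_mul]; exact add_mem ha hb
  | smul s a _ ha => rw [smul_mul_assoc]; exact Submodule.smul_mem _ s ha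
  | mem x hx =>
    obtain ⟨p, q, hpq, w, hw, a, ha, rfl⟩ := hx
    induction hy using Submodule.span_induction with
    | zero => simp
    | add b c _ _ hb hc => rw [mul_add]; exact add_mem hb hc
    | smul s b _ hb => rw [mul_smul_comm]; exact Submodule.smul_mem _ s hb
    | mem y hy =>
      obtain ⟨p', q', hpq', w', hw', a', ha', rfl⟩ := hy
      rw [tmul_mul_tmul w a' ha hw']
      refine Submodule.smul_mem _ _ (Submodule.subset_span ⟨p + p', q + q', by omega, _,
        SetLike.mul_mem_graded hw hw', _, SetLike.mul_mem_graded ha ha', rfl⟩)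

theorem totalDeg_diff {N : ℕ} {x : Mixed m B} (hx : x ∈ totalDeg m B N) :
    diff m B x ∈ totalDeg m B (N + 1) := by
  induction hx using Submodule.span_induction with
  | zero => simp
  | add a b _ _ ha hb => rw [map_add]; exact add_mem ha hb
  | smul s a _ ha => rw [map_smul]; exact Submodule.smul_mem _ s ha
  | mem x hx =>
    obtain ⟨p, q, hpq, w, hw, a, ha, rfl⟩ := hx
    rw [diff, LinearMap.add_apply, map_tmul, map_tmul, parity_of_mem _ hw]
    exact add_mem
      (Submodule.subset_span ⟨p + 1, q, by omega, _, dForm_mem hw, _, ha, rfl⟩)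
      (Submodule.subset_span ⟨p, q + 1, by omega, _, Submodule.smul_mem _ _ hw, _,
        B.diff_mem ha, rfl⟩)

end Mixed

/-! ## Connections and curvature -/

/-- A connection on a `G`-differential algebra `B`: an element of `(B^1 ⊗ 𝔤)^G` with
`i_X θ = 1 ⊗ X`. -/
structure Connection (B : GDiffAlg.{u} d G) where
  form : B ⊗[ℝ] LieAlg d G
  form_mem : form ∈ LinearMap.range
    (TensorProduct.map (B.deg 1).subtype (LinearMap.id : LieAlg d G →ₗ[ℝ] LieAlg d G))
  invariant : ∀ g : G, TensorProduct.map (B.act g).toLinearMap (Ad g) form = form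
  contr_form : ∀ X : LieAlg d G,
    TensorProduct.map (B.contr X) (LinearMap.id : LieAlg d G →ₗ[ℝ] LieAlg d G) form = 1 ⊗ₜ[ℝ] X

section Curvature

variable {R : Type*} [Ring R] [Algebra ℝ R]

/-- The pairing `⟨ξ, a ⊗ X⟩ = ξ(X) a`, as a linear map in `ξ`. -/
def pairing (Θ : R ⊗[ℝ] LieAlg d G) : Module.Dual ℝ (LieAlg d G) →ₗ[ℝ] R where
  toFun ξ := TensorProduct.rid ℝ R (TensorProduct.map LinearMap.id ξ Θ)
  map_add' ξ ζ := by rw [TensorProduct.map_add_right, LinearMap.add_apply, map_add]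
  map_smul' r ξ := by
    rw [TensorProduct.map_smul_right, LinearMap.smul_apply, map_smul, RingHom.id_apply]

/-- The subspace of `R ⊗ 𝔤` spanned by the `a ⊗ X` with `a ∈ U`. -/
def valuedIn (U : Submodule ℝ R) : Submodule ℝ (R ⊗[ℝ] LieAlg d G) :=
  Submodule.span ℝ {x | ∃ a ∈ U, ∃ X : LieAlg d G, x = a ⊗ₜ[ℝ] X}

theorem pairing_mem {U : Submodule ℝ R} {Θ : R ⊗[ℝ] LieAlg d G} (h : Θ ∈ valuedIn U)
    (ξ : Module.Dual ℝ (LieAlg d G)) : pairing Θ ξ ∈ U := by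
  change TensorProduct.rid ℝ R (TensorProduct.map LinearMap.id ξ Θ) ∈ U
  induction h using Submodule.span_induction with
  | zero => simp
  | add a b _ _ ha hb => rw [map_add, map_add]; exact add_mem ha hb
  | smul s a _ ha => rw [map_smul, map_smul]; exact Submodule.smul_mem _ s ha
  | mem x hx =>
    obtain ⟨a, ha, X, rfl⟩ := hx
    rw [TensorProduct.map_tmul, TensorProduct.rid_tmul]
    exact Submodule.smul_mem _ _ ha

variable [LieGroup (𝓡 d) ∞ G]

/-- The bracket `[a ⊗ X, b ⊗ Y] = ab ⊗ [X, Y]`. -/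
def tensorBracket : R ⊗[ℝ] LieAlg d G →ₗ[ℝ] R ⊗[ℝ] LieAlg d G →ₗ[ℝ] R ⊗[ℝ] LieAlg d G :=
  TensorProduct.map₂ (LinearMap.mul ℝ R)
    (LieModule.toEnd ℝ (LieAlg d G) (LieAlg d G) : LieAlg d G →ₗ[ℝ] LieAlg d G →ₗ[ℝ] LieAlg d G)

/-- The curvature `dθ + ½ [θ, θ]`. -/
def curvature (D : R →ₗ[ℝ] R) (θ : R ⊗[ℝ] LieAlg d G) : R ⊗[ℝ] LieAlg d G :=
  TensorProduct.map D LinearMap.id θ + (1 / 2 : ℝ) • tensorBracket θ θ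

theorem curvature_mem {D : R →ₗ[ℝ] R} {U W : Submodule ℝ R} (hD : ∀ a ∈ U, D a ∈ W)
    (hU : ∀ a ∈ U, ∀ b ∈ U, a * b ∈ W) {θ : R ⊗[ℝ] LieAlg d G} (h : θ ∈ valuedIn U) :
    curvature D θ ∈ valuedIn W := by
  have h1 : TensorProduct.map D (LinearMap.id : LieAlg d G →ₗ[ℝ] LieAlg d G) θ ∈
      valuedIn (d := d) (G := G) W := by
    induction h using Submodule.span_induction with
    | zero => simp
    | add a b _ _ ha hb => rw [map_add]; exact add_mem ha hb
    | smul s a _ ha => rw [map_smul]; exact Submodule.smul_mem _ s ha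
    | mem x hx =>
      obtain ⟨a, ha, X, rfl⟩ := hx
      exact Submodule.subset_span ⟨_, hD a ha, X, rfl⟩
  have h2 : ∀ ψ ∈ valuedIn (d := d) (G := G) U, ∀ φ ∈ valuedIn (d := d) (G := G) U,
      tensorBracket ψ φ ∈ valuedIn (d := d) (G := G) W := by
    intro ψ hψ φ hφ
    induction hψ using Submodule.span_induction with
    | zero => simp
    | add a b _ _ ha hb => rw [map_add, LinearMap.add_apply]; exact add_mem ha hb
    | smul s a _ ha => rw [map_smul, LinearMap.smul_apply]; exact Submodule.smul_mem _ s ha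
    | mem x hx =>
      obtain ⟨a, ha, X, rfl⟩ := hx
      induction hφ using Submodule.span_induction with
      | zero => simp
      | add a b _ _ ha hb => rw [map_add]; exact add_mem ha hb
      | smul s a _ ha => rw [map_smul]; exact Submodule.smul_mem _ s ha
      | mem y hy =>
        obtain ⟨b, hb, Y, rfl⟩ := hy
        exact Submodule.subset_span ⟨_, hU a ha b hb, ⁅X, Y⁆, rfl⟩
  exact add_mem h1 (Submodule.smul_mem _ _ (h2 θ h θ h))

end Curvature

/-! ## The Chern-Weil map through the fat realization -/

/-- A `G`-differential simplicial algebra: a sequence `A_n` of `G`-differential algebras with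
morphisms `A_m → A_n` for all monotone maps `[m] → [n]`, i.e. with face maps `A_{n-1} → A_n` and
degeneracy maps `A_{n+1} → A_n` satisfying the cosimplicial relations. -/
abbrev GDiffSimplicialAlg (d : ℕ) (G : Type v) [TopologicalSpace G]
    [ChartedSpace (EuclideanSpace ℝ (Fin d)) G] [Group G] : Type _ :=
  CosimplicialObject (GDiffAlg.{u} d G)

namespace GDiffSimplicialAlg

variable (A : GDiffSimplicialAlg.{u} d G)

/-- The algebra `A_n`. -/
abbrev lvl (n : ℕ) : GDiffAlg.{u} d G := A.obj (SimplexCategory.mk n)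

/-- A pseudo-connection is a connection on `A_0`. -/
abbrev PseudoConnection : Type u := Connection (lvl A 0)

/-- The map `p_i^n : A_0 → A_n` given by the vertex `i` of the `n`-simplex. -/
def vertexMap (n : ℕ) (i : Fin (n + 1)) : lvl A 0 →ₐ[ℝ] lvl A n :=
  GDiffAlg.homAlg (A.map (SimplexCategory.const (SimplexCategory.mk 0) (SimplexCategory.mk n) i))

/-- The map `α ↦ ∑_i t_i ⊗ p_i^n(α)`. -/
def baryExtend (n : ℕ) : lvl A 0 →ₗ[ℝ] Mixed n (lvl A n) :=
  ∑ i : Fin (n + 1), (GradedTensorProduct.of ℝ (formDeg n) (lvl A n).deg).toLinearMap ∘ₗ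
    TensorProduct.mk ℝ (Forms n) (lvl A n) (fnForm n (coord i)) ∘ₗ (vertexMap A n i).toLinearMap

/-- Sequences `(k_n)` with `k_n ∈ Ω(Δ_n) ⊗ A_n`. -/
abbrev FormSeq : Type u := ∀ n, Mixed n (lvl A n)

/-- The fat realization `‖A‖`: sequences of bounded degree that are compatible with all face and
degeneracy maps. -/
def fatRealization : Submodule ℝ (FormSeq A) where
  carrier := {k |
    (∃ N, ∀ n, k n ∈ ⨆ j ≤ N, Mixed.totalDeg n (lvl A n) j) ∧
    (∀ n (i : Fin (n + 2)), Mixed.pull (SimplexCategory.δ i) (lvl A (n + 1)) (k (n + 1)) =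
      Mixed.push n (CosimplicialObject.δ A i) (k n)) ∧
    (∀ n (i : Fin (n + 1)), Mixed.pull (SimplexCategory.σ i) (lvl A n) (k n) =
      Mixed.push (n + 1) (CosimplicialObject.σ A i) (k (n + 1)))}
  zero_mem' := ⟨⟨0, fun _ => zero_mem _⟩, fun _ _ => by simp, fun _ _ => by simp⟩
  add_mem' := by
    rintro k l ⟨⟨M, hM⟩, hk, hk'⟩ ⟨⟨N, hN⟩, hl, hl'⟩
    refine ⟨⟨max M N, fun n => add_mem ?_ ?_⟩, fun n i => by simp [hk, hl],
      fun n i => by simp [hk', hl']⟩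
    · exact (iSup₂_le fun j hj => le_iSup₂_of_le j (hj.trans (le_max_left _ _)) le_rfl :
        (⨆ j ≤ M, Mixed.totalDeg n (lvl A n) j) ≤ _) (hM n)
    · exact (iSup₂_le fun j hj => le_iSup₂_of_le j (hj.trans (le_max_right _ _)) le_rfl :
        (⨆ j ≤ N, Mixed.totalDeg n (lvl A n) j) ≤ _) (hN n)
  smul_mem' := by
    rintro r k ⟨⟨M, hM⟩, hk, hk'⟩
    exact ⟨⟨M, fun n => Submodule.smul_mem _ r (hM n)⟩, fun n i => by simp [hk],
      fun n i => by simp [hk']⟩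

/-- The basic elements of the fat realization. -/
def fatBasic : Submodule ℝ (FormSeq A) :=
  fatRealization A ⊓ ⨅ (X : LieAlg d G) (n : ℕ),
    (LinearMap.ker (Mixed.lie n (lvl A n) X) ⊓
      LinearMap.ker (Mixed.contr n (lvl A n) X)).comap (LinearMap.proj n)

/-- Sequences `(c_n)` with `c_n ∈ A_n`. -/
abbrev Cochain : Type u := ∀ n, lvl A n

/-- The integration map `(k_n) ↦ (∫_{Δ_n} k_n)`. -/
def integrate : FormSeq A →ₗ[ℝ] Cochain A :=
  LinearMap.pi fun n => Mixed.integral n (lvl A n) ∘ₗ LinearMap.proj n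

/-- The alternating sum `∂` of the face maps. -/
def faceSum : ∀ n, Cochain A →ₗ[ℝ] lvl A n
  | 0 => 0
  | n + 1 => ∑ i : Fin (n + 2), (-1 : ℝ) ^ (i : ℕ) •
      ((GDiffAlg.homAlg (CosimplicialObject.δ A i)).toLinearMap ∘ₗ LinearMap.proj n)

/-- The total differential `(-1)^n d + ∂`. -/
def totalDiff : Cochain A →ₗ[ℝ] Cochain A :=
  LinearMap.pi fun n => (-1 : ℝ) ^ n • ((lvl A n).diff ∘ₗ LinearMap.proj n) + faceSum A n

/-- The cochains in `⨁_n A_n^basic`. -/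
def basicCochains : Submodule ℝ (Cochain A) where
  carrier := {c | (∀ n, c n ∈ (lvl A n).basic) ∧ ∃ N, ∀ n, N < n → c n = 0}
  zero_mem' := ⟨fun _ => zero_mem _, 0, fun _ _ => rfl⟩
  add_mem' := by
    rintro b c ⟨hb, M, hM⟩ ⟨hc, N, hN⟩
    refine ⟨fun n => add_mem (hb n) (hc n), max M N, fun n hn => ?_⟩
    rw [Pi.add_apply, hM n ((le_max_left _ _).trans_lt hn),
      hN n ((le_max_right _ _).trans_lt hn), add_zero]
  smul_mem' := by
    rintro r c ⟨hc, N, hN⟩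
    exact ⟨fun n => Submodule.smul_mem _ r (hc n), N, fun n hn => by
      rw [Pi.smul_apply, hN n hn, smul_zero]⟩

/-- The cocycles `Z(A^basic)` for the total differential. -/
def basicCocycles : Submodule ℝ (Cochain A) := basicCochains A ⊓ LinearMap.ker (totalDiff A)

/-- The coboundaries of basic cochains. -/
def basicCoboundaries : Submodule ℝ (Cochain A) := (basicCochains A).map (totalDiff A)

/-- The cohomology `H^*(A^basic)`. -/
abbrev BasicCohomology : Type u :=
  basicCocycles A ⧸ (basicCoboundaries A).comap (basicCocycles A).subtype

/-- The cohomology class of a cocycle. -/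
def cls : basicCocycles A →ₗ[ℝ] BasicCohomology A := Submodule.mkQ _

/-- The cochains of total degree `N`. -/
def cochainDeg (N : ℕ) : Submodule ℝ (Cochain A) where
  carrier := {c | ∀ n, (n ≤ N → c n ∈ (lvl A n).deg (N - n)) ∧ (N < n → c n = 0)}
  zero_mem' _ := ⟨fun _ => zero_mem _, fun _ => rfl⟩
  add_mem' hb hc n := ⟨fun h => add_mem ((hb n).1 h) ((hc n).1 h), fun h => by
    rw [Pi.add_apply, (hb n).2 h, (hc n).2 h, add_zero]⟩
  smul_mem' r _ hc n := ⟨fun h => Submodule.smul_mem _ r ((hc n).1 h), fun h => by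
    rw [Pi.smul_apply, (hc n).2 h, smul_zero]⟩

/-- The cup product: for `a ∈ A_p^k` and `b ∈ A_q`, `a ∨ b` is `(-1)^{kq}` times the product of the
images of `a` under the front face map `A_p → A_{p+q}` and of `b` under the back face map
`A_q → A_{p+q}`. -/
def cup (a b : Cochain A) : Cochain A := fun N => ∑ p : Fin (N + 1),
  GDiffAlg.homAlg (A.map (SimplexCategory.subinterval (n := N) 0 p (by have := p.2; omega)))
      ((parity (lvl A p).deg ^ (N - p : ℕ)) (a p)) *
    GDiffAlg.homAlg (A.map (SimplexCategory.subinterval (n := N) p (N - p) (by have := p.2; omega)))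
      (b (N - p))

/-- The unit `1 ∈ A_0` of the cup product. -/
def unitCochain : Cochain A := Pi.single 0 1

section ChernWeilMap

variable [LieGroup (𝓡 d) ∞ G] {A}

/-- The component `θ_n = ∑_i t_i ⊗ p_i^n(θ)` in `(Ω(Δ_n) ⊗ A_n) ⊗ 𝔤` of the connection induced by
`θ` on the fat realization. -/
def fatConnection (θ : PseudoConnection A) (n : ℕ) : Mixed n (lvl A n) ⊗[ℝ] LieAlg d G :=
  TensorProduct.map (baryExtend A n) LinearMap.id θ.form

/-- The curvature `Ω_n` of `θ_n`. -/
def fatCurvature (θ : PseudoConnection A) (n : ℕ) : Mixed n (lvl A n) ⊗[ℝ] LieAlg d G :=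
  curvature (Mixed.diff n (lvl A n)) (fatConnection θ n)

theorem fatConnection_mem (θ : PseudoConnection A) (n : ℕ) :
    fatConnection θ n ∈ valuedIn (d := d) (G := G) (Mixed.totalDeg n (lvl A n) 1) := by
  obtain ⟨τ, hτ⟩ := θ.form_mem
  rw [fatConnection, ← hτ]
  clear hτ
  induction τ using TensorProduct.induction_on with
  | zero => simp
  | add a b ha hb => rw [map_add, map_add]; exact add_mem ha hb
  | tmul a X =>
    rw [TensorProduct.map_tmul, TensorProduct.map_tmul]
    refine Submodule.subset_span ⟨_, ?_, _, rfl⟩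
    rw [baryExtend, LinearMap.sum_apply]
    refine Submodule.sum_mem _ fun i _ => Submodule.subset_span
      ⟨0, 1, rfl, fnForm n (coord i), ?_, vertexMap A n i a, GDiffAlg.Hom.map_deg _ a.2, rfl⟩
    exact Submodule.tmul_mem_baseChange_of_mem (coord i)
      (SetLike.one_mem_graded fun k : ℕ => ⋀[ℝ]^k (Fin n → ℝ))

theorem fatCurvature_mem (θ : PseudoConnection A) (n : ℕ) :
    fatCurvature θ n ∈ valuedIn (d := d) (G := G) (Mixed.totalDeg n (lvl A n) 2) :=
  curvature_mem (fun _ h => Mixed.totalDeg_diff h) (fun _ h _ h' => Mixed.totalDeg_mul h h')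
    (fatConnection_mem θ n)

theorem fatCurvature_comm (θ : PseudoConnection A) (n : ℕ) (ξ ζ : Module.Dual ℝ (LieAlg d G)) :
    pairing (fatCurvature θ n) ξ * pairing (fatCurvature θ n) ζ =
      pairing (fatCurvature θ n) ζ * pairing (fatCurvature θ n) ξ :=
  Mixed.totalDeg_comm even_two (pairing_mem (fatCurvature_mem θ n) ξ)
    (pairing_mem (fatCurvature_mem θ n) ζ)

/-- The algebra homomorphism `f ↦ (f(Ω_n))_n` on `S(𝔤^*)`, determined by `ξ ↦ ⟨ξ, Ω_n⟩`. -/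
def fatChernWeil (θ : PseudoConnection A) :
    SymmetricAlgebra ℝ (Module.Dual ℝ (LieAlg d G)) →ₐ[ℝ] FormSeq A :=
  AlgHom.pi fun n => symLift (pairing (fatCurvature θ n)) (fatCurvature_comm θ n)

end ChernWeilMap

end GDiffSimplicialAlg

/-! ## Invariant polynomials -/

variable (d G)

/-- The symmetric algebra `S(𝔤^*)`. -/
abbrev SymDual : Type := SymmetricAlgebra ℝ (Module.Dual ℝ (LieAlg d G))

variable {d G}

/-- The coadjoint action of `g` on `S(𝔤^*)`, extending `ξ ↦ ξ ∘ Ad g⁻¹`. -/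
def coadjoint (g : G) : SymDual d G →ₐ[ℝ] SymDual d G :=
  SymmetricAlgebra.lift (SymmetricAlgebra.ι ℝ _ ∘ₗ (Ad (d := d) g⁻¹).dualMap)

variable (d G)

/-- The algebra `S(𝔤^*)^G` of invariant polynomials. -/
def invariantPolys : Subalgebra ℝ (SymDual d G) :=
  ⨅ g : G, AlgHom.equalizer (coadjoint g) (AlgHom.id ℝ (SymDual d G))

/-- The homogeneous polynomials `S^k(𝔤^*)`. -/
def symDeg (k : ℕ) : Submodule ℝ (SymDual d G) :=
  LinearMap.range (SymmetricAlgebra.ι ℝ (Module.Dual ℝ (LieAlg d G))) ^ k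

end LieGroup

end ChernWeil

end

/-! Let `θ_0, ..., θ_m` be connections on one algebra `B`. Since `∑ t_i = 1`, the form `∑ t_i ⊗ θ_i`
is a connection form on `Ω(Δ_m) ⊗ B`, and ordinary Chern–Weil theory applies to it. The Bianchi
identity gives `d f(Ω) = -∑ θ^i (L_i f)(Ω)`, which vanishes for invariant `f` (`diff_famChernWeil`),
and `i_X Ω = 0` (`contr_famCurv`), so `f(Ω)` is closed and basic. Pull-back along a map of simplices
only reindexes the connections (`pullAlg_famChernWeil`), which yields compatibility with faces and
degeneracies. Stokes' theorem (`integralForm_dForm`) then turns closedness into the cocycle equation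
for the integrals.

The passage from `G` to its Lie algebra rests on two facts: every `X` is the velocity of a
one-parameter subgroup `γ` (`exists_isOneParameterSubgroup`), and `Ad (γ t) Y` has derivative `[X,
Y]` at `0` (`hasDerivAt_Ad`). They give `i_X dθ` for a connection (`Connection.contr_diff_pairing`)
and the infinitesimal invariance of invariant polynomials (`coadDeriv_of_invariant`).

Multiplicativity and independence of the pseudo-connection are two instances of one acyclic models
argument. Let `V_n` be complexes that contract onto the line of a unit, compatibly with degrees. A
functional `T` that respects boundaries, kills the unit and vanishes in low degree is null
homotopic, `T = K D + K ∂`, with `K` built recursively from the contraction (`K_D_succ`). Applying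
`K` to a closed, basic, face-compatible family `w_n` in `V_n ⊗ A_n` gives a basic cochain with total
differential `T(w)` (`BasicCycle.exists_totalDiff`). The contractions come from the Poincaré lemma
(`dForm_poincare`).

For independence, `V_n` consists of the forms on the join of two copies of `Δ_n`, which is again a
simplex; `θ` sits at the first vertices, `θ'` at the last, and `T` is the difference of the
integrals over the two factors. For multiplicativity, `V_n = Ω(Δ_n) ⊗ Ω(Δ_n)`, `T` is the integral
of the wedge product minus the cup product of the integrals, and `w_n` is the external product of
`f(Ω_n)` and `f'(Ω_n)`. -/

namespace ChernWeil
-- One-parameter subgroups with prescribed velocity.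
section
variable {d : ℕ} {G : Type v} [TopologicalSpace G]
    [ChartedSpace (EuclideanSpace ℝ (Fin d)) G] [Group G] [LieGroup (𝓡 d) ∞ G]

omit [Group G] [LieGroup (𝓡 d) ∞ G] in
theorem tangentBundle_mk_congr {a b : G} (h : a = b) {v w : EuclideanSpace ℝ (Fin d)} (hvw : v = w) :
    (⟨a, v⟩ : TangentBundle (𝓡 d) G) = ⟨b, w⟩ := by
  subst h hvw; rfl

-- The field is `g ↦ T(mul)(0_g, X)`, a composite of the zero section, a constant section and the
-- tangent map of the multiplication, all smooth.
open Bundle in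
theorem contMDiff_mulInvariantVectorField_infty (X : LieAlg d G) :
    ContMDiff (𝓡 d) (𝓡 d).tangent ∞
      (fun g : G => (⟨g, mulInvariantVectorField X g⟩ : TangentBundle (𝓡 d) G)) := by
  let fg : G → TangentBundle (𝓡 d) G := fun g ↦ TotalSpace.mk' _ g 0
  have sfg : ContMDiff (𝓡 d) (𝓡 d).tangent ∞ fg := contMDiff_zeroSection _ _
  let fv : G → TangentBundle (𝓡 d) G := fun _ ↦ TotalSpace.mk' _ 1 X
  have sfv : ContMDiff (𝓡 d) (𝓡 d).tangent ∞ fv := contMDiff_const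
  have S₁ := sfg.prodMk sfv
  have S₂ := contMDiff_equivTangentBundleProd_symm (n := ∞) (I := 𝓡 d) (M := G) (I' := 𝓡 d) (M' := G)
  have S₃ : ContMDiff ((𝓡 d).prod (𝓡 d)).tangent (𝓡 d).tangent ∞
      (tangentMap ((𝓡 d).prod (𝓡 d)) (𝓡 d) (fun (p : G × G) ↦ p.1 * p.2)) :=
    ContMDiff.contMDiff_tangentMap (contMDiff_mul (𝓡 d) ∞) (by simp)
  have S := (S₃.comp S₂).comp S₁
  refine S.congr fun g => tangentBundle_mk_congr (mul_one g).symm ?_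
  refine Eq.trans ?_ (mfderiv_prod_eq_add_apply (I := 𝓡 d) (I' := 𝓡 d) (I'' := 𝓡 d)
    (f := fun p : G × G => p.1 * p.2) (p := (g, 1)) (v := (0, X))
    ((contMDiff_mul (𝓡 d) ∞).mdifferentiableAt (by simp))).symm
  refine Eq.trans ?_ (congrArg₂ (fun a b : EuclideanSpace ℝ (Fin d) => a + b) (map_zero _).symm rfl)
  exact (zero_add (mulInvariantVectorField X g : EuclideanSpace ℝ (Fin d))).symm

theorem mdifferentiableAt_mul_left (g h : G) :
    MDifferentiableAt (𝓡 d) (𝓡 d) (g * ·) h :=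
  (contMDiff_mul_left (I := 𝓡 d) (n := ∞) (a := g)).contMDiffAt.mdifferentiableAt (by simp)

theorem mdifferentiableAt_mul_right (g h : G) :
    MDifferentiableAt (𝓡 d) (𝓡 d) (· * g) h :=
  (contMDiff_mul_right (I := 𝓡 d) (n := ∞) (a := g)).contMDiffAt.mdifferentiableAt (by simp)

theorem mulInvariantVectorField_mul (X : LieAlg d G) (g h : G) :
    mulInvariantVectorField X (g * h) =
      mfderiv (𝓡 d) (𝓡 d) (g * ·) h (mulInvariantVectorField X h) := by
  have e : (fun x : G => g * h * x) = (g * ·) ∘ (h * ·) := by ext x; simp [mul_assoc]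
  have := mfderiv_comp_apply (I := 𝓡 d) (I' := 𝓡 d) (I'' := 𝓡 d) (f := (h * ·)) (g := (g * ·))
    (1 : G) (mdifferentiableAt_mul_left g _) (mdifferentiableAt_mul_left h _) X
  refine (congrArg (fun f => (mfderiv (𝓡 d) (𝓡 d) f (1 : G) : EuclideanSpace ℝ (Fin d) →L[ℝ]
    EuclideanSpace ℝ (Fin d)) X) e).trans (this.trans ?_)
  exact congrArg (fun y => (mfderiv (𝓡 d) (𝓡 d) (g * ·) y : EuclideanSpace ℝ (Fin d) →L[ℝ]
    EuclideanSpace ℝ (Fin d)) (mfderiv (𝓡 d) (𝓡 d) (h * ·) 1 X)) (mul_one h)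

/-- The field is invariant under left translations, so these carry integral curves to integral
curves. This spreads the local flow at `1` over the whole group. -/
theorem _root_.IsMIntegralCurveOn.mul_left {γ : ℝ → G} {X : LieAlg d G} {s : Set ℝ}
    (h : IsMIntegralCurveOn γ (mulInvariantVectorField X) s) (g : G) :
    IsMIntegralCurveOn (fun t => g * γ t) (mulInvariantVectorField X) s := by
  intro t ht
  have h1 := (mdifferentiableAt_mul_left (d := d) g (γ t)).hasMFDerivAt.comp_hasMFDerivWithinAt t (h t ht)
  refine h1.congr_mfderiv ?_
  refine ContinuousLinearMap.ext fun r : ℝ => ?_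
  refine (map_smul (mfderiv (𝓡 d) (𝓡 d) (g * ·) (γ t)) r _).trans ?_
  exact congrArg (fun v : EuclideanSpace ℝ (Fin d) => r • v)
    (mulInvariantVectorField_mul X g (γ t)).symm

/-- A solution through `1` on `(-ε, ε)`, left translated, is a solution through any `x` on the same
interval. A uniform lifetime makes the field complete. -/
theorem exists_isMIntegralCurve_mulInvariantVectorField [T2Space G] (X : LieAlg d G) :
    ∃ γ : ℝ → G, γ 0 = 1 ∧ IsMIntegralCurve γ (mulInvariantVectorField X) := by
  have hv := (contMDiff_mulInvariantVectorField_infty X).of_le (n := ∞) (m := 1) (by simp)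
  obtain ⟨γ, h0, hγ⟩ := exists_isMIntegralCurveAt_of_contMDiffAt_boundaryless (t₀ := 0)
    (hv.contMDiffAt (x := (1 : G)))
  obtain ⟨ε, hε, hγ⟩ := isMIntegralCurveAt_iff'.1 hγ
  refine exists_isMIntegralCurve_of_isMIntegralCurveOn hv hε (fun x => ?_) 1
  refine ⟨fun t => x * γ t, by simp [h0], ?_⟩
  have := hγ.mul_left x
  rwa [Real.ball_eq_Ioo, zero_sub, zero_add] at this

/-- As functions of `t`, both sides are integral curves of one field and agree at `t = 0`; integral
curves are unique because `G` is Hausdorff. -/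
theorem map_add_of_isMIntegralCurve [T2Space G] {X : LieAlg d G} {γ : ℝ → G} (h0 : γ 0 = 1)
    (hγ : IsMIntegralCurve γ (mulInvariantVectorField X)) (s t : ℝ) :
    γ (s + t) = γ s * γ t := by
  have hv := (contMDiff_mulInvariantVectorField_infty X).of_le (n := ∞) (m := 1) (by simp)
  have h1 : IsMIntegralCurve (fun t => γ s * γ t) (mulInvariantVectorField X) := by
    rw [isMIntegralCurve_iff_isMIntegralCurveOn] at hγ ⊢
    exact hγ.mul_left _
  have h2 := hγ.comp_add s
  have := isMIntegralCurve_Ioo_eq_of_contMDiff_boundaryless (t₀ := 0) hv h2 h1 (by simp [h0])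
  have := congrFun this t
  simpa [add_comm] using this

/-- Solutions of smooth autonomous differential equations are smooth. -/
theorem contDiffAt_of_hasDerivAt_comp {E : Type*} [NormedAddCommGroup E] [NormedSpace ℝ E]
    {u : ℝ → E} {F : E → E} {t₀ : ℝ} (hF : ContDiffAt ℝ ∞ F (u t₀))
    (hu : ∀ᶠ t in 𝓝 t₀, HasDerivAt u (F (u t)) t) : ContDiffAt ℝ ∞ u t₀ := by
  rw [contDiffAt_infty]
  intro n
  -- Bootstrap: if `u` is `C^n`, then so is `u' = F ∘ u`, hence `u` is `C^{n+1}`. Only a finite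
  -- order of differentiability spreads from a point to a neighbourhood, so `n` is fixed beforehand.
  have key : ∀ n : ℕ, ∀ᶠ t in 𝓝 t₀, ContDiffAt ℝ n u t := by
    intro n
    have hF' : ∀ᶠ t in 𝓝 t₀, ContDiffAt ℝ n F (u t) :=
      hu.self_of_nhds.continuousAt.eventually
        ((hF.of_le (m := n) (mod_cast le_top)).eventually (by simp))
    induction n with
    | zero =>
      filter_upwards [hu.eventually_nhds] with t ht
      rw [Nat.cast_zero, contDiffAt_zero]
      obtain ⟨s, hs, h⟩ := Filter.eventually_iff_exists_mem.1 ht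
      exact ⟨s, hs, fun x hx => (h x hx).continuousAt.continuousWithinAt⟩
    | succ n ih =>
      have ih := ih (hF'.mono fun t h => h.of_le (by norm_cast; omega))
      filter_upwards [hu.eventually_nhds, ih, hF'] with t ht hi hf
      rw [Nat.cast_succ, contDiffAt_succ_iff_hasFDerivAt]
      obtain ⟨s, hs, h⟩ := Filter.eventually_iff_exists_mem.1 ht
      refine ⟨fun t => ContinuousLinearMap.smulRight (1 : ℝ →L[ℝ] ℝ) (F (u t)), ⟨s, hs, fun x hx => ?_⟩, ?_⟩
      · exact (h x hx).hasFDerivAt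
      · exact contDiffAt_const.smulRight
          ((hf.of_le (by norm_cast; omega)).comp t hi)
  exact (key n).self_of_nhds

omit [LieGroup (𝓡 d) ∞ G] in
theorem mulInvariantVectorField_one (X : LieAlg d G) :
    (mulInvariantVectorField X (1 : G) : EuclideanSpace ℝ (Fin d)) = X := by
  have e : (fun x : G => 1 * x) = id := by ext; simp
  refine (congrArg (fun f => (mfderiv (𝓡 d) (𝓡 d) f (1 : G) : EuclideanSpace ℝ (Fin d) →L[ℝ]
    EuclideanSpace ℝ (Fin d)) X) e).trans ?_
  exact congrArg (fun L : EuclideanSpace ℝ (Fin d) →L[ℝ] EuclideanSpace ℝ (Fin d) => L X)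
    (mfderiv_id (I := 𝓡 d) (x := (1 : G)))

/-- In the chart at `γ t₀` the curve solves an autonomous equation whose right-hand side is the
smooth coordinate expression of the field, so `contDiffAt_of_hasDerivAt_comp` applies. -/
theorem contMDiff_of_isMIntegralCurve {X : LieAlg d G} {γ : ℝ → G}
    (hγ : IsMIntegralCurve γ (mulInvariantVectorField X)) : ContMDiff 𝓘(ℝ, ℝ) (𝓡 d) ∞ γ := by
  intro t₀
  have hγ' := hγ.isMIntegralCurveAt t₀
  have hv := (contMDiff_mulInvariantVectorField_infty X).contMDiffAt (x := γ t₀)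
  rw [contMDiffAt_iff] at hv
  have hF := (hv.2.contDiffAt (range_mem_nhds_isInteriorPoint
    BoundarylessManifold.isInteriorPoint)).snd
  rw [contMDiffAt_iff_target]
  refine ⟨hγ'.continuousAt, ContDiffAt.contMDiffAt ?_⟩
  refine contDiffAt_of_hasDerivAt_comp hF ?_
  have hsrc : ∀ᶠ t in 𝓝 t₀, γ t ∈ (extChartAt (𝓡 d) (γ t₀)).source :=
    hγ'.continuousAt.eventually (extChartAt_source_mem_nhds (γ t₀))
  filter_upwards [hsrc, hγ'.eventually_hasDerivAt] with t ht1 ht2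
  apply ht2.congr_deriv
  exact congrArg (fun g => tangentCoordChange (𝓡 d) g (γ t₀) g (mulInvariantVectorField X g))
    (PartialEquiv.left_inv _ ht1).symm

/-- The axiom `infinitesimal` of a `G`-differential algebra speaks of given one-parameter subgroups;
existence is what makes it usable for every `X`. -/
theorem exists_isOneParameterSubgroup [T2Space G] (X : LieAlg d G) :
    ∃ γ : ℝ → G, IsOneParameterSubgroup γ X := by
  obtain ⟨γ, h0, hγ⟩ := exists_isMIntegralCurve_mulInvariantVectorField X
  refine ⟨γ, map_add_of_isMIntegralCurve h0 hγ, contMDiff_of_isMIntegralCurve hγ, ?_⟩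
  refine (congrArg (fun L : ℝ →L[ℝ] EuclideanSpace ℝ (Fin d) => L 1) (hγ 0).mfderiv).trans ?_
  refine (one_smul ℝ (mulInvariantVectorField X (γ 0) : EuclideanSpace ℝ (Fin d))).trans ?_
  rw [h0]
  exact mulInvariantVectorField_one X

end
end ChernWeil

/-! ### The derivative of the adjoint action, computed in the chart at the identity. -/

namespace ChernWeil
section
variable {d : ℕ} (G : Type v) [TopologicalSpace G]
    [ChartedSpace (EuclideanSpace ℝ (Fin d)) G] [Group G]

/-- The multiplication of `G` in the chart at `1`. -/
noncomputable def chartMul (p : EuclideanSpace ℝ (Fin d) × EuclideanSpace ℝ (Fin d)) :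
    EuclideanSpace ℝ (Fin d) :=
  extChartAt (𝓡 d) (1 : G)
    ((extChartAt (𝓡 d) (1 : G)).symm p.1 * (extChartAt (𝓡 d) (1 : G)).symm p.2)

/-- The image of `1` in the chart at `1`. -/
noncomputable def chartOne : EuclideanSpace ℝ (Fin d) := extChartAt (𝓡 d) (1 : G) 1

theorem chart_symm_chartOne : (extChartAt (𝓡 d) (1 : G)).symm (chartOne G) = 1 :=
  extChartAt_to_inv (I := 𝓡 d) (1 : G)

variable {G} in
/-- The derivative of the chart at `1`. -/
noncomputable def dChart (g : G) : EuclideanSpace ℝ (Fin d) →L[ℝ] EuclideanSpace ℝ (Fin d) :=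
  mfderiv (𝓡 d) 𝓘(ℝ, EuclideanSpace ℝ (Fin d)) (extChartAt (𝓡 d) (1 : G)) g

variable {G} in
/-- The derivative at `1` of a self-map of `G`. -/
noncomputable def dOne (h : G → G) : EuclideanSpace ℝ (Fin d) →L[ℝ] EuclideanSpace ℝ (Fin d) :=
  mfderiv (𝓡 d) (𝓡 d) h 1

variable {G} in
/-- An element of the Lie algebra as a vector of the model space. -/
def vec (X : LieAlg d G) : EuclideanSpace ℝ (Fin d) := X

variable [LieGroup (𝓡 d) ∞ G]

theorem dChart_one : dChart (d := d) (1 : G) = ContinuousLinearMap.id ℝ _ :=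
  have : IsManifold (𝓡 d) 1 G := IsManifold.of_le (n := ∞) (by simp)
  mfderiv_extChartAt_self (I := 𝓡 d) (x := (1 : G))

theorem contDiffAt_chartMul : ContDiffAt ℝ ∞ (chartMul (d := d) G) (chartOne G, chartOne G) := by
  have hs : ContMDiffAt 𝓘(ℝ, EuclideanSpace ℝ (Fin d)) (𝓡 d) ∞
      (extChartAt (𝓡 d) (1 : G)).symm (chartOne G) :=
    (contMDiffOn_extChartAt_symm (n := ∞) (1 : G)).contMDiffAt (extChartAt_target_mem_nhds (1 : G))
  have h1 := hs.comp (I := 𝓘(ℝ, EuclideanSpace ℝ (Fin d) × EuclideanSpace ℝ (Fin d)))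
    (chartOne G, chartOne G) (contDiff_fst (n := ∞) (𝕜 := ℝ)).contMDiff.contMDiffAt
  have h2 := hs.comp (I := 𝓘(ℝ, EuclideanSpace ℝ (Fin d) × EuclideanSpace ℝ (Fin d)))
    (chartOne G, chartOne G) (contDiff_snd (n := ∞) (𝕜 := ℝ)).contMDiff.contMDiffAt
  rw [← contMDiffAt_iff_contDiffAt]
  have h3 : ContMDiffAt (𝓡 d) 𝓘(ℝ, EuclideanSpace ℝ (Fin d)) ∞ (extChartAt (𝓡 d) (1 : G))
      ((extChartAt (𝓡 d) (1 : G)).symm (chartOne G) *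
        (extChartAt (𝓡 d) (1 : G)).symm (chartOne G)) := by
    rw [chart_symm_chartOne, mul_one]
    exact contMDiffAt_extChartAt
  exact ContMDiffAt.comp (chartOne G, chartOne G) h3 (h1.mul h2)

variable {G}

/-- The chain rule at the point `1`. The value `h 1` has to lie in the domain of the chart but need
not be `1`, so that `h` may be a translation by a nearby element. -/
theorem hasFDerivAt_chart_conj {h : G → G} (hh : MDifferentiableAt (𝓡 d) (𝓡 d) h 1)
    (hs : h 1 ∈ (extChartAt (𝓡 d) (1 : G)).source) :
    HasFDerivAt (fun y => extChartAt (𝓡 d) (1 : G) (h ((extChartAt (𝓡 d) (1 : G)).symm y)))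
      ((dChart (h 1)).comp (dOne h)) (chartOne G) := by
  have he : MDifferentiableAt (𝓡 d) 𝓘(ℝ, EuclideanSpace ℝ (Fin d)) (extChartAt (𝓡 d) (1 : G))
      (h 1) := by
    rw [extChartAt_source] at hs
    exact (contMDiffAt_extChartAt' (n := ∞) hs).mdifferentiableAt (by simp)
  have : HasFDerivWithinAt
      (fun y => extChartAt (𝓡 d) (1 : G) (h ((extChartAt (𝓡 d) (1 : G)).symm y)))
      ((dChart (h 1)).comp (dOne h)) (Set.range (𝓡 d)) (chartOne G) :=
    (he.hasMFDerivAt.comp 1 hh.hasMFDerivAt).2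
  have r : Set.range (𝓡 d) = Set.univ := by simp
  rw [r, hasFDerivWithinAt_univ] at this
  exact this

theorem eventually_differentiableAt_chartMul_left :
    ∀ᶠ g in 𝓝 (1 : G), DifferentiableAt ℝ (chartMul (d := d) G)
      (extChartAt (𝓡 d) (1 : G) g, chartOne G) := by
  have h := (contDiffAt_chartMul (d := d) G).of_le (m := 1) (by simp)
  have h := (h.eventually (by simp)).mono fun p hp => hp.differentiableAt (by simp)
  have hc : ContinuousAt (fun g : G => (extChartAt (𝓡 d) (1 : G) g, chartOne (d := d) G)) 1 :=
    (continuousAt_extChartAt (1 : G)).prodMk continuousAt_const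
  exact hc.eventually h

theorem eventually_differentiableAt_chartMul_right :
    ∀ᶠ g in 𝓝 (1 : G), DifferentiableAt ℝ (chartMul (d := d) G)
      (chartOne G, extChartAt (𝓡 d) (1 : G) g) := by
  have h := (contDiffAt_chartMul (d := d) G).of_le (m := 1) (by simp)
  have h := (h.eventually (by simp)).mono fun p hp => hp.differentiableAt (by simp)
  have hc : ContinuousAt (fun g : G => (chartOne (d := d) G, extChartAt (𝓡 d) (1 : G) g)) 1 :=
    continuousAt_const.prodMk (continuousAt_extChartAt (1 : G))
  exact hc.eventually h

/-- With the first argument fixed at `g`, the coordinate multiplication is the left translation by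
`g` read in the chart. Together with the `inl` version, both kinds of translation become partial
derivatives of one smooth function. -/
theorem eventually_fderiv_chartMul_inr :
    ∀ᶠ g in 𝓝 (1 : G), fderiv ℝ (chartMul (d := d) G) (extChartAt (𝓡 d) (1 : G) g, chartOne G) ∘L
      ContinuousLinearMap.inr ℝ _ _ = (dChart g).comp (dOne (g * ·)) := by
  filter_upwards [eventually_differentiableAt_chartMul_left (d := d),
    extChartAt_source_mem_nhds (I := 𝓡 d) (1 : G)] with g hg hs
  have h1 := hg.hasFDerivAt.comp (chartOne G) (hasFDerivAt_prodMk_right _ _)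
  have h2 := hasFDerivAt_chart_conj (h := (g * ·)) (mdifferentiableAt_mul_left (d := d) g 1)
    (by simpa using hs)
  simp only [mul_one] at h2
  refine h1.unique (h2.congr_of_eventuallyEq (Filter.Eventually.of_forall fun y => ?_))
  simp only [Function.comp_apply, chartMul]
  rw [PartialEquiv.left_inv _ hs]

theorem eventually_fderiv_chartMul_inl :
    ∀ᶠ g in 𝓝 (1 : G), fderiv ℝ (chartMul (d := d) G) (chartOne G, extChartAt (𝓡 d) (1 : G) g) ∘L
      ContinuousLinearMap.inl ℝ _ _ = (dChart g).comp (dOne (· * g)) := by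
  filter_upwards [eventually_differentiableAt_chartMul_right (d := d),
    extChartAt_source_mem_nhds (I := 𝓡 d) (1 : G)] with g hg hs
  have h1 := hg.hasFDerivAt.comp (f := fun y => (y, extChartAt (𝓡 d) (1 : G) g)) (chartOne G)
    (hasFDerivAt_prodMk_left _ _)
  have h2 := hasFDerivAt_chart_conj (h := (· * g)) (mdifferentiableAt_mul_right (d := d) g 1)
    (by simpa using hs)
  simp only [one_mul] at h2
  refine h1.unique (h2.congr_of_eventuallyEq (Filter.Eventually.of_forall fun y => ?_))
  simp only [Function.comp_apply, chartMul]
  rw [PartialEquiv.left_inv _ hs]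

/-- Differentiate `g x = (g x g⁻¹) g` at `x = 1`. This relates `Ad g` to the two translations
without differentiating in `g⁻¹`. -/
theorem dOne_mul_right_Ad (g : G) (Y : LieAlg d G) : dOne (· * g) (Ad g Y) = dOne (g * ·) Y := by
  have e : (g * ·) = (· * g) ∘ (fun x : G => g * x * g⁻¹) := by ext x; simp
  have h1 : MDifferentiableAt (𝓡 d) (𝓡 d) (fun x : G => g * x * g⁻¹) 1 :=
    (mdifferentiableAt_mul_right (d := d) g⁻¹ (g * 1)).comp 1 (mdifferentiableAt_mul_left g 1)
  have h2 := mfderiv_comp_apply (I := 𝓡 d) (I' := 𝓡 d) (I'' := 𝓡 d) (f := fun x : G => g * x * g⁻¹)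
    (g := (· * g)) (1 : G) (mdifferentiableAt_mul_right g _) h1 Y
  refine Eq.trans ?_ ((congrArg (fun f => dOne f Y) e).trans h2).symm
  exact congrArg (fun y : G => (mfderiv (𝓡 d) (𝓡 d) (· * g) y : EuclideanSpace ℝ (Fin d) →L[ℝ]
    EuclideanSpace ℝ (Fin d)) (Ad g Y)) (by simp : (1 : G) = g * 1 * g⁻¹)

theorem fderiv_chartMul_inl_one : fderiv ℝ (chartMul (d := d) G) (chartOne G, chartOne G) ∘L
    ContinuousLinearMap.inl ℝ _ _ = ContinuousLinearMap.id ℝ _ := by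
  have h := (eventually_fderiv_chartMul_inl (d := d) (G := G)).self_of_nhds
  have e : (· * (1 : G)) = id := by ext; simp
  have h2 : dOne (d := d) (· * (1 : G)) = ContinuousLinearMap.id ℝ _ :=
    (congrArg dOne e).trans (mfderiv_id (I := 𝓡 d) (x := (1 : G)))
  rw [h2, dChart_one] at h
  exact h

theorem fderiv_chartMul_inr_one : fderiv ℝ (chartMul (d := d) G) (chartOne G, chartOne G) ∘L
    ContinuousLinearMap.inr ℝ _ _ = ContinuousLinearMap.id ℝ _ := by
  have h := (eventually_fderiv_chartMul_inr (d := d) (G := G)).self_of_nhds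
  have e : ((1 : G) * ·) = id := by ext; simp
  have h2 : dOne (d := d) ((1 : G) * ·) = ContinuousLinearMap.id ℝ _ :=
    (congrArg dOne e).trans (mfderiv_id (I := 𝓡 d) (x := (1 : G)))
  rw [h2, dChart_one] at h
  exact h

variable (G) in
/-- The second derivative at `1` of the multiplication in the chart at `1`. -/
noncomputable def sndChartMul : EuclideanSpace ℝ (Fin d) × EuclideanSpace ℝ (Fin d) →L[ℝ]
    (EuclideanSpace ℝ (Fin d) × EuclideanSpace ℝ (Fin d) →L[ℝ] EuclideanSpace ℝ (Fin d)) :=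
  fderiv ℝ (fderiv ℝ (chartMul G)) (chartOne G, chartOne G)

theorem sndChartMul_symm (v w : EuclideanSpace ℝ (Fin d) × EuclideanSpace ℝ (Fin d)) :
    sndChartMul G v w = sndChartMul G w v :=
  (contDiffAt_infty.1 (contDiffAt_chartMul (d := d) G) 2).isSymmSndFDerivAt
    (by rw [minSmoothness_of_isRCLikeNormedField]; rfl) v w

theorem hasFDerivAt_fderiv_chartMul : HasFDerivAt (fderiv ℝ (chartMul (d := d) G)) (sndChartMul G)
    (chartOne G, chartOne G) :=
  (((contDiffAt_infty.1 (contDiffAt_chartMul (d := d) G) 2).fderiv_right (m := 1) le_rfl).differentiableAt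
    one_ne_zero).hasFDerivAt

/-- A left invariant vector field in the chart at `1`. -/
noncomputable def chartField (X : LieAlg d G) (x : EuclideanSpace ℝ (Fin d)) :
    EuclideanSpace ℝ (Fin d) :=
  VectorField.mpullbackWithin 𝓘(ℝ, EuclideanSpace ℝ (Fin d)) (𝓡 d)
    (extChartAt (𝓡 d) (1 : G)).symm (mulInvariantVectorField X) (Set.range (𝓡 d)) x

/-- The field at `g` is the image of `X` under the left translation by `g`, and the pull-back by the
inverse chart contributes the derivative of the chart; `eventually_fderiv_chartMul_inr` identifies
the composite. -/
theorem eventually_chartField (X : LieAlg d G) : chartField X =ᶠ[𝓝 (chartOne G)]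
      fun x => fderiv ℝ (chartMul (d := d) G) (x, chartOne G) (0, vec X) := by
  have : IsManifold (𝓡 d) 1 G := IsManifold.of_le (n := ∞) (by simp)
  have hc := continuousAt_extChartAt_symm (I := 𝓡 d) (1 : G)
  rw [ContinuousAt, extChartAt_to_inv] at hc
  have h1 := hc.eventually (eventually_fderiv_chartMul_inr (d := d) (G := G))
  filter_upwards [h1, extChartAt_target_mem_nhds (I := 𝓡 d) (1 : G)] with x hx hxt
  rw [PartialEquiv.right_inv _ hxt] at hx
  have h2 := ContinuousLinearMap.inverse_eq
    (mfderivWithin_extChartAt_symm_comp_mfderiv_extChartAt (I := 𝓡 d) (x := (1 : G)) hxt)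
    (mfderiv_extChartAt_comp_mfderivWithin_extChartAt_symm (I := 𝓡 d) (x := (1 : G)) hxt)
  have h3 := congrArg (fun L : EuclideanSpace ℝ (Fin d) →L[ℝ] EuclideanSpace ℝ (Fin d) => L X) hx
  refine Eq.trans ?_ h3.symm
  exact congrArg (fun L : EuclideanSpace ℝ (Fin d) →L[ℝ] EuclideanSpace ℝ (Fin d) =>
    L (mulInvariantVectorField X ((extChartAt (𝓡 d) (1 : G)).symm x))) h2

theorem hasFDerivAt_chartField (X : EuclideanSpace ℝ (Fin d)) :
    HasFDerivAt (fun x => fderiv ℝ (chartMul (d := d) G) (x, chartOne G) (0, X))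
      ((ContinuousLinearMap.apply ℝ _ (0, X)).comp
        ((sndChartMul G).comp (ContinuousLinearMap.inl ℝ _ _))) (chartOne G) :=
  (ContinuousLinearMap.apply ℝ (EuclideanSpace ℝ (Fin d)) ((0 : EuclideanSpace ℝ (Fin d)), X)).hasFDerivAt.comp
    (chartOne G) ((hasFDerivAt_fderiv_chartMul (d := d) (G := G)).comp
      (f := fun y => (y, chartOne G)) (chartOne G) (hasFDerivAt_prodMk_left _ _))

/-- Write `V_X(x) = ∂₂μ(x, 1) X` for the field in the chart. As `V_X = X` at the identity, the
bracket `DV_Y(V_X) - DV_X(V_Y)` there involves only mixed second derivatives of the multiplication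
`μ`. -/
theorem bracket_eq_sndChartMul (X Y : LieAlg d G) : vec ⁅X, Y⁆ =
    sndChartMul G (vec X, 0) (0, vec Y) - sndChartMul G (vec Y, 0) (0, vec X) := by
  have h1 : vec ⁅X, Y⁆ = (dChart (d := d) (1 : G)).inverse
    (VectorField.lieBracketWithin ℝ (chartField X) (chartField Y)
      ((extChartAt (𝓡 d) (1 : G)).symm ⁻¹' Set.univ ∩ Set.range (𝓡 d)) (chartOne G)) :=
    VectorField.mlieBracketWithin_apply
  have r : (extChartAt (𝓡 d) (1 : G)).symm ⁻¹' Set.univ ∩ Set.range (𝓡 d) = Set.univ := by simp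
  rw [dChart_one, ContinuousLinearMap.inverse_id, r, VectorField.lieBracketWithin_univ,
    (eventually_chartField X).lieBracket_vectorField_eq (eventually_chartField Y)] at h1
  refine h1.trans ?_
  have k : ∀ Z : EuclideanSpace ℝ (Fin d),
      fderiv ℝ (chartMul (d := d) G) (chartOne G, chartOne G) (0, Z) = Z := fun Z =>
    congrArg (fun L : EuclideanSpace ℝ (Fin d) →L[ℝ] EuclideanSpace ℝ (Fin d) => L Z)
      (fderiv_chartMul_inr_one (G := G))
  rw [VectorField.lieBracket, (hasFDerivAt_chartField (G := G) (vec Y)).fderiv,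
    (hasFDerivAt_chartField (G := G) (vec X)).fderiv, k, k]
  rfl

namespace IsOneParameterSubgroup

omit [LieGroup (𝓡 d) ∞ G] in
theorem map_zero {γ : ℝ → G} {X : LieAlg d G} (h : IsOneParameterSubgroup γ X) : γ 0 = 1 := by
  have := h.map_add 0 0
  rw [add_zero] at this
  exact (left_eq_mul.1 this)

theorem hasDerivAt_chart {γ : ℝ → G} {X : LieAlg d G} (h : IsOneParameterSubgroup γ X) :
    HasDerivAt (fun t => extChartAt (𝓡 d) (1 : G) (γ t)) (vec X) 0 := by
  have h1 : HasMFDerivAt 𝓘(ℝ, ℝ) (𝓡 d) γ 0 (mfderiv 𝓘(ℝ, ℝ) (𝓡 d) γ 0) :=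
    (h.smooth.contMDiffAt.mdifferentiableAt (by simp)).hasMFDerivAt
  have h2 : HasMFDerivAt (𝓡 d) 𝓘(ℝ, EuclideanSpace ℝ (Fin d)) (extChartAt (𝓡 d) (1 : G)) (γ 0)
      (dChart (d := d) (γ 0)) := by
    rw [h.map_zero]
    exact ((contMDiffAt_extChartAt (n := ∞) (x := (1 : G))).mdifferentiableAt (by simp)).hasMFDerivAt
  have h3 : HasFDerivAt (fun t => extChartAt (𝓡 d) (1 : G) (γ t))
      ((dChart (γ 0)).comp (mfderiv 𝓘(ℝ, ℝ) (𝓡 d) γ 0 : ℝ →L[ℝ] EuclideanSpace ℝ (Fin d))) 0 :=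
    hasMFDerivAt_iff_hasFDerivAt.1 (h2.comp 0 h1)
  refine h3.hasDerivAt.congr_deriv ?_
  have h4 : dChart (d := d) (γ 0) = ContinuousLinearMap.id ℝ _ := by rw [h.map_zero, dChart_one]
  exact (congrArg (fun L : EuclideanSpace ℝ (Fin d) →L[ℝ] EuclideanSpace ℝ (Fin d) =>
    L (mfderiv 𝓘(ℝ, ℝ) (𝓡 d) γ 0 (1 : ℝ))) h4).trans h.velocity

/-- The derivative of `t ↦ Ad (exp (t X)) Y` at `0` is `[X, Y]`. -/
theorem hasDerivAt_Ad {γ : ℝ → G} {X : LieAlg d G} (h : IsOneParameterSubgroup γ X)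
    (Y : LieAlg d G) : HasDerivAt (fun t => vec (Ad (γ t) Y)) (vec ⁅X, Y⁆) 0 := by
  let u : ℝ → EuclideanSpace ℝ (Fin d) := fun t => extChartAt (𝓡 d) (1 : G) (γ t)
  have hu : HasDerivAt u (vec X) 0 := h.hasDerivAt_chart
  have hu0 : u 0 = chartOne G := by simp [u, h.map_zero, chartOne]
  have hγ : Filter.Tendsto γ (𝓝 0) (𝓝 1) := by
    have := h.smooth.continuous.continuousAt (x := 0)
    rwa [ContinuousAt, h.map_zero] at this
  -- `P t` and `B t` are the derivatives at `1` of the right and left translations by `γ t`, read in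
  -- the chart, so `P t (Ad (γ t) Y) = B t Y`. Since `P 0 = B 0 = 1`, the derivative of `P⁻¹ B` at
  -- `0` is `B' - P'`.
  let P : ℝ → (EuclideanSpace ℝ (Fin d) →L[ℝ] EuclideanSpace ℝ (Fin d)) := fun t =>
    fderiv ℝ (chartMul (d := d) G) (chartOne G, u t) ∘L ContinuousLinearMap.inl ℝ _ _
  let B : ℝ → (EuclideanSpace ℝ (Fin d) →L[ℝ] EuclideanSpace ℝ (Fin d)) := fun t =>
    fderiv ℝ (chartMul (d := d) G) (u t, chartOne G) ∘L ContinuousLinearMap.inr ℝ _ _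
  have hAd : ∀ᶠ t in 𝓝 (0 : ℝ), P t (vec (Ad (γ t) Y)) = B t (vec Y) := by
    filter_upwards [hγ.eventually (eventually_fderiv_chartMul_inl (d := d)),
      hγ.eventually (eventually_fderiv_chartMul_inr (d := d))] with t h1 h2
    simp only [P, B, u, h1, h2, ContinuousLinearMap.comp_apply]
    exact congrArg (dChart (γ t)) (dOne_mul_right_Ad (γ t) Y)
  have hP0 : P 0 = 1 := by
    have := fderiv_chartMul_inl_one (d := d) (G := G)
    rw [← hu0] at this
    simp only [P]
    rw [← hu0]
    exact this
  have hB0 : B 0 = 1 := by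
    have := fderiv_chartMul_inr_one (d := d) (G := G)
    rw [← hu0] at this
    simp only [B]
    rw [← hu0]
    exact this
  have hF : HasFDerivAt (fderiv ℝ (chartMul (d := d) G)) (sndChartMul G) (chartOne G, u 0) := by
    rw [hu0]; exact hasFDerivAt_fderiv_chartMul
  have hF' : HasFDerivAt (fderiv ℝ (chartMul (d := d) G)) (sndChartMul G) (u 0, chartOne G) := by
    rw [hu0]; exact hasFDerivAt_fderiv_chartMul
  have hP : HasDerivAt P (sndChartMul G (0, vec X) ∘L ContinuousLinearMap.inl ℝ _ _) 0 := by
    have := (hF.comp_hasDerivAt (f := fun t => (chartOne G, u t)) 0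
      ((hasDerivAt_const 0 (chartOne G)).prodMk hu)).clm_comp
      (hasDerivAt_const 0 (ContinuousLinearMap.inl ℝ _ _))
    simpa using this
  have hB : HasDerivAt B (sndChartMul G (vec X, 0) ∘L ContinuousLinearMap.inr ℝ _ _) 0 := by
    have := (hF'.comp_hasDerivAt (f := fun t => (u t, chartOne G)) 0
      (hu.prodMk (hasDerivAt_const 0 (chartOne G)))).clm_comp
      (hasDerivAt_const 0 (ContinuousLinearMap.inr ℝ _ _))
    simpa using this
  have hinv : HasDerivAt (fun t => Ring.inverse (P t))
      (-(sndChartMul G (0, vec X) ∘L ContinuousLinearMap.inl ℝ _ _)) 0 := by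
    have h1 := hasFDerivAt_ringInverse (𝕜 := ℝ)
      (1 : (EuclideanSpace ℝ (Fin d) →L[ℝ] EuclideanSpace ℝ (Fin d))ˣ)
    rw [Units.val_one, ← hP0] at h1
    refine (h1.comp_hasDerivAt 0 hP).congr_deriv ?_
    simp
  have hq := hinv.clm_apply (hB.clm_apply (hasDerivAt_const 0 (vec Y)))
  -- Units are open, so `P t` is invertible near `t = 0`; there `Ring.inverse` is a true inverse.
  have hunit : ∀ᶠ t in 𝓝 (0 : ℝ), IsUnit (P t) :=
    hP.continuousAt.eventually (Units.isOpen.mem_nhds (by rw [hP0]; exact isUnit_one))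
  have heq : (fun t => vec (Ad (γ t) Y)) =ᶠ[𝓝 0] fun t => Ring.inverse (P t) (B t (vec Y)) := by
    filter_upwards [hAd, hunit] with t h1 h2
    rw [← h1, ← mul_apply_eq_comp, Ring.inverse_mul_cancel (P t) h2,
      one_apply_eq_self]
  refine (hq.congr_of_eventuallyEq heq).congr_deriv ?_
  -- The derivative found is `D²μ((X,0),(0,Y)) - D²μ((0,X),(Y,0))`; the symmetry of `D²μ` identifies
  -- it with the bracket.
  rw [bracket_eq_sndChartMul, hP0, hB0, Ring.inverse_one, sndChartMul_symm (vec Y, 0)]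
  simp [sub_eq_neg_add]

end IsOneParameterSubgroup

end
end ChernWeil

/-! ### Invariant polynomials and their infinitesimal invariance. -/

namespace ChernWeil
section
variable {d : ℕ} {G : Type v} [TopologicalSpace G]
    [ChartedSpace (EuclideanSpace ℝ (Fin d)) G] [Group G]

instance : Module.Finite ℝ (LieAlg d G) :=
  inferInstanceAs (Module.Finite ℝ (EuclideanSpace ℝ (Fin d)))

/-- Evaluation of polynomials at a point of the Lie algebra. -/
noncomputable def evalAt (Y : LieAlg d G) : SymDual d G →ₐ[ℝ] ℝ :=
  SymmetricAlgebra.lift (Module.Dual.eval ℝ _ Y)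

theorem evalAt_ι (Y : LieAlg d G) (ξ : Module.Dual ℝ (LieAlg d G)) :
    evalAt Y (SymmetricAlgebra.ι ℝ _ ξ) = ξ Y := by
  simp [evalAt]

/-- In a basis, `S(𝔤^*)` is a polynomial ring over the infinite field `ℝ`, where polynomials are
determined by their values. Identities in `S(𝔤^*)` can thus be checked by calculus at points of `𝔤`.
-/
theorem eq_zero_of_evalAt {f : SymDual d G} (h : ∀ Y : LieAlg d G, evalAt Y f = 0) : f = 0 := by
  let b := Module.finBasis ℝ (LieAlg d G)
  let e := SymmetricAlgebra.equivMvPolynomial b.dualBasis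
  have key : ∀ Y : LieAlg d G, evalAt Y =
      (MvPolynomial.aeval fun i => b.repr Y i).comp e.toAlgHom := fun Y => by
    refine SymmetricAlgebra.algHom_ext (b.dualBasis.ext fun i => ?_)
    have h1 := SymmetricAlgebra.equivMvPolynomial_ι_apply b.dualBasis i
    change evalAt Y (SymmetricAlgebra.ι ℝ _ (b.dualBasis i)) =
      MvPolynomial.aeval (fun i => b.repr Y i) (e (SymmetricAlgebra.ι ℝ _ (b.dualBasis i)))
    rw [evalAt_ι, h1, MvPolynomial.aeval_X, Module.Basis.dualBasis_apply]
  refine e.injective (MvPolynomial.funext fun x => ?_)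
  have h1 := h (b.equivFun.symm x)
  rw [key] at h1
  rw [map_zero, map_zero, ← MvPolynomial.coe_aeval_eq_eval]
  refine Eq.trans ?_ h1
  have : (fun i => b.repr (b.equivFun.symm x) i) = x := by
    funext i
    exact congrFun (b.equivFun.apply_symm_apply x) i
  rw [this]
  rfl

theorem coadjoint_ι (g : G) (ξ : Module.Dual ℝ (LieAlg d G)) :
    coadjoint g (SymmetricAlgebra.ι ℝ _ ξ) = SymmetricAlgebra.ι ℝ _ (ξ ∘ₗ Ad g⁻¹) := by
  rw [coadjoint, SymmetricAlgebra.lift_ι_apply]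
  rfl

theorem evalAt_Ad (g : G) (Y : LieAlg d G) (f : SymDual d G) :
    evalAt (Ad g Y) f = evalAt Y (coadjoint g⁻¹ f) := by
  have : evalAt (Ad g Y) = (evalAt Y).comp (coadjoint (d := d) g⁻¹) := by
    refine SymmetricAlgebra.algHom_ext (LinearMap.ext fun ξ => ?_)
    simp [evalAt_ι, coadjoint_ι]
  rw [this, AlgHom.comp_apply]

theorem evalAt_Ad_of_invariant (g : G) (Y : LieAlg d G) {f : SymDual d G}
    (hf : f ∈ invariantPolys d G) : evalAt (Ad g Y) f = evalAt Y f := by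
  rw [evalAt_Ad]
  rw [invariantPolys, Algebra.mem_iInf] at hf
  exact congrArg _ (hf g⁻¹)

variable [LieGroup (𝓡 d) ∞ G]

/-- The algebra homomorphism `f ↦ f + ε L_X f` to dual numbers, where `L_X` is the derivation
extending `ξ ↦ ξ ∘ ad X`. -/
noncomputable def dualCoad (X : LieAlg d G) : SymDual d G →ₐ[ℝ] DualNumber (SymDual d G) :=
  SymmetricAlgebra.lift
    ((TrivSqZeroExt.inlAlgHom ℝ (SymDual d G) (SymDual d G)).toLinearMap ∘ₗ
        SymmetricAlgebra.ι ℝ _ +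
      (TrivSqZeroExt.inrHom (SymDual d G) (SymDual d G)).restrictScalars ℝ ∘ₗ
        SymmetricAlgebra.ι ℝ _ ∘ₗ (LieAlgebra.ad ℝ (LieAlg d G) X : LieAlg d G →ₗ[ℝ] LieAlg d G).dualMap)

theorem dualCoad_ι (X : LieAlg d G) (ξ : Module.Dual ℝ (LieAlg d G)) :
    dualCoad X (SymmetricAlgebra.ι ℝ _ ξ) = TrivSqZeroExt.inl (SymmetricAlgebra.ι ℝ _ ξ) +
      TrivSqZeroExt.inr (SymmetricAlgebra.ι ℝ _ (ξ ∘ₗ (LieAlgebra.ad ℝ (LieAlg d G) X))) := by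
  rw [dualCoad, SymmetricAlgebra.lift_ι_apply]
  rfl

theorem fst_dualCoad (X : LieAlg d G) (f : SymDual d G) : (dualCoad X f).fst = f := by
  have : (TrivSqZeroExt.fstHom ℝ (SymDual d G) (SymDual d G)).comp (dualCoad X) = AlgHom.id ℝ _ := by
    refine SymmetricAlgebra.algHom_ext (LinearMap.ext fun ξ => ?_)
    simp [dualCoad_ι]
  exact AlgHom.congr_fun this f

/-- The derivation of `S(𝔤^*)` extending `ξ ↦ ξ ∘ ad X`. -/
noncomputable def coadDeriv (X : LieAlg d G) (f : SymDual d G) : SymDual d G := (dualCoad X f).snd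

theorem coadDeriv_ι (X : LieAlg d G) (ξ : Module.Dual ℝ (LieAlg d G)) :
    coadDeriv X (SymmetricAlgebra.ι ℝ _ ξ) =
      SymmetricAlgebra.ι ℝ _ (ξ ∘ₗ (LieAlgebra.ad ℝ (LieAlg d G) X)) := by
  simp [coadDeriv, dualCoad_ι]

theorem coadDeriv_algebraMap (X : LieAlg d G) (r : ℝ) :
    coadDeriv X (algebraMap ℝ (SymDual d G) r) = 0 := by
  rw [coadDeriv, AlgHom.commutes]
  rfl

theorem coadDeriv_add (X : LieAlg d G) (f f' : SymDual d G) :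
    coadDeriv X (f + f') = coadDeriv X f + coadDeriv X f' := by
  simp [coadDeriv]

/-- The Leibniz rule is the multiplicativity of `dualCoad`, read in its `ε` component. -/
theorem coadDeriv_mul (X : LieAlg d G) (f f' : SymDual d G) :
    coadDeriv X (f * f') = f * coadDeriv X f' + coadDeriv X f * f' := by
  simp [coadDeriv, fst_dualCoad, mul_comm]

namespace IsOneParameterSubgroup

omit [LieGroup (𝓡 d) ∞ G] in
theorem continuous_dual (ξ : Module.Dual ℝ (LieAlg d G)) :
    ∃ L : EuclideanSpace ℝ (Fin d) →L[ℝ] ℝ, ∀ Y, ξ Y = L (vec Y) :=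
  ⟨LinearMap.toContinuousLinearMap (E := EuclideanSpace ℝ (Fin d))
    ({ toFun := fun Y => ξ Y, map_add' := ξ.map_add, map_smul' := ξ.map_smul } :
      EuclideanSpace ℝ (Fin d) →ₗ[ℝ] ℝ), fun _ => rfl⟩

theorem hasDerivAt_dual_Ad {γ : ℝ → G} {X : LieAlg d G} (h : IsOneParameterSubgroup γ X)
    (ξ : Module.Dual ℝ (LieAlg d G)) (Y : LieAlg d G) :
    HasDerivAt (fun t => ξ (Ad (γ t) Y)) (ξ ⁅X, Y⁆) 0 := by
  obtain ⟨L, hL⟩ := continuous_dual ξ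
  simp only [hL]
  exact L.hasFDerivAt.comp_hasDerivAt 0 (h.hasDerivAt_Ad Y)

omit [LieGroup (𝓡 d) ∞ G] in
theorem _root_.ChernWeil.Ad_one (Y : LieAlg d G) : Ad (1 : G) Y = Y := by
  have e : (fun x : G => 1 * x * 1⁻¹) = id := by ext; simp
  exact (congrArg (fun f => dOne f (vec Y)) e).trans
    (congrArg (fun L : EuclideanSpace ℝ (Fin d) →L[ℝ] EuclideanSpace ℝ (Fin d) => L (vec Y))
      (mfderiv_id (I := 𝓡 d) (x := (1 : G))))

/-- Both sides obey the product rule, as `Ad (γ 0)` is the identity, so the claim reduces to linear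
forms and hence to `hasDerivAt_Ad`. -/
theorem hasDerivAt_evalAt_Ad {γ : ℝ → G} {X : LieAlg d G} (h : IsOneParameterSubgroup γ X)
    (Y : LieAlg d G) (f : SymDual d G) :
    HasDerivAt (fun t => evalAt (Ad (γ t) Y) f) (evalAt Y (coadDeriv X f)) 0 := by
  induction f using SymmetricAlgebra.induction with
  | algebraMap r =>
    simpa [coadDeriv_algebraMap] using hasDerivAt_const (0 : ℝ) r
  | ι ξ =>
    simp only [evalAt_ι, coadDeriv_ι]
    exact h.hasDerivAt_dual_Ad ξ Y
  | add a b ha hb =>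
    simp only [_root_.map_add, coadDeriv_add]
    exact ha.add hb
  | mul a b ha hb =>
    simp only [map_mul, coadDeriv_mul, _root_.map_add]
    refine (ha.mul hb).congr_deriv ?_
    rw [h.map_zero, Ad_one, add_comm]

end IsOneParameterSubgroup

/-- The function `t ↦ f(Ad (γ t) Y)` is constant, and its derivative at `0` is the value of
`coadDeriv X f` at `Y`; a polynomial vanishing at all points is zero. -/
theorem coadDeriv_of_invariant [T2Space G] (X : LieAlg d G) {f : SymDual d G}
    (hf : f ∈ invariantPolys d G) : coadDeriv X f = 0 := by
  obtain ⟨γ, h⟩ := exists_isOneParameterSubgroup X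
  refine eq_zero_of_evalAt fun Y => ?_
  have h1 := h.hasDerivAt_evalAt_Ad Y f
  simp only [evalAt_Ad_of_invariant _ _ hf] at h1
  exact h1.unique (hasDerivAt_const _ _)

/-! ### The abstract Bianchi identity -/

section Bianchi

variable {R : Type*} [Ring R] [Algebra ℝ R]

omit [LieGroup (𝓡 d) ∞ G] in
theorem pairing_tmul (r : R) (X : LieAlg d G) (ξ : Module.Dual ℝ (LieAlg d G)) :
    pairing (r ⊗ₜ[ℝ] X) ξ = ξ X • r := by
  change TensorProduct.rid ℝ R (TensorProduct.map LinearMap.id ξ (r ⊗ₜ[ℝ] X)) = _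
  simp

omit [LieGroup (𝓡 d) ∞ G] in
theorem pairing_add (Θ Θ' : R ⊗[ℝ] LieAlg d G) : pairing (Θ + Θ') = pairing Θ + pairing Θ' := by
  ext ξ
  change TensorProduct.rid ℝ R (TensorProduct.map LinearMap.id ξ (Θ + Θ')) = _
  rw [map_add, map_add]
  rfl

omit [LieGroup (𝓡 d) ∞ G] in
theorem pairing_smul (r : ℝ) (Θ : R ⊗[ℝ] LieAlg d G) : pairing (r • Θ) = r • pairing Θ := by
  ext ξ
  change TensorProduct.rid ℝ R (TensorProduct.map LinearMap.id ξ (r • Θ)) = _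
  rw [map_smul, map_smul]
  rfl

omit [LieGroup (𝓡 d) ∞ G] in
theorem pairing_zero : pairing (0 : R ⊗[ℝ] LieAlg d G) = 0 := by
  simpa using pairing_smul 0 (0 : R ⊗[ℝ] LieAlg d G)

omit [LieGroup (𝓡 d) ∞ G] in
theorem pairing_map {R' : Type*} [Ring R'] [Algebra ℝ R'] (f : R →ₗ[ℝ] R')
    (g : LieAlg d G →ₗ[ℝ] LieAlg d G) (Θ : R ⊗[ℝ] LieAlg d G) (ξ : Module.Dual ℝ (LieAlg d G)) :
    pairing (TensorProduct.map f g Θ) ξ = f (pairing Θ (ξ ∘ₗ g)) := by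
  induction Θ using TensorProduct.induction_on with
  | zero => simp [pairing_zero]
  | add a b ha hb => simp only [map_add, pairing_add, LinearMap.add_apply, ha, hb]
  | tmul r X => simp [pairing_tmul]

/-- Expansion by structure constants. It reduces identities in `R ⊗ 𝔤` to identities between the
components of `Θ` in a basis. -/
theorem pairing_tensorBracket {ι : Type*} [Fintype ι] (b : Module.Basis ι ℝ (LieAlg d G))
    (Θ Θ' : R ⊗[ℝ] LieAlg d G) (ξ : Module.Dual ℝ (LieAlg d G)) :
    pairing (tensorBracket Θ Θ') ξ =
      ∑ i, ∑ j, ξ ⁅b i, b j⁆ • (pairing Θ (b.coord i) * pairing Θ' (b.coord j)) := by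
  induction Θ using TensorProduct.induction_on with
  | zero => simp [pairing_zero]
  | add x y hx hy =>
    simp only [map_add, LinearMap.add_apply, pairing_add, hx, hy, add_mul, smul_add,
      Finset.sum_add_distrib]
  | tmul r X =>
    induction Θ' using TensorProduct.induction_on with
    | zero => simp [pairing_zero]
    | add x y hx hy =>
      simp only [map_add, LinearMap.add_apply, pairing_add, hx, hy, mul_add, smul_add,
        Finset.sum_add_distrib]
    | tmul s Y =>
      have e : tensorBracket (r ⊗ₜ[ℝ] X) (s ⊗ₜ[ℝ] Y) = (r * s) ⊗ₜ[ℝ] ⁅X, Y⁆ := rfl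
      have e2 : ξ ⁅X, Y⁆ = ∑ i, ∑ j, ξ ⁅b i, b j⁆ * (b.coord i X * b.coord j Y) := by
        conv_lhs => rw [← b.sum_repr X, ← b.sum_repr Y]
        simp only [sum_lie, lie_sum, map_sum, smul_lie, lie_smul, map_smul, smul_eq_mul,
          Module.Basis.coord_apply, Finset.mul_sum]
        rw [Finset.sum_comm]
        refine Finset.sum_congr rfl fun i _ => Finset.sum_congr rfl fun j _ => by ring
      rw [e, pairing_tmul, e2, Finset.sum_smul]
      refine Finset.sum_congr rfl fun i _ => ?_
      rw [Finset.sum_smul]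
      refine Finset.sum_congr rfl fun j _ => ?_
      rw [pairing_tmul, pairing_tmul, smul_mul_smul_comm, smul_smul]

theorem pairing_curvature {ι : Type*} [Fintype ι] (b : Module.Basis ι ℝ (LieAlg d G))
    (D : R →ₗ[ℝ] R) (Θ : R ⊗[ℝ] LieAlg d G) (ξ : Module.Dual ℝ (LieAlg d G)) :
    pairing (curvature D Θ) ξ = D (pairing Θ ξ) + (1 / 2 : ℝ) •
      ∑ i, ∑ j, ξ ⁅b i, b j⁆ • (pairing Θ (b.coord i) * pairing Θ (b.coord j)) := by
  rw [curvature, pairing_add, LinearMap.add_apply, pairing_map, pairing_smul, LinearMap.smul_apply,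
    pairing_tensorBracket b, LinearMap.comp_id]

omit [LieGroup (𝓡 d) ∞ G] in
theorem dual_eq_sum {ι : Type*} [Fintype ι] (b : Module.Basis ι ℝ (LieAlg d G))
    (ξ : Module.Dual ℝ (LieAlg d G)) : ξ = ∑ i, ξ (b i) • b.coord i := by
  refine b.ext fun j => ?_
  classical
  simp

omit [LieGroup (𝓡 d) ∞ G] in
theorem pairing_eq_sum {ι : Type*} [Fintype ι] (b : Module.Basis ι ℝ (LieAlg d G))
    (Θ : R ⊗[ℝ] LieAlg d G) (ξ : Module.Dual ℝ (LieAlg d G)) :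
    pairing Θ ξ = ∑ i, ξ (b i) • pairing Θ (b.coord i) := by
  conv_lhs => rw [dual_eq_sum b ξ]
  simp only [map_sum, map_smul]

/-- The Jacobi identity paired with a cubic expression in anticommuting elements. -/
theorem sum_jacobi {ι : Type*} [Fintype ι] (b : Module.Basis ι ℝ (LieAlg d G)) {t : ι → R}
    (ht : ∀ i j, t i * t j = -(t j * t i)) (ξ : Module.Dual ℝ (LieAlg d G)) :
    ∑ i, ∑ j, ∑ k, ξ ⁅b i, ⁅b j, b k⁆⁆ • (t i * (t j * t k)) = 0 := by
  set S := ∑ i, ∑ j, ∑ k, ξ ⁅b i, ⁅b j, b k⁆⁆ • (t i * (t j * t k)) with hS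
  -- Moving one anticommuting factor past two others costs two signs, so the triple product is
  -- cyclically invariant. Hence `S` equals its two rotations, and `3 S` is a sum of Jacobi
  -- expressions.
  have cyc : ∀ i j k, t i * (t j * t k) = t j * (t k * t i) := fun i j k => by
    rw [← mul_assoc, ht i j, neg_mul, mul_assoc, ht i k, mul_neg, neg_neg]
  have rot : ∀ H : ι → ι → ι → R, ∑ i, ∑ j, ∑ k, H j k i = ∑ i, ∑ j, ∑ k, H i j k := fun H => by
    rw [Finset.sum_comm]
    exact Finset.sum_congr rfl fun j _ => Finset.sum_comm
  have h1 : S = ∑ i, ∑ j, ∑ k, ξ ⁅b k, ⁅b i, b j⁆⁆ • (t i * (t j * t k)) := by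
    rw [← rot]
    refine Finset.sum_congr rfl fun i _ => Finset.sum_congr rfl fun j _ =>
      Finset.sum_congr rfl fun k _ => ?_
    rw [cyc]
  have h2 : S = ∑ i, ∑ j, ∑ k, ξ ⁅b j, ⁅b k, b i⁆⁆ • (t i * (t j * t k)) := by
    rw [← rot, ← rot fun i j k => ξ ⁅b k, ⁅b i, b j⁆⁆ • (t j * (t k * t i))]
    refine Finset.sum_congr rfl fun i _ => Finset.sum_congr rfl fun j _ =>
      Finset.sum_congr rfl fun k _ => ?_
    rw [← cyc]
  have h3 : S + S + S = 0 := by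
    nth_rewrite 3 [h2]
    nth_rewrite 2 [h1]
    rw [hS]
    simp only [← Finset.sum_add_distrib, ← add_smul, ← map_add]
    refine Finset.sum_eq_zero fun i _ => Finset.sum_eq_zero fun j _ => Finset.sum_eq_zero fun k _ => ?_
    rw [add_right_comm, lie_jacobi, map_zero, zero_smul]
  have h4 : (3 : ℝ) • S = 0 := by
    rw [← h3]; module
  exact (smul_eq_zero.1 h4).resolve_left (by norm_num)

/-- The Bianchi identity. -/
theorem bianchi {ι : Type*} [Fintype ι] (b : Module.Basis ι ℝ (LieAlg d G)) {D : R →ₗ[ℝ] R}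
    {Θ : R ⊗[ℝ] LieAlg d G}
    (hanti : ∀ ξ ζ, pairing Θ ξ * pairing Θ ζ = -(pairing Θ ζ * pairing Θ ξ))
    (hD : ∀ ξ ζ, D (pairing Θ ξ * pairing Θ ζ) =
      D (pairing Θ ξ) * pairing Θ ζ - pairing Θ ξ * D (pairing Θ ζ))
    (hcomm : ∀ ξ ζ, D (pairing Θ ξ) * pairing Θ ζ = pairing Θ ζ * D (pairing Θ ξ))
    (hDD : ∀ ξ, D (D (pairing Θ ξ)) = 0) (ξ : Module.Dual ℝ (LieAlg d G)) :
    D (pairing (curvature D Θ) ξ) = -∑ i, pairing Θ (b.coord i) *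
      pairing (curvature D Θ) (ξ ∘ₗ (LieAlgebra.ad ℝ (LieAlg d G) (b i))) := by
  set t : ι → R := fun i => pairing Θ (b.coord i) with ht
  have hJ := sum_jacobi b (t := t) (fun i j => hanti _ _) ξ
  -- The two terms of `D (t_i t_j)` contribute equally: `D t_j` commutes with `t_i`, and the sign of
  -- the Leibniz rule is absorbed by exchanging the arguments of the bracket. This cancels the
  -- factor `1/2`.
  have hL : D (pairing (curvature D Θ) ξ) = -∑ i, ∑ j, ξ ⁅b i, b j⁆ • (t i * D (t j)) := by
    rw [pairing_curvature b, map_add, hDD, zero_add, map_smul, map_sum]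
    simp_rw [map_sum, map_smul, hD, smul_sub, Finset.sum_sub_distrib]
    have e : ∑ i, ∑ j, ξ ⁅b i, b j⁆ • (D (t i) * t j) =
        -∑ i, ∑ j, ξ ⁅b i, b j⁆ • (t i * D (t j)) := by
      rw [Finset.sum_comm, ← Finset.sum_neg_distrib]
      refine Finset.sum_congr rfl fun i _ => ?_
      rw [← Finset.sum_neg_distrib]
      refine Finset.sum_congr rfl fun j _ => ?_
      rw [hcomm, ← lie_skew, map_neg, neg_smul]
    rw [e]
    module
  rw [hL, neg_inj]
  -- After multiplication by `t_i`, the quadratic part of the curvature gives the cubic sum of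
  -- `sum_jacobi`, so only the part `D t_j` survives.
  have hR : ∀ i, pairing (curvature D Θ) (ξ ∘ₗ (LieAlgebra.ad ℝ (LieAlg d G) (b i))) =
      ∑ j, ξ ⁅b i, b j⁆ • D (t j) + (1 / 2 : ℝ) • ∑ j, ∑ k, ξ ⁅b i, ⁅b j, b k⁆⁆ • (t j * t k) := by
    intro i
    rw [pairing_curvature b, pairing_eq_sum b Θ (ξ ∘ₗ _), map_sum]
    simp_rw [map_smul]
    rfl
  simp_rw [hR, mul_add, Finset.sum_add_distrib, mul_smul_comm, Finset.mul_sum, mul_smul_comm,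
    ← Finset.smul_sum]
  rw [hJ, smul_zero, add_zero]

/-- The elements that commute with everything and satisfy the Leibniz rule without sign for the
given endomorphism. -/
def evenLeibniz (D : R →ₗ[ℝ] R) (h1 : D 1 = 0) : Subalgebra ℝ R where
  carrier := {x | ∀ y, x * y = y * x ∧ D (x * y) = D x * y + x * D y}
  mul_mem' {x x'} hx hx' y := by
    refine ⟨?_, ?_⟩
    · rw [mul_assoc, (hx' y).1, ← mul_assoc, (hx y).1, mul_assoc]
    · rw [mul_assoc, (hx _).2, (hx' y).2, (hx x').2, mul_add, add_mul, mul_assoc, mul_assoc,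
        mul_assoc, add_assoc]
  add_mem' {x x'} hx hx' y := by
    refine ⟨?_, ?_⟩
    · rw [add_mul, mul_add, (hx y).1, (hx' y).1]
    · rw [add_mul, map_add, (hx y).2, (hx' y).2, map_add, add_mul, add_mul]; abel
  algebraMap_mem' r y := by
    refine ⟨Algebra.commutes r y, ?_⟩
    rw [Algebra.algebraMap_eq_smul_one, map_smul, h1, smul_zero, zero_mul, zero_add,
      smul_mul_assoc, one_mul, map_smul, smul_mul_assoc, one_mul]

theorem symLift_mem {V : Type*} [AddCommGroup V] [Module ℝ V] (φ : V →ₗ[ℝ] R)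
    (h : ∀ x y, φ x * φ y = φ y * φ x) {E : Subalgebra ℝ R} (hE : ∀ x, φ x ∈ E)
    (f : SymmetricAlgebra ℝ V) : symLift φ h f ∈ E := by
  induction f using SymmetricAlgebra.induction with
  | algebraMap r => rw [AlgHom.commutes]; exact E.algebraMap_mem r
  | ι x => rw [symLift_ι]; exact hE x
  | mul a b ha hb => rw [map_mul]; exact E.mul_mem ha hb
  | add a b ha hb => rw [map_add]; exact E.add_mem ha hb

/-- If `δ` kills the generators `φ x`, it kills all polynomials in them. -/
theorem symLift_killed {V : Type*} [AddCommGroup V] [Module ℝ V] (φ : V →ₗ[ℝ] R)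
    (h : ∀ x y, φ x * φ y = φ y * φ x) {δ : R →ₗ[ℝ] R} (h1 : δ 1 = 0)
    (hE : ∀ x, φ x ∈ evenLeibniz δ h1) (hδ : ∀ x, δ (φ x) = 0)
    (f : SymmetricAlgebra ℝ V) : δ (symLift φ h f) = 0 := by
  induction f using SymmetricAlgebra.induction with
  | algebraMap r =>
    rw [AlgHom.commutes, Algebra.algebraMap_eq_smul_one, map_smul, h1, smul_zero]
  | ι x => rw [symLift_ι, hδ]
  | mul a b ha hb =>
    rw [map_mul, (symLift_mem φ h hE a _).2, ha, hb, zero_mul, mul_zero, add_zero]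
  | add a b ha hb =>
    rw [map_add, map_add, ha, hb, add_zero]

/-- Both sides are derivations along the homomorphism `f ↦ f(Ω)`, whose values are central and pass
through `D` without sign. So linear forms suffice, and for these the formula is the Bianchi
identity. When `f` is invariant, every term on the right vanishes. -/
theorem diff_symLift_curvature {ι : Type*} [Fintype ι] (b : Module.Basis ι ℝ (LieAlg d G))
    {D : R →ₗ[ℝ] R} (h1 : D 1 = 0) {Θ : R ⊗[ℝ] LieAlg d G}
    (hanti : ∀ ξ ζ, pairing Θ ξ * pairing Θ ζ = -(pairing Θ ζ * pairing Θ ξ))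
    (hD : ∀ ξ ζ, D (pairing Θ ξ * pairing Θ ζ) =
      D (pairing Θ ξ) * pairing Θ ζ - pairing Θ ξ * D (pairing Θ ζ))
    (hcomm : ∀ ξ ζ, D (pairing Θ ξ) * pairing Θ ζ = pairing Θ ζ * D (pairing Θ ξ))
    (hDD : ∀ ξ, D (D (pairing Θ ξ)) = 0)
    (hE : ∀ ξ, pairing (curvature D Θ) ξ ∈ evenLeibniz D h1)
    (h : ∀ ξ ζ, pairing (curvature D Θ) ξ * pairing (curvature D Θ) ζ =
      pairing (curvature D Θ) ζ * pairing (curvature D Θ) ξ) (f : SymDual d G) :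
    D (symLift (pairing (curvature D Θ)) h f) =
      -∑ i, pairing Θ (b.coord i) * symLift (pairing (curvature D Θ)) h (coadDeriv (b i) f) := by
  have hmem := symLift_mem (pairing (curvature D Θ)) h hE
  have hadd : ∀ a b, symLift (pairing (curvature D Θ)) h (a + b) =
    symLift (pairing (curvature D Θ)) h a + symLift (pairing (curvature D Θ)) h b :=
    fun a b => map_add _ _ _
  induction f using SymmetricAlgebra.induction with
  | algebraMap r =>
    rw [AlgHom.commutes, Algebra.algebraMap_eq_smul_one, map_smul, h1, smul_zero]
    simp only [coadDeriv_algebraMap]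
    have : symLift (pairing (curvature D Θ)) h 0 = 0 := map_zero _
    simp [this]
  | ι x =>
    simp only [coadDeriv_ι, symLift_ι]
    exact bianchi b hanti hD hcomm hDD x
  | mul x y hx hy =>
    rw [map_mul, (hmem x _).2, hx, hy]
    simp only [coadDeriv_mul, hadd, map_mul, mul_add, Finset.sum_add_distrib]
    rw [neg_mul, Finset.sum_mul, mul_neg, Finset.mul_sum, ← neg_add, add_comm]
    congr 2
    · refine Finset.sum_congr rfl fun i _ => ?_
      rw [← mul_assoc, (hmem x _).1, mul_assoc]
    · refine Finset.sum_congr rfl fun i _ => ?_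
      rw [mul_assoc]
  | add x y hx hy =>
    rw [hadd, map_add, hx, hy]
    simp only [coadDeriv_add, hadd, mul_add, Finset.sum_add_distrib]
    rw [neg_add]

end Bianchi

end
end ChernWeil

/-! ### The differential algebra of forms on simplices and its functoriality. -/

noncomputable section

namespace ChernWeil

/-! ### Partial derivatives of smooth functions on the simplex -/

theorem partialDeriv_apply {n : ℕ} (i : Fin n) {f : SmoothFn n} {F : (Fin n → ℝ) → ℝ}
    (hF : ContDiff ℝ ∞ F) (hf : ∀ x, f.1 x = F x) (x : Simplex n) :
    (partialDeriv i f).1 x = fderiv ℝ F x (Pi.single i 1) := by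
  change fderivWithin ℝ (extendZero f.1) (Simplex n) x _ = _
  rw [fderivWithin_extendZero hF hf]

theorem partialDeriv_mul {n : ℕ} (i : Fin n) (f g : SmoothFn n) :
    partialDeriv i (f * g) = partialDeriv i f * g + f * partialDeriv i g := by
  obtain ⟨F, hF, hf⟩ := f.2
  obtain ⟨K, hK, hg⟩ := g.2
  ext x
  have h1 := partialDeriv_apply i (f := f * g) (hF.mul hK)
    (fun x => by rw [← hf, ← hg]; rfl) x
  have h2 := partialDeriv_apply i hF hf x
  have h3 := partialDeriv_apply i hK hg x
  refine h1.trans ?_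
  change _ = (partialDeriv i f).1 x * g.1 x + f.1 x * (partialDeriv i g).1 x
  rw [h2, h3, hf, hg, fderiv_fun_mul (hF.differentiable (by simp) _) (hK.differentiable (by simp) _)]
  simp only [add_apply, smul_apply, smul_eq_mul]
  ring

theorem partialDeriv_one {n : ℕ} (i : Fin n) : partialDeriv i (1 : SmoothFn n) = 0 := by
  ext x
  refine (partialDeriv_apply i (f := 1) (contDiff_const (c := (1 : ℝ))) (fun _ => rfl) x).trans ?_
  simp

theorem partialDeriv_comm {n : ℕ} (i j : Fin n) (f : SmoothFn n) :
    partialDeriv i (partialDeriv j f) = partialDeriv j (partialDeriv i f) := by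
  obtain ⟨F, hF, hf⟩ := f.2
  have hd : ∀ k : Fin n, ContDiff ℝ ∞ fun x => fderiv ℝ F x (Pi.single k 1) := fun k =>
    (hF.fderiv_right (m := ∞) (by simp)).clm_apply contDiff_const
  have key : ∀ k l : Fin n, ∀ x : Simplex n, (partialDeriv k (partialDeriv l f)).1 x =
      fderiv ℝ (fderiv ℝ F) x (Pi.single k 1) (Pi.single l 1) := fun k l x => by
    refine (partialDeriv_apply k (hd l) (partialDeriv_apply l hF hf) x).trans ?_
    rw [fderiv_clm_apply ((hF.fderiv_right (m := ∞) (by simp)).differentiable (by simp) _)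
      (differentiableAt_const _)]
    simp
  ext x
  refine (key i j x).trans (Eq.trans ?_ (key j i x).symm)
  exact (contDiffAt_infty.1 (hF.contDiffAt (x := x.1)) 2).isSymmSndFDerivAt
    (by rw [minSmoothness_of_isRCLikeNormedField]; rfl) _ _

theorem hasFDerivAt_bary {n : ℕ} (k : Fin (n + 1)) (x : Fin n → ℝ) :
    HasFDerivAt (fun x : Fin n → ℝ => bary x k)
      (∑ i, dbary k i • ContinuousLinearMap.proj (R := ℝ) (φ := fun _ : Fin n => ℝ) i) x := by
  refine Fin.cases ?_ (fun j => ?_) k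
  · simp only [bary, dbary, Fin.cons_zero]
    refine ((HasFDerivAt.fun_sum fun i _ => (ContinuousLinearMap.proj (R := ℝ)
      (φ := fun _ : Fin n => ℝ) i).hasFDerivAt).const_sub 1).congr_fderiv ?_
    ext v
    simp
  · simp only [bary, dbary, Fin.cons_succ]
    refine (ContinuousLinearMap.proj (R := ℝ) (φ := fun _ : Fin n => ℝ) j).hasFDerivAt.congr_fderiv ?_
    ext v
    simp [Pi.single_apply]

theorem partialDeriv_coord {n : ℕ} (k : Fin (n + 1)) (i : Fin n) :
    partialDeriv i (coord k) = dbary k i • (1 : SmoothFn n) := by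
  ext x
  refine (partialDeriv_apply i (contDiff_bary k) (fun _ => rfl) x).trans ?_
  rw [(hasFDerivAt_bary k x.1).fderiv]
  change _ = dbary k i * 1
  simp [Pi.single_apply]

theorem covector_eq_sum {n : ℕ} (v : Fin n → ℝ) : v = ∑ i, v i • Pi.single i (1 : ℝ) := by
  ext j
  simp [Finset.sum_apply, Pi.single_apply]

theorem pullCovector_single {m n : ℕ} (φ : Fin (m + 1) →o Fin (n + 1)) (j : Fin n) :
    pullCovector φ (Pi.single j 1) = ∑ i with φ i = j.succ, dbary i := by
  simp [pullCovector, Fintype.linearCombination_apply, Pi.single_apply]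

/-- The chain rule for the affine map `simplexMap φ`, whose constant Jacobian has the coefficients
of `pullCovector φ` as entries. This is why `dForm` commutes with pull-back. -/
theorem partialDeriv_pullFn {m n : ℕ} (φ : Fin (m + 1) →o Fin (n + 1)) (f : SmoothFn n)
    (i : Fin m) : partialDeriv i (pullFn φ f) =
      ∑ j, pullCovector φ (Pi.single j 1) i • pullFn φ (partialDeriv j f) := by
  obtain ⟨F, hF, hf⟩ := f.2
  have hs : ∀ x : Fin m → ℝ, HasFDerivAt (simplexMap φ) (ContinuousLinearMap.pi fun j : Fin n =>
      ∑ k with φ k = j.succ, ∑ i, dbary k i •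
        ContinuousLinearMap.proj (R := ℝ) (φ := fun _ : Fin m => ℝ) i) x := fun x => by
    refine hasFDerivAt_pi.2 fun j => ?_
    exact HasFDerivAt.fun_sum fun k _ => hasFDerivAt_bary k x
  have hsm : ContDiff ℝ ∞ (simplexMap φ) :=
    contDiff_pi.2 fun j => ContDiff.sum fun i _ => contDiff_bary i
  ext x
  refine (partialDeriv_apply i (f := pullFn φ f) (hF.comp hsm) (fun x => hf _) x).trans ?_
  have hc := ((hF.differentiable (by simp) (simplexMap φ x.1)).hasFDerivAt.comp x.1 (hs x.1)).fderiv
  rw [hc]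
  have e : ∀ j, (pullFn φ (partialDeriv j f)).1 x = fderiv ℝ F (simplexMap φ x.1) (Pi.single j 1) :=
    fun j => partialDeriv_apply j hF hf ⟨simplexMap φ x.1, simplexMap_mem φ x.2⟩
  have e2 : (∑ j, pullCovector φ (Pi.single j 1) i • pullFn φ (partialDeriv j f)).1 x =
      ∑ j, pullCovector φ (Pi.single j 1) i * (pullFn φ (partialDeriv j f)).1 x := by
    rw [AddSubmonoidClass.coe_finsetSum, Finset.sum_apply]
    rfl
  refine Eq.trans ?_ e2.symm
  simp only [e, ContinuousLinearMap.comp_apply]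
  set L := fderiv ℝ F (simplexMap φ x.1)
  have hv : ∀ v : Fin n → ℝ, L v = ∑ j, v j * L (Pi.single j 1) := fun v => by
    conv_lhs => rw [covector_eq_sum v, map_sum]
    exact Finset.sum_congr rfl fun j _ => map_smul L _ _
  rw [hv]
  refine Finset.sum_congr rfl fun j _ => ?_
  congr 1
  simp [pullCovector_single, Pi.single_apply]

/-! ### Pure tensors of forms -/

/-- The form `f λ`. -/
def fTmul {n : ℕ} (f : SmoothFn n) (l : Covectors n) : Forms n := formEquiv n (f ⊗ₜ[ℝ] l)

theorem fTmul_induction {n : ℕ} {P : Forms n → Prop} (h0 : P 0)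
    (hadd : ∀ x y, P x → P y → P (x + y)) (h : ∀ f l, P (fTmul f l)) (x : Forms n) : P x := by
  obtain ⟨x, rfl⟩ := (formEquiv n).surjective x
  induction x using TensorProduct.induction_on with
  | zero => rw [map_zero]; exact h0
  | add x y hx hy => rw [map_add]; exact hadd _ _ hx hy
  | tmul f l => exact h f l

theorem fTmul_mul {n : ℕ} (f g : SmoothFn n) (l m : Covectors n) :
    fTmul f l * fTmul g m = fTmul (f * g) (l * m) :=
  (map_mul (formEquiv n) _ _).symm.trans
    (congrArg _ (Algebra.TensorProduct.tmul_mul_tmul f g l m))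

theorem fTmul_one {n : ℕ} : fTmul (1 : SmoothFn n) (1 : Covectors n) = 1 := rfl

theorem fTmul_add_left {n : ℕ} (f g : SmoothFn n) (l : Covectors n) :
    fTmul (f + g) l = fTmul f l + fTmul g l := by
  rw [fTmul, TensorProduct.add_tmul, map_add]; rfl

theorem fTmul_add_right {n : ℕ} (f : SmoothFn n) (l m : Covectors n) :
    fTmul f (l + m) = fTmul f l + fTmul f m := by
  rw [fTmul, TensorProduct.tmul_add, map_add]; rfl

theorem fTmul_smul_left {n : ℕ} (r : ℝ) (f : SmoothFn n) (l : Covectors n) :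
    fTmul (r • f) l = r • fTmul f l := by
  rw [fTmul, ← TensorProduct.smul_tmul', map_smul]; rfl

theorem fTmul_smul_right {n : ℕ} (r : ℝ) (f : SmoothFn n) (l : Covectors n) :
    fTmul f (r • l) = r • fTmul f l := by
  rw [fTmul, TensorProduct.tmul_smul, map_smul]; rfl

/-- The pure tensor `f λ` as a linear function of `f`. -/
def fTmulLeft {n : ℕ} (l : Covectors n) : SmoothFn n →ₗ[ℝ] Forms n where
  toFun f := fTmul f l
  map_add' f g := fTmul_add_left f g l
  map_smul' r f := fTmul_smul_left r f l

/-- The pure tensor `f λ` as a linear function of `λ`. -/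
def fTmulRight {n : ℕ} (f : SmoothFn n) : Covectors n →ₗ[ℝ] Forms n where
  toFun l := fTmul f l
  map_add' l m := fTmul_add_right f l m
  map_smul' r l := fTmul_smul_right r f l

theorem fTmul_sum_left {n : ℕ} {ι : Type*} (s : Finset ι) (f : ι → SmoothFn n) (l : Covectors n) :
    fTmul (∑ i ∈ s, f i) l = ∑ i ∈ s, fTmul (f i) l := map_sum (fTmulLeft l) f s

theorem fTmul_sum_right {n : ℕ} {ι : Type*} (s : Finset ι) (f : SmoothFn n) (l : ι → Covectors n) :
    fTmul f (∑ i ∈ s, l i) = ∑ i ∈ s, fTmul f (l i) := map_sum (fTmulRight f) l s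

theorem fTmul_mem {n p : ℕ} (f : SmoothFn n) {l : Covectors n} (hl : l ∈ ⋀[ℝ]^p (Fin n → ℝ)) :
    fTmul f l ∈ formDeg n p :=
  Submodule.tmul_mem_baseChange_of_mem f hl

/-- `formDeg` comes from a submodule over the smooth functions; absorbing function coefficients into
the first tensor factor leaves a span over `ℝ`. -/
theorem formDeg_eq_span (n p : ℕ) : formDeg n p =
    Submodule.span ℝ {x | ∃ f : SmoothFn n, ∃ l ∈ ⋀[ℝ]^p (Fin n → ℝ), x = fTmul f l} := by
  refine le_antisymm (fun x hx => ?_) (Submodule.span_le.2 ?_)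
  · obtain ⟨x, rfl⟩ := (formEquiv n).surjective x
    replace hx : x ∈ (⋀[ℝ]^p (Fin n → ℝ)).baseChange (SmoothFn n) := hx
    rw [Submodule.baseChange_eq_span] at hx
    obtain ⟨l, rfl⟩ := (Finsupp.mem_span_iff_linearCombination _ _ _).1 hx
    rw [Finsupp.linearCombination_apply, Finsupp.sum, map_sum]
    refine Submodule.sum_mem _ fun y _ => Submodule.subset_span ?_
    obtain ⟨_, y, hy, rfl⟩ := y
    refine ⟨l ⟨_, y, hy, rfl⟩, y, hy, congrArg (formEquiv n) ?_⟩
    simp [TensorProduct.smul_tmul']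
  · rintro _ ⟨f, l, hl, rfl⟩
    exact fTmul_mem f hl

theorem formDeg_induction {n p : ℕ} {P : Forms n → Prop} (h0 : P 0)
    (hadd : ∀ x y, P x → P y → P (x + y))
    (h : ∀ f, ∀ l ∈ ⋀[ℝ]^p (Fin n → ℝ), P (fTmul f l)) {x : Forms n} (hx : x ∈ formDeg n p) :
    P x := by
  rw [formDeg_eq_span] at hx
  -- `P` is not assumed stable under scalars, so the induction runs over all real multiples of `x`.
  suffices ∀ r : ℝ, P (r • x) by simpa using this 1
  induction hx using Submodule.span_induction with
  | zero => simpa using h0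
  | add x y _ _ hx hy => intro r; rw [smul_add]; exact hadd _ _ (hx r) (hy r)
  | smul s x _ hx => intro r; rw [smul_smul]; exact hx _
  | mem x hx =>
    intro r
    obtain ⟨f, l, hl, rfl⟩ := hx
    rw [← fTmul_smul_left]
    exact h _ l hl

/-! ### The exterior differential -/

theorem dForm_fTmul {n : ℕ} (f : SmoothFn n) (l : Covectors n) :
    dForm n (fTmul f l) = ∑ i, fTmul (partialDeriv i f)
      (ExteriorAlgebra.ι ℝ (Pi.single i (1 : ℝ)) * l) := by
  rw [dForm, LinearMap.comp_apply, LinearMap.comp_apply, LinearMap.sum_apply, map_sum]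
  rfl

theorem dForm_one (n : ℕ) : dForm n 1 = 0 := by
  rw [← fTmul_one, dForm_fTmul]
  refine Finset.sum_eq_zero fun i _ => ?_
  rw [partialDeriv_one]
  exact map_zero (fTmulLeft _)

/-- Partial derivatives commute and the `dt_i` anticommute, so exchanging the two indices shows that
the double sum is its own negative. -/
theorem dForm_dForm {n : ℕ} (x : Forms n) : dForm n (dForm n x) = 0 := by
  induction x using fTmul_induction with
  | h0 => simp
  | hadd x y hx hy => rw [map_add, map_add, hx, hy, add_zero]
  | h f l =>
    rw [dForm_fTmul, map_sum]
    simp_rw [dForm_fTmul]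
    set S := ∑ i, ∑ j, fTmul (partialDeriv j (partialDeriv i f))
      (ExteriorAlgebra.ι ℝ (Pi.single j (1 : ℝ)) * (ExteriorAlgebra.ι ℝ (Pi.single i (1 : ℝ)) * l))
      with hS
    have h : S = -S := by
      conv_lhs => rw [hS, Finset.sum_comm]
      rw [hS, ← Finset.sum_neg_distrib]
      refine Finset.sum_congr rfl fun i _ => ?_
      rw [← Finset.sum_neg_distrib]
      refine Finset.sum_congr rfl fun j _ => ?_
      rw [partialDeriv_comm, ← mul_assoc, ← mul_assoc,
        eq_neg_of_add_eq_zero_left (ExteriorAlgebra.ι_add_mul_swap (R := ℝ)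
          (Pi.single i (1 : ℝ) : Fin n → ℝ) (Pi.single j (1 : ℝ))), neg_mul]
      exact map_neg (fTmulRight _) _
    have h2 : (2 : ℝ) • S = 0 := by
      rw [two_smul]; nth_rewrite 1 [h]; exact neg_add_cancel S
    exact (smul_eq_zero.1 h2).resolve_left two_ne_zero

theorem dForm_mul {n p : ℕ} {x : Forms n} (hx : x ∈ formDeg n p) (y : Forms n) :
    dForm n (x * y) = dForm n x * y + (-1 : ℝ) ^ p • (x * dForm n y) := by
  refine formDeg_induction (P := fun x => dForm n (x * y) =
    dForm n x * y + (-1 : ℝ) ^ p • (x * dForm n y)) ?_ ?_ ?_ hx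
  · simp
  · intro x x' hx hx'
    rw [add_mul, map_add, hx, hx', map_add, add_mul, add_mul, smul_add]; abel
  · intro f l hl
    induction y using fTmul_induction with
    | h0 => simp
    | hadd y y' hy hy' => rw [mul_add, map_add, hy, hy', map_add, mul_add, mul_add, smul_add]; abel
    | h g m =>
      rw [fTmul_mul, dForm_fTmul, dForm_fTmul, dForm_fTmul, Finset.sum_mul, Finset.mul_sum,
        Finset.smul_sum, ← Finset.sum_add_distrib]
      refine Finset.sum_congr rfl fun i _ => ?_
      rw [partialDeriv_mul, fTmul_add_left, fTmul_mul, fTmul_mul, mul_assoc, ← mul_assoc l,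
        ← fTmul_smul_right, ← smul_mul_assoc, ← Mixed.ι_mul_of_mem _ hl, mul_assoc]

/-! ### Pull-back of forms -/

theorem pullForm_fTmul {m n : ℕ} (φ : Fin (m + 1) →o Fin (n + 1)) (f : SmoothFn n)
    (l : Covectors n) :
    pullForm φ (fTmul f l) = fTmul (pullFn φ f) (ExteriorAlgebra.map (pullCovector φ) l) := rfl

theorem map_mem_exteriorPower {V W : Type*} [AddCommGroup V] [Module ℝ V] [AddCommGroup W]
    [Module ℝ W] (f : V →ₗ[ℝ] W) {p : ℕ} {l : ExteriorAlgebra ℝ V} (hl : l ∈ ⋀[ℝ]^p V) :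
    ExteriorAlgebra.map f l ∈ ⋀[ℝ]^p W := by
  have h : (⋀[ℝ]^p V).map (ExteriorAlgebra.map f).toLinearMap ≤ ⋀[ℝ]^p W := by
    change Submodule.map _ (LinearMap.range (ExteriorAlgebra.ι ℝ) ^ p) ≤
      LinearMap.range (ExteriorAlgebra.ι ℝ) ^ p
    rw [Submodule.map_pow]
    refine pow_le_pow_left' ?_ p
    rintro _ ⟨_, ⟨v, rfl⟩, rfl⟩
    exact ⟨f v, (ExteriorAlgebra.map_apply_ι f v).symm⟩
  exact h ⟨l, hl, rfl⟩

theorem pullForm_mem {m n p : ℕ} (φ : Fin (m + 1) →o Fin (n + 1)) {x : Forms n}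
    (hx : x ∈ formDeg n p) : pullForm φ x ∈ formDeg m p := by
  refine formDeg_induction (P := fun x => pullForm φ x ∈ formDeg m p) ?_ ?_ ?_ hx
  · rw [map_zero]; exact zero_mem _
  · intro x y hx hy
    rw [map_add]; exact add_mem hx hy
  · intro f l hl
    rw [pullForm_fTmul]
    exact fTmul_mem _ (map_mem_exteriorPower _ hl)

theorem dForm_pullForm {m n : ℕ} (φ : Fin (m + 1) →o Fin (n + 1)) (x : Forms n) :
    dForm m (pullForm φ x) = pullForm φ (dForm n x) := by
  induction x using fTmul_induction with
  | h0 => simp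
  | hadd x y hx hy => rw [map_add, map_add, hx, hy, map_add, map_add]
  | h f l =>
    rw [pullForm_fTmul, dForm_fTmul, dForm_fTmul, map_sum]
    simp_rw [partialDeriv_pullFn, fTmul_sum_left, pullForm_fTmul, map_mul,
      ExteriorAlgebra.map_apply_ι]
    rw [Finset.sum_comm]
    refine Finset.sum_congr rfl fun j _ => ?_
    conv_rhs => rw [covector_eq_sum (pullCovector φ (Pi.single j 1)), map_sum, Finset.sum_mul,
      fTmul_sum_right]
    refine Finset.sum_congr rfl fun i _ => ?_
    rw [fTmul_smul_left, map_smul, smul_mul_assoc, fTmul_smul_right]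

theorem pullFn_coord {m n : ℕ} (φ : Fin (m + 1) →o Fin (n + 1)) (j : Fin (n + 1)) :
    pullFn φ (coord j) = ∑ i with φ i = j, coord i := by
  ext x
  refine (bary_simplexMap φ x.1 j).trans ?_
  rw [AddSubmonoidClass.coe_finsetSum, Finset.sum_apply]
  rfl

theorem sum_coord (n : ℕ) : ∑ i, coord (n := n) i = 1 := by
  ext x
  rw [AddSubmonoidClass.coe_finsetSum, Finset.sum_apply]
  exact sum_bary x.1

end ChernWeil
end

/-! ### The graded tensor product `Ω(Δ_m) ⊗ B` as a differential algebra with contractions. -/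

noncomputable section

namespace ChernWeil

variable {d : ℕ} {G : Type v} [TopologicalSpace G] [ChartedSpace (EuclideanSpace ℝ (Fin d)) G]
  [Group G]

/-! ### Parity -/

section Parity

variable {R : Type*} [Ring R] [Algebra ℝ R] (deg : ℕ → Submodule ℝ R) [GradedAlgebra deg]

@[elab_as_elim]
theorem graded_induction {P : R → Prop} (h0 : P 0) (hadd : ∀ x y, P x → P y → P (x + y))
    (h : ∀ p, ∀ x ∈ deg p, P x) (x : R) : P x :=
  DirectSum.Decomposition.inductionOn deg h0 (fun m => h _ _ m.2) hadd x

theorem parity_parity (x : R) : parity deg (parity deg x) = x := by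
  refine graded_induction deg ?_ ?_ ?_ x
  · simp
  · intro x y hx hy; simp [hx, hy]
  · intro p x hx
    rw [parity_of_mem _ hx, map_smul, parity_of_mem _ hx, smul_smul, ← mul_pow]
    simp

theorem parity_one : parity deg 1 = 1 := by
  rw [parity_of_mem deg (SetLike.one_mem_graded deg)]
  simp

theorem parity_mul (x y : R) : parity deg (x * y) = parity deg x * parity deg y := by
  refine graded_induction deg ?_ ?_ ?_ x
  · simp
  · intro x x' hx hx'; simp [add_mul, hx, hx']
  · intro p x hx
    refine graded_induction deg ?_ ?_ ?_ y
    · simp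
    · intro y y' hy hy'; simp [mul_add, hy, hy']
    · intro q y hy
      rw [parity_of_mem _ hx, parity_of_mem _ hy, parity_of_mem _ (SetLike.mul_mem_graded hx hy),
        smul_mul_smul_comm, pow_add]

theorem parity_of_odd_map {R' : Type*} [Ring R'] [Algebra ℝ R'] (deg' : ℕ → Submodule ℝ R')
    [GradedAlgebra deg'] {f : R →ₗ[ℝ] R'} (hf : ∀ p, ∀ x ∈ deg p, f x ∈ deg' (p + 1)) (x : R) :
    parity deg' (f x) = -f (parity deg x) := by
  refine graded_induction deg ?_ ?_ ?_ x
  · simp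
  · intro x y hx hy; simp only [map_add, hx, hy, neg_add]
  · intro p x hx
    rw [parity_of_mem _ hx, parity_of_mem _ (hf p x hx), map_smul, pow_succ, mul_neg_one, neg_smul]

theorem parity_of_even_map {R' : Type*} [Ring R'] [Algebra ℝ R'] (deg' : ℕ → Submodule ℝ R')
    [GradedAlgebra deg'] {f : R →ₗ[ℝ] R'} (hf : ∀ p, ∀ x ∈ deg p, f x ∈ deg' p) (x : R) :
    parity deg' (f x) = f (parity deg x) := by
  refine graded_induction deg ?_ ?_ ?_ x
  · simp
  · intro x y hx hy; simp only [map_add, hx, hy]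
  · intro p x hx
    rw [parity_of_mem _ hx, parity_of_mem _ (hf p x hx), map_smul]

end Parity

namespace GDiffAlg

variable (B : GDiffAlg.{u} d G)

theorem diff_one : B.diff 1 = 0 := by
  have h := B.diff_mul (1 : B) (SetLike.one_mem_graded B.deg)
  simpa using h

theorem contr_one (X : LieAlg d G) : B.contr X 1 = 0 :=
  B.contr_zero X (SetLike.one_mem_graded B.deg)

theorem lie_mem (X : LieAlg d G) {p : ℕ} {a : B} (ha : a ∈ B.deg p) : B.lie X a ∈ B.deg p := by
  refine add_mem (B.contr_mem X (B.diff_mem ha)) ?_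
  cases p with
  | zero =>
    change B.diff (B.contr X a) ∈ _
    rw [B.contr_zero X ha, map_zero]
    exact zero_mem _
  | succ p => exact B.diff_mem (B.contr_mem X ha)

theorem parity_contr (X : LieAlg d G) (a : B) :
    parity B.deg (B.contr X a) = -B.contr X (parity B.deg a) := by
  refine graded_induction B.deg ?_ ?_ ?_ a
  · simp
  · intro x y hx hy; simp only [map_add, hx, hy, neg_add]
  · intro p x hx
    cases p with
    | zero => rw [parity_of_mem _ hx, map_smul, B.contr_zero X hx]; simp
    | succ p =>
      rw [parity_of_mem _ hx, parity_of_mem _ (B.contr_mem X hx), map_smul, pow_succ, mul_neg_one,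
        neg_smul, neg_neg]

theorem parity_diff (a : B) : parity B.deg (B.diff a) = -B.diff (parity B.deg a) :=
  parity_of_odd_map _ _ (fun _ _ h => B.diff_mem h) a

theorem diff_mul' (a b : B) : B.diff (a * b) = B.diff a * b + parity B.deg a * B.diff b := by
  refine graded_induction B.deg ?_ ?_ ?_ a
  · simp
  · intro x y hx hy; simp only [map_add, add_mul, hx, hy]; abel
  · intro p x hx
    rw [B.diff_mul b hx, parity_of_mem _ hx, smul_mul_assoc]

theorem contr_mul' (X : LieAlg d G) (a b : B) :
    B.contr X (a * b) = B.contr X a * b + parity B.deg a * B.contr X b := by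
  refine graded_induction B.deg ?_ ?_ ?_ a
  · simp
  · intro x y hx hy; simp only [map_add, add_mul, hx, hy]; abel
  · intro p x hx
    rw [B.contr_mul X b hx, parity_of_mem _ hx, smul_mul_assoc]

theorem lie_mul (X : LieAlg d G) (a b : B) : B.lie X (a * b) = B.lie X a * b + a * B.lie X b := by
  change B.contr X (B.diff (a * b)) + B.diff (B.contr X (a * b)) = (B.contr X (B.diff a) +
    B.diff (B.contr X a)) * b + a * (B.contr X (B.diff b) + B.diff (B.contr X b))
  rw [diff_mul', contr_mul', map_add, map_add, contr_mul', contr_mul', diff_mul', diff_mul',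
    parity_contr, parity_diff, parity_parity]
  noncomm_ring

end GDiffAlg

theorem dForm_mul' {m : ℕ} (x y : Forms m) :
    dForm m (x * y) = dForm m x * y + parity (formDeg m) x * dForm m y := by
  refine graded_induction (formDeg m) ?_ ?_ ?_ x
  · simp
  · intro x y hx hy; simp only [map_add, add_mul, hx, hy]; abel
  · intro p x hx
    rw [dForm_mul hx, parity_of_mem _ hx, smul_mul_assoc]

namespace Mixed

variable {m n : ℕ} {B C : GDiffAlg.{u} d G}

/-- The pure tensor `w ⊗ a` as a bilinear map. -/
def mk (m : ℕ) (B : GDiffAlg.{u} d G) : Forms m →ₗ[ℝ] B →ₗ[ℝ] Mixed m B :=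
  (TensorProduct.mk ℝ (Forms m) B).compr₂
    (GradedTensorProduct.of ℝ (formDeg m) B.deg).toLinearMap

theorem mk_apply (w : Forms m) (a : B) : mk m B w a = GradedTensorProduct.tmul ℝ w a := rfl

-- The sign in the product of `Mixed m B` depends on degrees, so the identities below are checked on
-- tensors with homogeneous factors.
@[elab_as_elim]
theorem hom_induction {P : Mixed m B → Prop} (h0 : P 0) (hadd : ∀ x y, P x → P y → P (x + y))
    (h : ∀ p q, ∀ w ∈ formDeg m p, ∀ a ∈ B.deg q, P (mk m B w a)) (x : Mixed m B) : P x := by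
  obtain ⟨x, rfl⟩ := (GradedTensorProduct.of ℝ (formDeg m) B.deg).surjective x
  induction x using TensorProduct.induction_on with
  | zero => rw [map_zero]; exact h0
  | add x y hx hy => rw [map_add]; exact hadd _ _ hx hy
  | tmul w a =>
    change P (mk m B w a)
    refine graded_induction (formDeg m) ?_ ?_ ?_ w
    · rw [map_zero]; exact h0
    · intro w w' hw hw'; rw [map_add]; exact hadd _ _ hw hw'
    · intro p w hw
      refine graded_induction B.deg ?_ ?_ ?_ a
      · rw [map_zero]; exact h0
      · intro a a' ha ha'; rw [map_add]; exact hadd _ _ ha ha'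
      · intro q a ha
        exact h p q w hw a ha

theorem map_mk (f : Forms m →ₗ[ℝ] Forms n) (g : B →ₗ[ℝ] C) (w : Forms m) (a : B) :
    map f g (mk m B w a) = mk n C (f w) (g a) := rfl

theorem mk_mul_mk {p q : ℕ} (w : Forms m) {w' : Forms m} {a : B} (a' : B) (ha : a ∈ B.deg q)
    (hw : w' ∈ formDeg m p) :
    mk m B w a * mk m B w' a' = (-1 : ℝ) ^ (q * p) • mk m B (w * w') (a * a') :=
  tmul_mul_tmul w a' ha hw

theorem one_eq : (1 : Mixed m B) = mk m B 1 1 := rfl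

/-- The parity involution for the total degree. -/
def par (m : ℕ) (B : GDiffAlg.{u} d G) : Mixed m B →ₗ[ℝ] Mixed m B :=
  map (parity (formDeg m)) (parity B.deg)

theorem par_of_mem {N : ℕ} {x : Mixed m B} (hx : x ∈ totalDeg m B N) :
    par m B x = (-1 : ℝ) ^ N • x := by
  induction hx using Submodule.span_induction with
  | zero => simp
  | add a b _ _ ha hb => rw [map_add, ha, hb, smul_add]
  | smul s a _ ha => rw [map_smul, ha, smul_comm]
  | mem x hx =>
    obtain ⟨p, q, hpq, w, hw, a, ha, rfl⟩ := hx
    rw [par, map_tmul, parity_of_mem _ hw, parity_of_mem _ ha, tmul_smul_smul, ← pow_add, hpq]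

theorem mk_mem {p q : ℕ} {w : Forms m} {a : B} (hw : w ∈ formDeg m p) (ha : a ∈ B.deg q) :
    mk m B w a ∈ totalDeg m B (p + q) :=
  Submodule.subset_span ⟨p, q, rfl, w, hw, a, ha, rfl⟩

theorem diff_mk {p : ℕ} {w : Forms m} (hw : w ∈ formDeg m p) (a : B) :
    diff m B (mk m B w a) = mk m B (dForm m w) a + (-1 : ℝ) ^ p • mk m B w (B.diff a) := by
  rw [diff, LinearMap.add_apply, map_mk, map_mk, parity_of_mem _ hw, map_smul, LinearMap.smul_apply,
    LinearMap.id_apply]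

theorem contr_mk (X : LieAlg d G) {p : ℕ} {w : Forms m} (hw : w ∈ formDeg m p) (a : B) :
    contr m B X (mk m B w a) = (-1 : ℝ) ^ p • mk m B w (B.contr X a) := by
  rw [contr, map_mk, parity_of_mem _ hw, map_smul, LinearMap.smul_apply]

theorem diff_one : diff m B 1 = 0 := by
  rw [one_eq, diff_mk (SetLike.one_mem_graded (formDeg m)), dForm_one, B.diff_one]
  simp

theorem contr_one (X : LieAlg d G) : contr m B X 1 = 0 := by
  rw [one_eq, contr_mk X (SetLike.one_mem_graded (formDeg m)), B.contr_one]
  simp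

theorem diff_diff (x : Mixed m B) : diff m B (diff m B x) = 0 := by
  refine hom_induction ?_ ?_ ?_ x
  · simp
  · intro x y hx hy; simp only [map_add, hx, hy, add_zero]
  · intro p q w hw a ha
    rw [diff_mk hw, map_add, map_smul, diff_mk hw, diff_mk (dForm_mem hw), dForm_dForm, B.diff_diff]
    simp [pow_succ]

/-- The contraction acts on `B` alone and anticommutes with `dForm ⊗ 1`, so these terms cancel in
Cartan's formula. Consequently the Lie derivative passes through every partial evaluation in the
form factor. -/
theorem lie_eq_map (X : LieAlg d G) : lie m B X = map LinearMap.id (B.lie X) := by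
  refine LinearMap.ext fun x => hom_induction ?_ ?_ ?_ x
  · simp
  · intro x y hx hy; simp only [map_add, hx, hy]
  · intro p q w hw a ha
    change contr m B X (diff m B (mk m B w a)) + diff m B (contr m B X (mk m B w a)) =
      mk m B w (B.contr X (B.diff a) + B.diff (B.contr X a))
    rw [diff_mk hw, contr_mk X hw, map_add, map_smul, map_smul, contr_mk X hw,
      contr_mk X (dForm_mem hw), diff_mk hw, map_add]
    rcases neg_one_pow_eq_or ℝ p with h | h <;> simp only [pow_succ, h] <;> module

theorem diff_mul (x y : Mixed m B) :
    diff m B (x * y) = diff m B x * y + par m B x * diff m B y := by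
  refine hom_induction ?_ ?_ ?_ x
  · simp
  · intro x y hx hy; simp only [map_add, add_mul, hx, hy]; abel
  · intro p q w hw a ha
    refine hom_induction ?_ ?_ ?_ y
    · simp
    · intro x y hx hy; simp only [map_add, mul_add, hx, hy]; abel
    · intro p' q' w' hw' a' ha'
      rw [mk_mul_mk w a' ha hw', map_smul, diff_mk (SetLike.mul_mem_graded hw hw'), diff_mk hw,
        diff_mk hw', par_of_mem (mk_mem hw ha), dForm_mul hw, B.diff_mul _ ha, add_mul, mul_add]
      simp only [smul_mul_assoc, mul_smul_comm]
      rw [mk_mul_mk _ _ ha hw', mk_mul_mk _ _ (B.diff_mem ha) hw', mk_mul_mk _ _ ha hw',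
        mk_mul_mk _ _ ha (dForm_mem hw')]
      simp only [map_add, LinearMap.add_apply, map_smul, LinearMap.smul_apply, add_mul, mul_add,
        pow_add, one_mul, mul_one]
      rcases neg_one_pow_eq_or ℝ p with h | h <;> rcases neg_one_pow_eq_or ℝ p' with h' | h' <;>
        rcases neg_one_pow_eq_or ℝ q with h2 | h2 <;>
        rcases neg_one_pow_eq_or ℝ (q * p') with h3 | h3 <;> simp only [h, h', h2, h3] <;> module

theorem contr_mul (X : LieAlg d G) (x y : Mixed m B) :
    contr m B X (x * y) = contr m B X x * y + par m B x * contr m B X y := by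
  refine hom_induction ?_ ?_ ?_ x
  · simp
  · intro x y hx hy; simp only [map_add, add_mul, hx, hy]; abel
  · intro p q w hw a ha
    refine hom_induction ?_ ?_ ?_ y
    · simp
    · intro x y hx hy; simp only [map_add, mul_add, hx, hy]; abel
    · intro p' q' w' hw' a' ha'
      rw [mk_mul_mk w a' ha hw', map_smul, contr_mk X (SetLike.mul_mem_graded hw hw'),
        contr_mk X hw, contr_mk X hw', par_of_mem (mk_mem hw ha), B.contr_mul X _ ha]
      simp only [smul_mul_assoc, mul_smul_comm]
      rw [mk_mul_mk _ _ ha hw']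
      -- Contraction lowers the degree of `a` by one and so changes the Koszul sign by `(-1)^p'`.
      -- For `q = 0` the degree cannot drop, but then the contraction is zero.
      have e : (-1 : ℝ) ^ (q * p') • (mk m B (w * w') (B.contr X a * a')) =
          (-1 : ℝ) ^ p' • (mk m B w (B.contr X a) * mk m B w' a') := by
        cases q with
        | zero => rw [B.contr_zero X ha]; simp
        | succ q =>
          rw [mk_mul_mk _ _ (B.contr_mem X ha) hw', smul_smul, ← pow_add]
          congr 2
          ring
      simp only [map_add, map_smul, smul_add]
      rw [smul_comm, e, pow_add, pow_add]
      rcases neg_one_pow_eq_or ℝ p with h | h <;> rcases neg_one_pow_eq_or ℝ p' with h' | h' <;>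
        rcases neg_one_pow_eq_or ℝ q with h2 | h2 <;>
        rcases neg_one_pow_eq_or ℝ (q * p') with h3 | h3 <;> simp only [h, h', h2, h3] <;> module

theorem totalDeg_anticomm {M N : ℕ} (hM : Odd M) (hN : Odd N) {x y : Mixed m B}
    (hx : x ∈ totalDeg m B M) (hy : y ∈ totalDeg m B N) : x * y = -(y * x) := by
  induction hx using Submodule.span_induction with
  | zero => simp
  | add a b _ _ ha hb => rw [add_mul, ha, hb, mul_add, neg_add]
  | smul s a _ ha => rw [smul_mul_assoc, ha, mul_smul_comm, smul_neg]
  | mem x hx =>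
    obtain ⟨p, q, hpq, w, hw, a, ha, rfl⟩ := hx
    induction hy using Submodule.span_induction with
    | zero => simp
    | add b c _ _ hb hc => rw [add_mul, mul_add, hb, hc, neg_add]
    | smul s b _ hb => rw [smul_mul_assoc, mul_smul_comm, hb, smul_neg]
    | mem y hy =>
      obtain ⟨p', q', hpq', w', hw', a', ha', rfl⟩ := hy
      rw [tmul_mul_tmul w a' ha hw', tmul_mul_tmul w' a ha' hw, form_super_comm hw hw',
        B.super_comm ha ha']
      rw [tmul_smul_smul, smul_smul, ← pow_add, ← pow_add, ← neg_smul]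
      congr 1
      have e : Odd (q * p' + (p * p' + q * q') + q' * p) := by
        have : q * p' + (p * p' + q * q') + q' * p = (p + q) * (p' + q') := by ring
        rw [this, hpq, hpq']
        exact hM.mul hN
      have e' := e.neg_one_pow (α := ℝ)
      rw [pow_add] at e'
      rcases neg_one_pow_eq_or ℝ (q' * p) with h | h <;> rw [h] at e' ⊢ <;> linarith

theorem even_comm {M : ℕ} (hM : Even M) {x : Mixed m B} (hx : x ∈ totalDeg m B M)
    (y : Mixed m B) : x * y = y * x := by
  refine hom_induction ?_ ?_ ?_ y
  · simp
  · intro y z hy hz; rw [mul_add, add_mul, hy, hz]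
  · intro p q w hw a ha
    exact totalDeg_comm hM hx (mk_mem hw ha)

/-- Even elements are central and meet the differential without sign. Applied to curvature
components, this supplies the hypothesis `hE` of `diff_symLift_curvature`. -/
theorem mem_evenLeibniz_diff {M : ℕ} (hM : Even M) {x : Mixed m B} (hx : x ∈ totalDeg m B M) :
    x ∈ evenLeibniz (diff m B) diff_one := fun y => by
  refine ⟨even_comm hM hx y, ?_⟩
  rw [diff_mul, par_of_mem hx, hM.neg_one_pow, one_smul]

theorem mem_evenLeibniz_contr (X : LieAlg d G) {M : ℕ} (hM : Even M) {x : Mixed m B}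
    (hx : x ∈ totalDeg m B M) : x ∈ evenLeibniz (contr m B X) (contr_one X) := fun y => by
  refine ⟨even_comm hM hx y, ?_⟩
  rw [contr_mul, par_of_mem hx, hM.neg_one_pow, one_smul]

/-- The tensor product of two degree preserving algebra homomorphisms. -/
def mapAlg (f : Forms m →ₐ[ℝ] Forms n) (g : B →ₐ[ℝ] C)
    (hf : ∀ p, ∀ w ∈ formDeg m p, f w ∈ formDeg n p) (hg : ∀ p, ∀ a ∈ B.deg p, g a ∈ C.deg p) :
    Mixed m B →ₐ[ℝ] Mixed n C :=
  AlgHom.ofLinearMap (map f.toLinearMap g.toLinearMap)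
    (by rw [one_eq, map_mk]; simp [one_eq]) (fun x y => by
      refine hom_induction ?_ ?_ ?_ x
      · simp
      · intro x y hx hy; simp only [map_add, add_mul, hx, hy]
      · intro p q w hw a ha
        refine hom_induction ?_ ?_ ?_ y
        · simp
        · intro x y hx hy; simp only [map_add, mul_add, hx, hy]
        · intro p' q' w' hw' a' ha'
          rw [mk_mul_mk _ _ ha hw', map_smul, map_mk, map_mk, map_mk]
          refine Eq.trans ?_ (mk_mul_mk (f w) (g a') (hg _ _ ha) (hf _ _ hw')).symm
          simp)

/-- Pull-back along a map of simplices, as an algebra homomorphism. -/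
def pullAlg (φ : Fin (m + 1) →o Fin (n + 1)) (B : GDiffAlg.{u} d G) : Mixed n B →ₐ[ℝ] Mixed m B :=
  mapAlg (pullForm φ) (AlgHom.id ℝ B) (fun _ _ h => pullForm_mem φ h) fun _ _ h => h

theorem pullAlg_mk (φ : Fin (m + 1) →o Fin (n + 1)) (w : Forms n) (a : B) :
    pullAlg φ B (mk n B w a) = mk m B (pullForm φ w) a := rfl

/-- The map induced by a morphism, as an algebra homomorphism. -/
def pushAlg (m : ℕ) (f : B ⟶ C) : Mixed m B →ₐ[ℝ] Mixed m C :=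
  mapAlg (AlgHom.id ℝ _) (GDiffAlg.homAlg f) (fun _ _ h => h)
    fun _ _ h => GDiffAlg.Hom.map_deg f h

theorem pushAlg_mk (f : B ⟶ C) (w : Forms m) (a : B) :
    pushAlg m f (mk m B w a) = mk m C w (GDiffAlg.homAlg f a) := rfl

theorem diff_pullAlg (φ : Fin (m + 1) →o Fin (n + 1)) (x : Mixed n B) :
    diff m B (pullAlg φ B x) = pullAlg φ B (diff n B x) := by
  refine hom_induction ?_ ?_ ?_ x
  · simp
  · intro x y hx hy; simp only [map_add, hx, hy]
  · intro p q w hw a ha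
    rw [diff_mk hw, pullAlg_mk, diff_mk (pullForm_mem φ hw), dForm_pullForm, map_add, map_smul]
    rfl

theorem diff_pushAlg (f : B ⟶ C) (x : Mixed m B) :
    diff m C (pushAlg m f x) = pushAlg m f (diff m B x) := by
  refine hom_induction ?_ ?_ ?_ x
  · simp
  · intro x y hx hy; simp only [map_add, hx, hy]
  · intro p q w hw a ha
    rw [diff_mk hw, pushAlg_mk, diff_mk hw, map_add, map_smul, pushAlg_mk, pushAlg_mk]
    rw [show GDiffAlg.homAlg f (B.diff a) = _ from GDiffAlg.Hom.map_diff f a]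
    rfl

end Mixed

end ChernWeil
end

/-! ### Chern–Weil forms of families of connections and of pseudo-connections. -/

noncomputable section

namespace ChernWeil

variable {d : ℕ} {G : Type v} [TopologicalSpace G] [ChartedSpace (EuclideanSpace ℝ (Fin d)) G]
  [Group G]

/-! ### The components of a connection -/

namespace Connection

variable {B C : GDiffAlg.{u} d G} (c : Connection B)

theorem pairing_mem_deg (ξ : Module.Dual ℝ (LieAlg d G)) : pairing c.form ξ ∈ B.deg 1 := by
  obtain ⟨τ, hτ⟩ := c.form_mem
  rw [← hτ]
  clear hτ
  induction τ using TensorProduct.induction_on with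
  | zero => simp [pairing_zero]
  | add a b ha hb => rw [map_add, pairing_add]; exact add_mem ha hb
  | tmul a X =>
    rw [TensorProduct.map_tmul, pairing_tmul]
    exact Submodule.smul_mem _ _ a.2

theorem contr_pairing (X : LieAlg d G) (ξ : Module.Dual ℝ (LieAlg d G)) :
    B.contr X (pairing c.form ξ) = ξ X • (1 : B) := by
  have h := pairing_map (B.contr X) LinearMap.id c.form ξ
  rw [c.contr_form X, LinearMap.comp_id, pairing_tmul] at h
  exact h.symm

theorem act_pairing (g : G) (ξ : Module.Dual ℝ (LieAlg d G)) :
    B.act g (pairing c.form (ξ ∘ₗ Ad g)) = pairing c.form ξ := by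
  have h := pairing_map (B.act g).toLinearMap (Ad g) c.form ξ
  rw [c.invariant g] at h
  exact h.symm

theorem act_inv_pairing (g : G) (ξ : Module.Dual ℝ (LieAlg d G)) :
    B.act g⁻¹ (pairing c.form ξ) = pairing c.form (ξ ∘ₗ Ad g) := by
  rw [← c.act_pairing g ξ, ← AlgHom.mul_apply, ← map_mul]
  simp

/-- Cartan's formula reduces the left side to `L_X θ^ξ`, since `i_X θ^ξ` is the constant `ξ(X)`. The
invariance of the connection then computes `L_X θ^ξ` from the derivative of `Ad`. -/
theorem contr_diff_pairing [T2Space G] [LieGroup (𝓡 d) ∞ G] (X : LieAlg d G)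
    (ξ : Module.Dual ℝ (LieAlg d G)) : B.contr X (B.diff (pairing c.form ξ)) =
      -pairing c.form (ξ ∘ₗ (LieAlgebra.ad ℝ (LieAlg d G) X)) := by
  obtain ⟨γ, h⟩ := exists_isOneParameterSubgroup X
  have h1 := B.infinitesimal X γ h (pairing c.form ξ)
  rw [c.contr_pairing, map_smul, B.diff_one, smul_zero, add_zero] at h1
  -- The quotient is taken at `-t`, because invariance expresses the action of `(γ t)⁻¹ = γ (-t)` on
  -- `θ^ξ` through `Ad (γ t)`. The substitution produces the minus sign.
  have hneg : Filter.Tendsto (fun t : ℝ => -t) (𝓝[≠] 0) (𝓝[≠] 0) := by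
    refine tendsto_nhdsWithin_iff.2 ⟨?_, ?_⟩
    · have : Filter.Tendsto (fun t : ℝ => -t) (𝓝 0) (𝓝 0) := by
        simpa using continuous_neg.tendsto (0 : ℝ)
      exact this.mono_left nhdsWithin_le_nhds
    · filter_upwards [self_mem_nhdsWithin] with t ht
      simpa using ht
  have h2 := h1.comp hneg
  let b := Module.finBasis ℝ (LieAlg d G)
  have hγ : ∀ t, γ (-t) = (γ t)⁻¹ := fun t => by
    refine eq_inv_of_mul_eq_one_left ?_
    rw [← h.map_add, neg_add_cancel, h.map_zero]
  -- In a basis the quotient is a combination of fixed elements with real coefficients, so only real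
  -- limits have to be computed; limits in `B` are unique because its topology is Hausdorff.
  have h3 : Filter.Tendsto (fun t : ℝ => -∑ i, (t⁻¹ • (ξ (Ad (γ t) (b i)) - ξ (b i))) •
      pairing c.form (b.coord i)) (𝓝[≠] 0)
      (𝓝 (-∑ i, ξ ⁅X, b i⁆ • pairing c.form (b.coord i))) := by
    refine (tendsto_finsetSum _ fun i _ => Filter.Tendsto.smul_const ?_ _).neg
    have := (h.hasDerivAt_dual_Ad ξ (b i)).tendsto_slope_zero
    simpa [h.map_zero, Ad_one] using this
  have h4 : pairing c.form (ξ ∘ₗ (LieAlgebra.ad ℝ (LieAlg d G) X)) =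
      ∑ i, ξ ⁅X, b i⁆ • pairing c.form (b.coord i) := pairing_eq_sum b c.form _
  rw [h4]
  refine tendsto_nhds_unique h2 (h3.congr fun t => ?_)
  simp only [Function.comp_apply]
  rw [hγ, c.act_inv_pairing, pairing_eq_sum b c.form (ξ ∘ₗ Ad (γ t)), pairing_eq_sum b c.form ξ,
    ← Finset.sum_sub_distrib, Finset.smul_sum, ← Finset.sum_neg_distrib]
  refine Finset.sum_congr rfl fun i _ => ?_
  rw [LinearMap.comp_apply]
  simp only [smul_eq_mul, inv_neg]
  module

/-- The image of a connection under a morphism. -/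
def map (f : B ⟶ C) : Connection C where
  form := TensorProduct.map (GDiffAlg.homAlg f).toLinearMap LinearMap.id c.form
  form_mem := by
    obtain ⟨τ, hτ⟩ := c.form_mem
    let g : B.deg 1 →ₗ[ℝ] C.deg 1 := (GDiffAlg.homAlg f).toLinearMap.restrict
      fun _ h => GDiffAlg.Hom.map_deg f h
    refine ⟨TensorProduct.map g LinearMap.id τ, ?_⟩
    rw [← hτ, ← LinearMap.comp_apply, ← LinearMap.comp_apply, ← TensorProduct.map_comp,
      ← TensorProduct.map_comp]
    rfl
  invariant g := by
    conv_rhs => rw [← c.invariant g]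
    rw [← LinearMap.comp_apply, ← LinearMap.comp_apply, ← TensorProduct.map_comp,
      ← TensorProduct.map_comp]
    refine congrArg (fun L => TensorProduct.map L (Ad g) c.form) (LinearMap.ext fun a => ?_)
    exact (GDiffAlg.Hom.map_act f g a).symm
  contr_form X := by
    have h := congrArg (TensorProduct.map (GDiffAlg.homAlg f).toLinearMap
      (LinearMap.id : LieAlg d G →ₗ[ℝ] LieAlg d G)) (c.contr_form X)
    rw [TensorProduct.map_tmul, AlgHom.toLinearMap_apply, map_one, LinearMap.id_apply] at h
    refine Eq.trans ?_ h
    rw [← LinearMap.comp_apply, ← LinearMap.comp_apply, ← TensorProduct.map_comp,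
      ← TensorProduct.map_comp]
    refine congrArg (fun L => TensorProduct.map L
      (LinearMap.id : LieAlg d G →ₗ[ℝ] LieAlg d G) c.form) (LinearMap.ext fun a => ?_)
    exact (GDiffAlg.Hom.map_contr f X a).symm

@[ext]
theorem ext' {c c' : Connection B} (h : c.form = c'.form) : c = c' := by
  cases c; cases c'; cases h; rfl

theorem map_comp {E : GDiffAlg.{u} d G} (f : B ⟶ C) (g : C ⟶ E) :
    c.map (f ≫ g) = (c.map f).map g := by
  ext1
  change _ = TensorProduct.map _ _ (TensorProduct.map _ _ c.form)
  rw [← LinearMap.comp_apply, ← TensorProduct.map_comp]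
  rfl

end Connection

/-! ### The Chern-Weil forms of a family of connections -/

section Family

variable {m n : ℕ} {B C : GDiffAlg.{u} d G}

/-- The form `∑ t_i ⊗ θ_i` for connections `θ_0, ..., θ_m`. -/
def famConnection (c : Fin (m + 1) → Connection B) : Mixed m B ⊗[ℝ] LieAlg d G :=
  ∑ i, TensorProduct.map (Mixed.mk m B (fnForm m (coord i))) LinearMap.id (c i).form

theorem pairing_famConnection (c : Fin (m + 1) → Connection B)
    (ξ : Module.Dual ℝ (LieAlg d G)) : pairing (famConnection c) ξ =
      ∑ i, Mixed.mk m B (fnForm m (coord i)) (pairing (c i).form ξ) := by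
  let P : Mixed m B ⊗[ℝ] LieAlg d G →+ (Module.Dual ℝ (LieAlg d G) →ₗ[ℝ] Mixed m B) :=
    ⟨⟨pairing, pairing_zero⟩, pairing_add⟩
  have : pairing (famConnection c) = ∑ i,
      pairing (TensorProduct.map (Mixed.mk m B (fnForm m (coord i))) LinearMap.id (c i).form) :=
    map_sum P _ _
  rw [this, LinearMap.sum_apply]
  exact Finset.sum_congr rfl fun i _ => pairing_map _ _ _ _

theorem fnForm_mem (f : SmoothFn m) : fnForm m f ∈ formDeg m 0 :=
  Submodule.tmul_mem_baseChange_of_mem f (SetLike.one_mem_graded fun k : ℕ => ⋀[ℝ]^k (Fin m → ℝ))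

theorem pairing_famConnection_mem (c : Fin (m + 1) → Connection B)
    (ξ : Module.Dual ℝ (LieAlg d G)) : pairing (famConnection c) ξ ∈ Mixed.totalDeg m B 1 := by
  rw [pairing_famConnection]
  refine Submodule.sum_mem _ fun i _ => Submodule.subset_span ?_
  exact ⟨0, 1, rfl, _, fnForm_mem _, _, (c i).pairing_mem_deg ξ, rfl⟩

theorem sum_fnForm_coord (m : ℕ) : ∑ i, fnForm m (coord i) = 1 := by
  rw [← map_sum, sum_coord, map_one]

variable [LieGroup (𝓡 d) ∞ G]

theorem pairing_curvature_mem {Θ : Mixed m B ⊗[ℝ] LieAlg d G}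
    (h : ∀ ξ, pairing Θ ξ ∈ Mixed.totalDeg m B 1) (ξ : Module.Dual ℝ (LieAlg d G)) :
    pairing (curvature (Mixed.diff m B) Θ) ξ ∈ Mixed.totalDeg m B 2 := by
  rw [pairing_curvature (Module.finBasis ℝ (LieAlg d G))]
  have h2 : ∀ ξ ζ, pairing Θ ξ * pairing Θ ζ ∈ Mixed.totalDeg m B 2 := fun ξ ζ =>
    Mixed.totalDeg_mul (M := 1) (N := 1) (h ξ) (h ζ)
  refine Submodule.add_mem _ (Mixed.totalDeg_diff (h ξ)) (Submodule.smul_mem _ _ ?_)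
  exact Submodule.sum_mem _ fun i _ => Submodule.sum_mem _ fun j _ =>
    Submodule.smul_mem _ _ (h2 _ _)

/-- The pairing with the curvature of a family of connections. -/
def famCurv (c : Fin (m + 1) → Connection B) : Module.Dual ℝ (LieAlg d G) →ₗ[ℝ] Mixed m B :=
  pairing (curvature (Mixed.diff m B) (famConnection c))

theorem famCurv_mem (c : Fin (m + 1) → Connection B) (ξ : Module.Dual ℝ (LieAlg d G)) :
    famCurv c ξ ∈ Mixed.totalDeg m B 2 :=
  pairing_curvature_mem (pairing_famConnection_mem c) ξ

theorem famCurv_comm (c : Fin (m + 1) → Connection B) (ξ ζ : Module.Dual ℝ (LieAlg d G)) :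
    famCurv c ξ * famCurv c ζ = famCurv c ζ * famCurv c ξ :=
  Mixed.even_comm even_two (famCurv_mem c ξ) _

/-- The Chern-Weil forms of a family of connections. -/
def famChernWeil (c : Fin (m + 1) → Connection B) : SymDual d G →ₐ[ℝ] Mixed m B :=
  symLift (famCurv c) (famCurv_comm c)

theorem famChernWeil_ι (c : Fin (m + 1) → Connection B) (ξ : Module.Dual ℝ (LieAlg d G)) :
    famChernWeil c (SymmetricAlgebra.ι ℝ _ ξ) = famCurv c ξ :=
  symLift_ι _ _ _

theorem diff_famChernWeil [T2Space G] (c : Fin (m + 1) → Connection B) {f : SymDual d G}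
    (hf : f ∈ invariantPolys d G) : Mixed.diff m B (famChernWeil c f) = 0 := by
  have h := pairing_famConnection_mem c
  have hd := fun ξ => Mixed.totalDeg_diff (h ξ)
  refine (diff_symLift_curvature (Module.finBasis ℝ (LieAlg d G)) Mixed.diff_one
    (fun ξ ζ => Mixed.totalDeg_anticomm odd_one odd_one (h ξ) (h ζ)) (fun ξ ζ => ?_)
    (fun ξ ζ => Mixed.even_comm even_two (hd ξ) _) (fun ξ => Mixed.diff_diff _)
    (fun ξ => Mixed.mem_evenLeibniz_diff even_two (famCurv_mem c ξ)) (famCurv_comm c) f).trans ?_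
  · rw [Mixed.diff_mul, Mixed.par_of_mem (h ξ), pow_one, neg_one_smul, neg_mul, sub_eq_add_neg]
  · rw [neg_eq_zero]
    refine Finset.sum_eq_zero fun i _ => ?_
    rw [coadDeriv_of_invariant _ hf]
    exact (congrArg _ (map_zero (famChernWeil c))).trans (mul_zero _)

-- Vertex `i` contributes `t_i ξ(X)`, and `∑ t_i = 1`: affine combinations of connections still
-- satisfy `i_X θ = 1 ⊗ X`.
omit [LieGroup (𝓡 d) ∞ G] in
theorem contr_pairing_famConnection (c : Fin (m + 1) → Connection B) (X : LieAlg d G)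
    (ξ : Module.Dual ℝ (LieAlg d G)) :
    Mixed.contr m B X (pairing (famConnection c) ξ) = ξ X • 1 := by
  rw [pairing_famConnection, map_sum]
  simp_rw [Mixed.contr_mk X (fnForm_mem _), (c _).contr_pairing, pow_zero, one_smul, map_smul]
  rw [← Finset.smul_sum, ← LinearMap.sum_apply, ← map_sum, sum_fnForm_coord]
  rfl

/-- Besides the terms of the single connections there are `dt_i ⊗ θ_i`, whose contractions `-ξ(X)
dt_i` add up to zero because `∑ dt_i = d 1 = 0`. -/
theorem contr_diff_pairing_famConnection [T2Space G] (c : Fin (m + 1) → Connection B)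
    (X : LieAlg d G) (ξ : Module.Dual ℝ (LieAlg d G)) :
    Mixed.contr m B X (Mixed.diff m B (pairing (famConnection c) ξ)) =
      -pairing (famConnection c) (ξ ∘ₗ (LieAlgebra.ad ℝ (LieAlg d G) X)) := by
  have h : Mixed.diff m B (pairing (famConnection c) ξ) =
      ∑ i, Mixed.mk m B (dForm m (fnForm m (coord i))) (pairing (c i).form ξ) +
      ∑ i, Mixed.mk m B (fnForm m (coord i)) (B.diff (pairing (c i).form ξ)) := by
    rw [pairing_famConnection, map_sum, ← Finset.sum_add_distrib]
    refine Finset.sum_congr rfl fun i _ => ?_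
    rw [Mixed.diff_mk (fnForm_mem _), pow_zero, one_smul]
  rw [h, map_add, map_sum, map_sum]
  simp_rw [Mixed.contr_mk X (Mixed.dForm_mem (fnForm_mem _)), Mixed.contr_mk X (fnForm_mem _),
    (c _).contr_pairing, (c _).contr_diff_pairing, pow_zero, one_smul, map_smul, map_neg]
  rw [← Finset.smul_sum, ← Finset.smul_sum, ← LinearMap.sum_apply, ← map_sum, ← map_sum,
    sum_fnForm_coord, dForm_one, pairing_famConnection, ← Finset.sum_neg_distrib]
  simp

/-- Here `i_X dθ = -[X, θ]` and `½ i_X [θ, θ] = [X, θ]` cancel. No invariance of a polynomial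
enters, so `f(Ω)` is horizontal for every `f`. -/
theorem contr_famCurv [T2Space G] (c : Fin (m + 1) → Connection B) (X : LieAlg d G)
    (ξ : Module.Dual ℝ (LieAlg d G)) : Mixed.contr m B X (famCurv c ξ) = 0 := by
  let b := Module.finBasis ℝ (LieAlg d G)
  set t : Module.Dual ℝ (LieAlg d G) →ₗ[ℝ] Mixed m B := pairing (famConnection c) with ht
  have e : ∀ ξ ζ, Mixed.contr m B X (t ξ * t ζ) = ξ X • t ζ - ζ X • t ξ := fun ξ ζ => by
    rw [Mixed.contr_mul, Mixed.par_of_mem (pairing_famConnection_mem c ξ), ht,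
      contr_pairing_famConnection, contr_pairing_famConnection]
    simp [sub_eq_add_neg]
  have hX : X = ∑ i, b.coord i X • b i := (b.sum_repr X).symm
  have e1 : t (ξ ∘ₗ (LieAlgebra.ad ℝ (LieAlg d G) X)) =
      ∑ i, ∑ j, ξ ⁅b i, b j⁆ • (b.coord i X • t (b.coord j)) := by
    rw [ht, pairing_eq_sum b, Finset.sum_comm]
    refine Finset.sum_congr rfl fun j _ => ?_
    have : (ξ ∘ₗ (LieAlgebra.ad ℝ (LieAlg d G) X)) (b j) = ∑ i, ξ ⁅b i, b j⁆ * b.coord i X := by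
      conv_lhs => rw [LinearMap.comp_apply, LieAlgebra.ad_apply, hX, sum_lie, map_sum]
      refine Finset.sum_congr rfl fun i _ => ?_
      rw [smul_lie, map_smul, smul_eq_mul, mul_comm]
    rw [this, Finset.sum_smul]
    simp_rw [mul_smul]
  have e2 : ∑ i, ∑ j, ξ ⁅b i, b j⁆ • (b.coord j X • t (b.coord i)) =
      -∑ i, ∑ j, ξ ⁅b i, b j⁆ • (b.coord i X • t (b.coord j)) := by
    rw [Finset.sum_comm, ← Finset.sum_neg_distrib]
    refine Finset.sum_congr rfl fun j _ => ?_
    rw [← Finset.sum_neg_distrib]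
    refine Finset.sum_congr rfl fun i _ => ?_
    rw [← lie_skew, map_neg, neg_smul]
  rw [famCurv, pairing_curvature b, map_add, contr_diff_pairing_famConnection, map_smul, map_sum]
  simp_rw [map_sum, map_smul]
  change -t _ + (1 / 2 : ℝ) • ∑ i, ∑ j, ξ ⁅b i, b j⁆ •
    Mixed.contr m B X (t (b.coord i) * t (b.coord j)) = 0
  simp_rw [e, smul_sub, Finset.sum_sub_distrib]
  rw [e2, e1]
  module

theorem contr_famChernWeil [T2Space G] (c : Fin (m + 1) → Connection B) (X : LieAlg d G)
    (f : SymDual d G) : Mixed.contr m B X (famChernWeil c f) = 0 :=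
  symLift_killed _ _ (Mixed.contr_one X)
    (fun ξ => Mixed.mem_evenLeibniz_contr X even_two (famCurv_mem c ξ)) (contr_famCurv c X) f

theorem lie_famChernWeil [T2Space G] (c : Fin (m + 1) → Connection B) (X : LieAlg d G)
    {f : SymDual d G} (hf : f ∈ invariantPolys d G) : Mixed.lie m B X (famChernWeil c f) = 0 := by
  rw [Mixed.lie, LinearMap.add_apply, LinearMap.comp_apply, LinearMap.comp_apply,
    diff_famChernWeil c hf, contr_famChernWeil, map_zero, map_zero, add_zero]

/-! ### Naturality and degrees -/

omit [LieGroup (𝓡 d) ∞ G] in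
theorem algHom_famChernWeil_aux {R R' : Type*} [Ring R] [Algebra ℝ R] [Ring R'] [Algebra ℝ R']
    (ψ : R →ₐ[ℝ] R') (F : SymDual d G →ₐ[ℝ] R) (F' : SymDual d G →ₐ[ℝ] R')
    (h : ∀ ξ, ψ (F (SymmetricAlgebra.ι ℝ _ ξ)) = F' (SymmetricAlgebra.ι ℝ _ ξ))
    (f : SymDual d G) : ψ (F f) = F' f := by
  induction f using SymmetricAlgebra.induction with
  | algebraMap r => rw [AlgHom.commutes, AlgHom.commutes, AlgHom.commutes]
  | ι x => exact h x
  | mul a b ha hb => rw [map_mul, map_mul, map_mul, ha, hb]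
  | add a b ha hb => rw [map_add, map_add, map_add, ha, hb]

theorem algHom_pairing_curvature {R R' : Type*} [Ring R] [Algebra ℝ R] [Ring R'] [Algebra ℝ R']
    (ψ : R →ₐ[ℝ] R') {D : R →ₗ[ℝ] R} {D' : R' →ₗ[ℝ] R'} (hD : ∀ x, D' (ψ x) = ψ (D x))
    {Θ : R ⊗[ℝ] LieAlg d G} {Θ' : R' ⊗[ℝ] LieAlg d G} (h : ∀ ξ, ψ (pairing Θ ξ) = pairing Θ' ξ)
    (ξ : Module.Dual ℝ (LieAlg d G)) :
    ψ (pairing (curvature D Θ) ξ) = pairing (curvature D' Θ') ξ := by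
  let b := Module.finBasis ℝ (LieAlg d G)
  rw [pairing_curvature b, pairing_curvature b, map_add, map_smul, map_sum]
  simp_rw [map_sum, map_smul, map_mul, h, ← hD, h]

/-- The coordinate `t_j` pulls back to the sum of the `t_i` with `φ i = j`, so the pulled back
connection form belongs to the reindexed family. Pull-back is a homomorphism commuting with `d`, so
curvature and polynomials follow. -/
theorem pullAlg_famChernWeil (φ : Fin (m + 1) →o Fin (n + 1)) (c : Fin (n + 1) → Connection B)
    (f : SymDual d G) : Mixed.pullAlg φ B (famChernWeil c f) = famChernWeil (c ∘ φ) f := by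
  refine algHom_famChernWeil_aux (Mixed.pullAlg φ B) (famChernWeil c)
    (famChernWeil (c ∘ φ)) (fun ξ => ?_) f
  rw [famChernWeil_ι, famChernWeil_ι]
  refine algHom_pairing_curvature (Mixed.pullAlg φ B) (Mixed.diff_pullAlg φ) (fun ζ => ?_) ξ
  rw [pairing_famConnection, pairing_famConnection, map_sum]
  have e : ∀ j, pullForm φ (fnForm n (coord j)) = ∑ i with φ i = j, fnForm m (coord i) :=
    fun j => by
      have : pullForm φ (fnForm n (coord j)) = fTmul (pullFn φ (coord j))
          (ExteriorAlgebra.map (pullCovector φ) 1) := rfl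
      rw [this, map_one, pullFn_coord, fTmul_sum_left]
      rfl
  simp_rw [Mixed.pullAlg_mk, e, map_sum, LinearMap.sum_apply]
  rw [← Finset.sum_fiberwise (s := Finset.univ) (g := φ)]
  refine Finset.sum_congr rfl fun j _ => Finset.sum_congr rfl fun i hi => ?_
  rw [Function.comp_apply, (Finset.mem_filter.1 hi).2]

theorem pushAlg_famChernWeil (g : B ⟶ C) (c : Fin (m + 1) → Connection B)
    (f : SymDual d G) :
    Mixed.pushAlg m g (famChernWeil c f) = famChernWeil (fun i => (c i).map g) f := by
  refine algHom_famChernWeil_aux (Mixed.pushAlg m g) (famChernWeil c)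
    (famChernWeil fun i => (c i).map g) (fun ξ => ?_) f
  rw [famChernWeil_ι, famChernWeil_ι]
  refine algHom_pairing_curvature (Mixed.pushAlg m g) (Mixed.diff_pushAlg g) (fun ζ => ?_) ξ
  rw [pairing_famConnection, pairing_famConnection, map_sum]
  refine Finset.sum_congr rfl fun i _ => ?_
  rw [Mixed.pushAlg_mk]
  congr 1
  exact (pairing_map (GDiffAlg.homAlg g).toLinearMap LinearMap.id (c i).form ζ).symm

theorem famChernWeil_mem (c : Fin (m + 1) → Connection B) {k : ℕ} {f : SymDual d G}
    (hf : f ∈ symDeg d G k) : famChernWeil c f ∈ Mixed.totalDeg m B (2 * k) := by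
  induction hf using Submodule.pow_induction_on_left' with
  | algebraMap r =>
    rw [AlgHom.commutes, Algebra.algebraMap_eq_smul_one]
    refine Submodule.smul_mem _ _ (Submodule.subset_span ?_)
    exact ⟨0, 0, rfl, 1, SetLike.one_mem_graded (formDeg m), 1, SetLike.one_mem_graded B.deg, rfl⟩
  | add x y i hx hy ihx ihy => rw [map_add]; exact Submodule.add_mem _ ihx ihy
  | mem_mul x hx i y hy ih =>
    obtain ⟨ξ, rfl⟩ := hx
    rw [map_mul, famChernWeil_ι, Nat.succ_eq_add_one, show 2 * (i + 1) = 2 + 2 * i by ring]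
    exact Mixed.totalDeg_mul (famCurv_mem c ξ) ih

omit [LieGroup (𝓡 d) ∞ G] in
theorem exists_mem_symDeg (f : SymDual d G) : ∃ N, f ∈ ⨆ k ≤ N, symDeg d G k := by
  have mono : ∀ {M N : ℕ}, M ≤ N → ⨆ k ≤ M, symDeg d G k ≤ ⨆ k ≤ N, symDeg d G k := fun h =>
    iSup₂_le fun k hk => le_iSup₂_of_le k (hk.trans h) le_rfl
  induction f using SymmetricAlgebra.induction with
  | algebraMap r =>
    refine ⟨0, Submodule.mem_iSup_of_mem 0 (Submodule.mem_iSup_of_mem le_rfl ?_)⟩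
    rw [symDeg, pow_zero]
    exact Submodule.algebraMap_mem r
  | ι x =>
    refine ⟨1, Submodule.mem_iSup_of_mem 1 (Submodule.mem_iSup_of_mem le_rfl ?_)⟩
    rw [symDeg, pow_one]
    exact ⟨x, rfl⟩
  | add a b ha hb =>
    obtain ⟨M, hM⟩ := ha
    obtain ⟨N, hN⟩ := hb
    exact ⟨max M N, add_mem (mono (le_max_left M N) hM) (mono (le_max_right M N) hN)⟩
  | mul a b ha hb =>
    obtain ⟨M, hM⟩ := ha
    obtain ⟨N, hN⟩ := hb
    refine ⟨M + N, ?_⟩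
    have h := Submodule.mul_mem_mul hM hN
    simp_rw [Submodule.iSup_mul, Submodule.mul_iSup] at h
    refine (iSup_le fun i => iSup_le fun hi => iSup_le fun j => iSup_le fun hj => ?_ :
      _ ≤ ⨆ k ≤ M + N, symDeg d G k) h
    refine le_iSup₂_of_le (i + j) (by omega) ?_
    rw [symDeg, symDeg, symDeg, ← pow_add]

/-- The bound depends on `f` alone, not on the simplex, the algebra or the family. This uniformity
gives bounded degree in the fat realization and finite length of the cochains. -/
theorem exists_bound_famChernWeil (f : SymDual d G) :
    ∃ N, ∀ (m : ℕ) (B : GDiffAlg.{u} d G) (c : Fin (m + 1) → Connection B),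
      famChernWeil c f ∈ ⨆ k ≤ N, Mixed.totalDeg m B (2 * k) := by
  obtain ⟨N, hN⟩ := exists_mem_symDeg f
  refine ⟨N, fun m B c => ?_⟩
  have h : (⨆ k ≤ N, symDeg d G k) ≤ (⨆ k ≤ N, Mixed.totalDeg m B (2 * k)).comap
      (famChernWeil c).toLinearMap :=
    iSup₂_le fun k hk x hx => Submodule.mem_iSup_of_mem k
      (Submodule.mem_iSup_of_mem hk (famChernWeil_mem c hx))
  exact h hN

end Family

/-! ### The Chern-Weil forms of a pseudo-connection -/

namespace GDiffSimplicialAlg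

variable [LieGroup (𝓡 d) ∞ G] {A : GDiffSimplicialAlg.{u} d G}

/-- The connections on `A_n` induced by a pseudo-connection at the vertices. -/
def vertexConnection (θ : PseudoConnection A) (n : ℕ) (i : Fin (n + 1)) : Connection (lvl A n) :=
  Connection.map θ
    (A.map (SimplexCategory.const (SimplexCategory.mk 0) (SimplexCategory.mk n) i))

omit [LieGroup (𝓡 d) ∞ G] in
theorem vertexConnection_map (θ : PseudoConnection A) {m n : ℕ}
    (φ : SimplexCategory.mk m ⟶ SimplexCategory.mk n) (i : Fin (m + 1)) :
    (vertexConnection θ m i).map (A.map φ) = vertexConnection θ n (φ.toOrderHom i) := by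
  rw [vertexConnection, ← Connection.map_comp, ← A.map_comp]
  rfl

/-- The fat form is the family form of the connections carried by the vertices, which makes all
results on families available for pseudo-connections. -/
theorem fatChernWeil_apply (θ : PseudoConnection A) (f : SymDual d G) (n : ℕ) :
    fatChernWeil θ f n = famChernWeil (vertexConnection θ n) f := by
  have h : fatConnection θ n = famConnection (vertexConnection θ n) := by
    rw [fatConnection, famConnection, baryExtend]
    have : ∀ (s : Finset (Fin (n + 1))) (L : Fin (n + 1) → (lvl A 0 →ₗ[ℝ] Mixed n (lvl A n))),
        TensorProduct.map (∑ i ∈ s, L i) (LinearMap.id : LieAlg d G →ₗ[ℝ] LieAlg d G) =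
          ∑ i ∈ s, TensorProduct.map (L i) LinearMap.id := fun s L => by
      induction s using Finset.cons_induction with
      | empty => simp
      | cons a s ha ih => rw [Finset.sum_cons, Finset.sum_cons, TensorProduct.map_add_left, ih]
    rw [this, LinearMap.sum_apply]
    refine Finset.sum_congr rfl fun i _ => ?_
    rw [vertexConnection, Connection.map, ← LinearMap.comp_apply, ← TensorProduct.map_comp]
    rfl
  refine algHom_famChernWeil_aux (AlgHom.id ℝ _) (symLift (pairing (fatCurvature θ n))
    (fatCurvature_comm θ n)) (famChernWeil (vertexConnection θ n)) (fun ξ => ?_) f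
  rw [famChernWeil_ι, symLift_ι, fatCurvature, h]
  rfl

end GDiffSimplicialAlg

end ChernWeil
end

/-! ### Stokes' theorem on the simplex. -/

noncomputable section

namespace ChernWeil

open MeasureTheory

/-! ### Integration of partial derivatives over the simplex -/

/-- The affine involution of the simplex exchanging the barycentric coordinates `0` and `j + 1`. -/
def swapVertex {n : ℕ} (j : Fin n) (y : Fin n → ℝ) : Fin n → ℝ :=
  Function.update y j (1 - ∑ i, y i)

theorem sum_swapVertex {n : ℕ} (j : Fin n) (y : Fin n → ℝ) :
    ∑ i, swapVertex j y i = 1 - y j := by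
  have h := Finset.sum_update_of_mem (Finset.mem_univ j) y (1 - ∑ i, y i)
  rw [swapVertex, h]
  have h2 := Finset.sum_sdiff_eq_sub (f := y) (Finset.subset_univ {j})
  rw [h2]
  simp

theorem swapVertex_swapVertex {n : ℕ} (j : Fin n) (y : Fin n → ℝ) :
    swapVertex j (swapVertex j y) = y := by
  rw [swapVertex, sum_swapVertex, swapVertex, Function.update_idem, sub_sub_cancel,
    Function.update_eq_self]

theorem swapVertex_mem {n : ℕ} (j : Fin n) {y : Fin n → ℝ} (hy : y ∈ Simplex n) :
    swapVertex j y ∈ Simplex n := by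
  refine ⟨fun i => ?_, ?_⟩
  · rw [swapVertex]
    by_cases h : i = j
    · subst h
      rw [Function.update_self]
      linarith [hy.2]
    · rw [Function.update_of_ne h]
      exact hy.1 i
  · rw [sum_swapVertex]
    linarith [hy.1 j]

/-- The linear part of `swapVertex`. -/
def swapLinear {n : ℕ} (j : Fin n) : (Fin n → ℝ) →L[ℝ] (Fin n → ℝ) :=
  ContinuousLinearMap.pi fun i => if i = j then
    -∑ k, ContinuousLinearMap.proj (R := ℝ) (φ := fun _ : Fin n => ℝ) k
    else ContinuousLinearMap.proj (R := ℝ) (φ := fun _ : Fin n => ℝ) i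

theorem swapVertex_eq {n : ℕ} (j : Fin n) (y : Fin n → ℝ) :
    swapVertex j y = swapLinear j y + Pi.single j 1 := by
  ext i
  by_cases h : i = j
  · subst h
    simp [swapVertex, swapLinear, sub_eq_neg_add]
  · simp [swapVertex, swapLinear, h]

/-- The linear part of an affine involution is an involution, so its determinant squares to `1`. -/
theorem abs_det_swapLinear {n : ℕ} (j : Fin n) : |(swapLinear j).det| = 1 := by
  have h : (swapLinear j).comp (swapLinear j) = ContinuousLinearMap.id ℝ (Fin n → ℝ) := by
    ext1 y
    have h0 : ∀ z, swapLinear j z = swapVertex j z - Pi.single j 1 := fun z => by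
      rw [swapVertex_eq]; simp
    have h1 := swapVertex_swapVertex j y
    rw [swapVertex_eq, swapVertex_eq j y, map_add] at h1
    have h2 := swapVertex_swapVertex j 0
    rw [swapVertex_eq, swapVertex_eq j 0, map_add, map_zero, map_zero] at h2
    rw [zero_add, add_assoc] at *
    have h3 := add_right_cancel (h1.trans ((add_zero y).symm.trans (congrArg (y + ·) h2.symm)))
    exact h3
  have h2 : (swapLinear j).det * (swapLinear j).det = 1 := by
    have := congrArg ContinuousLinearMap.det h
    exact (LinearMap.det_comp (swapLinear j).toLinearMap (swapLinear j).toLinearMap).symm.trans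
      (this.trans LinearMap.det_id)
  rcases mul_self_eq_one_iff.1 h2 with h | h <;> rw [h] <;> simp

theorem integral_swapVertex {n : ℕ} (j : Fin n) (g : (Fin n → ℝ) → ℝ) :
    ∫ y in Simplex n, g (swapVertex j y) = ∫ y in Simplex n, g y := by
  have himage : swapVertex j '' Simplex n = Simplex n := by
    refine Set.Subset.antisymm ?_ fun y hy => ⟨_, swapVertex_mem j hy, swapVertex_swapVertex j y⟩
    rintro _ ⟨y, hy, rfl⟩
    exact swapVertex_mem j hy
  have h := integral_image_eq_integral_abs_det_fderiv_smul volume (isCompact_simplex n).measurableSet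
    (f := swapVertex j) (f' := fun _ => swapLinear j) (fun x _ => ?_)
    (Function.LeftInverse.injective (swapVertex_swapVertex j)).injOn g
  · rw [himage] at h
    rw [h]
    simp only [abs_det_swapLinear, one_smul]
  · have e : swapVertex j = fun y => swapLinear j y + Pi.single j 1 := funext (swapVertex_eq j)
    rw [e]
    exact ((swapLinear j).hasFDerivAt.add_const _).hasFDerivWithinAt

/-- The integral over the face opposite to the origin does not depend on its chart. -/
theorem integral_insertNth {n : ℕ} (F : (Fin (n + 1) → ℝ) → ℝ) (j : Fin (n + 1)) :
    ∫ y in Simplex n, F (j.insertNth (1 - ∑ i, y i) y) =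
      ∫ y in Simplex n, F (Fin.cons (1 - ∑ i, y i) y) := by
  induction j using Fin.induction with
  | zero => simp
  | succ j ih =>
    -- Moving the dependent coordinate by one position amounts to the volume preserving substitution
    -- `swapVertex j`.
    rw [← ih, ← integral_swapVertex j]
    refine setIntegral_congr_fun (isCompact_simplex n).measurableSet fun y _ => ?_
    refine congrArg F ?_
    rw [sum_swapVertex, sub_sub_cancel]
    ext i
    refine Fin.succAboveCases j.succ ?_ (fun k => ?_) i
    · rw [Fin.insertNth_apply_same, ← Fin.succAbove_castSucc_self, Fin.insertNth_apply_succAbove]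
    · rw [Fin.insertNth_apply_succAbove]
      by_cases h : k = j
      · subst h
        rw [Fin.succAbove_succ_self, Fin.insertNth_apply_same, swapVertex, Function.update_self]
      · have : j.succ.succAbove k = j.castSucc.succAbove k := by
          rcases lt_or_gt_of_ne h with h | h <;> rw [Fin.lt_def] at h
          · rw [Fin.succAbove_of_castSucc_lt _ _ (by rw [Fin.lt_def]; simp; omega),
              Fin.succAbove_of_castSucc_lt _ _ (by rw [Fin.lt_def]; simpa using h)]
          · rw [Fin.succAbove_of_le_castSucc _ _ (by rw [Fin.le_def]; simp; omega),
              Fin.succAbove_of_le_castSucc _ _ (by rw [Fin.le_def]; simp; omega)]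
        rw [this, Fin.insertNth_apply_succAbove, swapVertex, Function.update_of_ne h]

/-- The simplex is fibred over the simplex of one dimension less, with an interval in the direction
`j` as fibre; this prepares Fubini's theorem. -/
theorem insertNth_mem_simplex {n : ℕ} (j : Fin (n + 1)) (s : ℝ) (y : Fin n → ℝ) :
    (j.insertNth s y : Fin (n + 1) → ℝ) ∈ Simplex (n + 1) ↔
      y ∈ Simplex n ∧ s ∈ Set.Icc 0 (1 - ∑ i, y i) := by
  simp only [Simplex, Set.mem_ofPred_eq, Set.mem_Icc, Fin.sum_univ_succAbove _ j,
    Fin.forall_iff_succAbove j, Fin.insertNth_apply_same, Fin.insertNth_apply_succAbove]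
  constructor
  · rintro ⟨⟨h1, h2⟩, h3⟩
    exact ⟨⟨h2, by linarith⟩, h1, by linarith⟩
  · rintro ⟨⟨h1, h2⟩, h3, h4⟩
    exact ⟨⟨h3, h1⟩, by linarith⟩

/-- By Fubini the `j`-th coordinate is integrated first, over `[0, 1 - ∑ y]`, and the fundamental
theorem of calculus leaves the values at the two ends. -/
theorem integral_fderiv_simplex {n : ℕ} {F : (Fin (n + 1) → ℝ) → ℝ} (hF : ContDiff ℝ ∞ F)
    (j : Fin (n + 1)) : ∫ x in Simplex (n + 1), fderiv ℝ F x (Pi.single j 1) =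
      ∫ y in Simplex n, (F (j.insertNth (1 - ∑ i, y i) y) - F (j.insertNth 0 y)) := by
  set g : (Fin (n + 1) → ℝ) → ℝ := fun x => fderiv ℝ F x (Pi.single j 1) with hg
  have hgc : Continuous g :=
    ((hF.fderiv_right (m := ∞) (by simp)).clm_apply contDiff_const).continuous
  let e := MeasurableEquiv.piFinSuccAbove (fun _ : Fin (n + 1) => ℝ) j
  have he : MeasurePreserving e := volume_preserving_piFinSuccAbove (fun _ => ℝ) j
  have hint : Integrable ((Simplex (n + 1)).indicator g) :=
    (hgc.continuousOn.integrableOn_compact (isCompact_simplex _)).integrable_indicator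
      (isCompact_simplex _).measurableSet
  have hint2 : Integrable (fun p : ℝ × (Fin n → ℝ) => (Simplex (n + 1)).indicator g (e.symm p))
      (volume.prod volume) :=
    (he.symm.integrable_comp_emb e.symm.measurableEmbedding).2 hint
  rw [← integral_indicator (isCompact_simplex _).measurableSet,
    ← he.symm.integral_comp', Measure.volume_eq_prod, integral_prod_symm _ hint2,
    ← integral_indicator (isCompact_simplex _).measurableSet]
  refine integral_congr_ae (Filter.Eventually.of_forall fun y => ?_)
  have hes : ∀ s, e.symm (s, y) = j.insertNth s y := fun s => rfl
  simp only [hes]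
  by_cases hy : y ∈ Simplex n
  · have hle : 0 ≤ 1 - ∑ i, y i := by linarith [hy.2]
    rw [Set.indicator_of_mem hy]
    have h1 : ∀ s, (Simplex (n + 1)).indicator g (j.insertNth s y) =
        (Set.Icc 0 (1 - ∑ i, y i)).indicator (fun s => g (j.insertNth s y)) s := fun s => by
      by_cases hs : s ∈ Set.Icc 0 (1 - ∑ i, y i)
      · rw [Set.indicator_of_mem hs, Set.indicator_of_mem ((insertNth_mem_simplex j s y).2 ⟨hy, hs⟩)]
      · rw [Set.indicator_of_notMem hs,
          Set.indicator_of_notMem fun h => hs ((insertNth_mem_simplex j s y).1 h).2]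
    simp only [h1]
    rw [integral_indicator measurableSet_Icc, integral_Icc_eq_integral_Ioc,
      ← intervalIntegral.integral_of_le hle]
    have hd : ∀ s : ℝ, HasDerivAt (fun s : ℝ => (j.insertNth s y : Fin (n + 1) → ℝ))
        (Pi.single j 1) s := fun s => by
      refine hasDerivAt_pi.2 fun i => ?_
      refine Fin.succAboveCases j ?_ (fun k => ?_) i
      · simpa using hasDerivAt_id' s
      · simpa [Fin.succAbove_ne] using hasDerivAt_const s (y k)
    refine intervalIntegral.integral_eq_sub_of_hasDerivAt (f := fun s => F (j.insertNth s y))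
      (fun s _ => ?_) (Continuous.intervalIntegrable ?_ _ _)
    · exact (hF.differentiable (by simp) _).hasFDerivAt.comp_hasDerivAt s (hd s)
    · exact hgc.comp (continuous_iff_continuousAt.2 fun s => (hd s).continuousAt)
  · rw [Set.indicator_of_notMem hy]
    have h1 : ∀ s, (Simplex (n + 1)).indicator g (j.insertNth s y) = 0 := fun s =>
      Set.indicator_of_notMem (fun h => hy ((insertNth_mem_simplex j s y).1 h).1) _
    simp only [h1, integral_zero]

theorem integralFn_eq {n : ℕ} {f : SmoothFn n} {F : (Fin n → ℝ) → ℝ} (hf : ∀ x, f.1 x = F x) :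
    integralFn n f = ∫ x in Simplex n, F x := by
  refine setIntegral_congr_fun (isCompact_simplex n).measurableSet fun y hy => ?_
  exact (extendZero_coe f.1 ⟨y, hy⟩).trans (hf ⟨y, hy⟩)

/-- The `i`-th face of the simplex. -/
abbrev face {n : ℕ} (i : Fin (n + 2)) : Fin (n + 1) →o Fin (n + 2) := (SimplexCategory.δ i).toOrderHom

theorem simplexMap_face_zero {n : ℕ} (y : Fin n → ℝ) :
    simplexMap (face 0) y = Fin.cons (1 - ∑ i, y i) y := by
  ext j
  have : ∀ i : Fin (n + 1), face 0 i = j.succ ↔ i = j := fun i =>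
    ⟨fun h => Fin.succ_injective _ h, fun h => congrArg Fin.succ h⟩
  rw [simplexMap]
  simp only [this, Finset.filter_eq', Finset.mem_univ, if_true, Finset.sum_singleton]
  rfl

theorem simplexMap_face_succ {n : ℕ} (j : Fin (n + 1)) (y : Fin n → ℝ) :
    simplexMap (face j.succ) y = j.insertNth 0 y := by
  ext i
  rw [simplexMap]
  refine Fin.succAboveCases j ?_ (fun k => ?_) i
  · rw [Fin.insertNth_apply_same]
    refine Finset.sum_eq_zero fun i hi => ?_
    exact absurd (Finset.mem_filter.1 hi).2 (Fin.succAbove_ne j.succ i)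
  · have : ∀ i : Fin (n + 1), face j.succ i = (j.succAbove k).succ ↔ i = k.succ := fun i => by
      rw [← Fin.succ_succAbove_succ]
      exact Fin.succAbove_right_inj
    simp only [this, Finset.filter_eq', Finset.mem_univ, if_true, Finset.sum_singleton]
    rw [Fin.insertNth_apply_succAbove]
    rfl

/-- The upper ends of the fibres sweep out the face `t_0 = 0`, the lower ends the face opposite to
the vertex `j.succ`. The former appears in a chart depending on `j`, which `integral_insertNth`
exchanges for the standard one. -/
theorem integralFn_partialDeriv {n : ℕ} (j : Fin (n + 1)) (f : SmoothFn (n + 1)) :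
    integralFn (n + 1) (partialDeriv j f) =
      integralFn n (pullFn (face 0) f) - integralFn n (pullFn (face j.succ) f) := by
  obtain ⟨F, hF, hf⟩ := f.2
  rw [integralFn_eq (F := fun x => fderiv ℝ F x (Pi.single j 1)) (partialDeriv_apply j hF hf), integral_fderiv_simplex hF,
    integralFn_eq (f := pullFn (face 0) f) (F := fun y => F (Fin.cons (1 - ∑ i, y i) y))
      (fun y => (hf _).trans (congrArg F (simplexMap_face_zero y.1))),
    integralFn_eq (f := pullFn (face j.succ) f) (F := fun y => F (j.insertNth 0 y))
      (fun y => (hf _).trans (congrArg F (simplexMap_face_succ j y.1))),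
    integral_sub, integral_insertNth]
  · refine (hF.continuous.comp (f := fun y : Fin n → ℝ => (j.insertNth (1 - ∑ i, y i) y :
      Fin (n + 1) → ℝ)) ?_).continuousOn.integrableOn_compact (isCompact_simplex n)
    exact Continuous.finInsertNth j (by fun_prop) continuous_id
  · refine (hF.continuous.comp (f := fun y : Fin n → ℝ => (j.insertNth (0 : ℝ) y :
      Fin (n + 1) → ℝ)) ?_).continuousOn.integrableOn_compact (isCompact_simplex n)
    exact Continuous.finInsertNth j continuous_const continuous_id

/-! ### The coefficient of the volume form -/

theorem topCoeff_ιMulti (n : ℕ) (v : Fin n → Fin n → ℝ) :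
    topCoeff n (ExteriorAlgebra.ιMulti ℝ n v) = Matrix.det (Matrix.of v) := by
  rw [topCoeff, ExteriorAlgebra.liftAlternating_apply_ιMulti, Pi.single_eq_same]
  rfl

theorem topCoeff_of_mem {n p : ℕ} (h : p ≠ n) {l : Covectors n} (hl : l ∈ ⋀[ℝ]^p (Fin n → ℝ)) :
    topCoeff n l = 0 := by
  rw [← ExteriorAlgebra.ιMulti_span_fixedDegree] at hl
  induction hl using Submodule.span_induction with
  | zero => simp
  | add a b _ _ ha hb => rw [map_add, ha, hb, add_zero]
  | smul r a _ ha => rw [map_smul, ha, smul_zero]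
  | mem x hx =>
    obtain ⟨v, rfl⟩ := hx
    rw [topCoeff, ExteriorAlgebra.liftAlternating_apply_ιMulti, Pi.single_eq_of_ne h]
    rfl

theorem integralForm_fTmul {n : ℕ} (f : SmoothFn n) (l : Covectors n) :
    integralForm n (fTmul f l) = integralFn n f * topCoeff n l := rfl

theorem integralForm_of_mem {n p : ℕ} (h : p ≠ n) {x : Forms n} (hx : x ∈ formDeg n p) :
    integralForm n x = 0 := by
  refine formDeg_induction (P := fun x => integralForm n x = 0) ?_ ?_ ?_ hx
  · simp
  · intro x y hx hy
    rw [map_add, hx, hy, add_zero]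
  · intro f l hl
    rw [integralForm_fTmul, topCoeff_of_mem h hl, mul_zero]

/-- Laplace expansion along the first row, a standard basis vector. -/
theorem topCoeff_single_mul {n : ℕ} (j : Fin (n + 1)) (v : Fin n → Fin (n + 1) → ℝ) :
    topCoeff (n + 1) (ExteriorAlgebra.ι ℝ (Pi.single j (1 : ℝ)) * ExteriorAlgebra.ιMulti ℝ n v) =
      (-1) ^ (j : ℕ) * Matrix.det (Matrix.of fun i k => v i (j.succAbove k)) := by
  have h : ExteriorAlgebra.ι ℝ (Pi.single j (1 : ℝ)) * ExteriorAlgebra.ιMulti ℝ n v =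
      ExteriorAlgebra.ιMulti ℝ (n + 1) (Fin.cons (Pi.single j (1 : ℝ)) v) := by
    rw [ExteriorAlgebra.ιMulti_succ_apply]
    rfl
  set A : Matrix (Fin (n + 1)) (Fin (n + 1)) ℝ := Matrix.of (Fin.cons (Pi.single j (1 : ℝ)) v)
    with hA
  have h0 : ∀ k, A 0 k = (Pi.single j (1 : ℝ) : Fin (n + 1) → ℝ) k := fun _ => rfl
  rw [h, topCoeff_ιMulti, ← hA, Matrix.det_succ_row_zero, Finset.sum_eq_single j]
  · rw [h0, Pi.single_eq_same, mul_one]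
    rfl
  · intro k _ hk
    rw [h0, Pi.single_eq_of_ne hk, mul_zero, zero_mul]
  · simp

theorem pullCovector_apply {m n : ℕ} (φ : Fin (m + 1) →o Fin (n + 1)) (w : Fin n → ℝ)
    (k : Fin m) : pullCovector φ w k = ∑ l, w l * ∑ i with φ i = l.succ, dbary i k := by
  rw [pullCovector, Fintype.linearCombination_apply, Finset.sum_apply]
  simp

theorem pullCovector_face_succ {n : ℕ} (j : Fin (n + 1)) (w : Fin (n + 1) → ℝ) (k : Fin n) :
    pullCovector (face j.succ) w k = w (j.succAbove k) := by
  rw [pullCovector_apply, Fin.sum_univ_succAbove _ j]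
  have h0 : ∀ i : Fin (n + 1), ¬face j.succ i = j.succ := fun i => Fin.succAbove_ne j.succ i
  have h1 : ∀ (i : Fin (n + 1)) (l : Fin n), face j.succ i = (j.succAbove l).succ ↔ i = l.succ :=
    fun i l => by
      rw [← Fin.succ_succAbove_succ]
      exact Fin.succAbove_right_inj
  simp [h0, h1, Finset.filter_eq', dbary, Pi.single_apply]

theorem pullCovector_face_zero {n : ℕ} (w : Fin (n + 1) → ℝ) (k : Fin n) :
    pullCovector (face 0) w k = w k.succ - w 0 := by
  rw [pullCovector_apply]
  have h1 : ∀ i l : Fin (n + 1), face 0 i = l.succ ↔ i = l := fun i l =>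
    ⟨fun h => Fin.succ_injective _ h, fun h => congrArg Fin.succ h⟩
  simp only [h1, Finset.filter_eq', Finset.mem_univ, if_true, Finset.sum_singleton,
    Fin.sum_univ_succ]
  simp [dbary, Pi.single_apply]
  ring

theorem topCoeff_face_succ {n : ℕ} (j : Fin (n + 1)) (v : Fin n → Fin (n + 1) → ℝ) :
    topCoeff n (ExteriorAlgebra.map (pullCovector (face j.succ)) (ExteriorAlgebra.ιMulti ℝ n v)) =
      Matrix.det (Matrix.of fun i k => v i (j.succAbove k)) := by
  rw [ExteriorAlgebra.map_apply_ιMulti, topCoeff_ιMulti]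
  refine congrArg Matrix.det ?_
  ext i k
  exact pullCovector_face_succ j (v i) k

/-- Both sides are the determinant of `v` completed by a first row of ones: either expand along that
row, or first subtract column `0` from the others, which is the effect of `pullCovector (face 0)`.
-/
theorem topCoeff_face_zero {n : ℕ} (v : Fin n → Fin (n + 1) → ℝ) :
    topCoeff n (ExteriorAlgebra.map (pullCovector (face 0)) (ExteriorAlgebra.ιMulti ℝ n v)) =
      ∑ j : Fin (n + 1), (-1) ^ (j : ℕ) * Matrix.det (Matrix.of fun i k => v i (j.succAbove k)) := by
  rw [ExteriorAlgebra.map_apply_ιMulti, topCoeff_ιMulti]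
  set A : Matrix (Fin (n + 1)) (Fin (n + 1)) ℝ := Matrix.of (Fin.cons (fun _ => 1) v) with hA
  set B : Matrix (Fin (n + 1)) (Fin (n + 1)) ℝ := Matrix.of fun i => Fin.cons (A i 0)
    fun k : Fin n => A i k.succ - A i 0 with hB
  have h1 : A.det = ∑ j : Fin (n + 1), (-1) ^ (j : ℕ) *
      Matrix.det (Matrix.of fun i k => v i (j.succAbove k)) := by
    rw [Matrix.det_succ_row_zero]
    refine Finset.sum_congr rfl fun j _ => ?_
    rw [show A 0 j = 1 from rfl, mul_one]
    rfl
  have h2 : B.det = Matrix.det (Matrix.of (pullCovector (face 0) ∘ v)) := by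
    rw [Matrix.det_succ_row_zero, Fin.sum_univ_succ, Finset.sum_eq_zero, add_zero]
    · rw [Fin.val_zero, pow_zero, one_mul, show B 0 0 = 1 from rfl, one_mul]
      refine congrArg Matrix.det ?_
      ext i k
      exact (pullCovector_face_zero (v i) k).symm
    · intro j _
      have : B 0 j.succ = 0 := sub_self (1 : ℝ)
      rw [this]
      simp
  rw [← h1, ← h2]
  rw [← Matrix.det_transpose A, ← Matrix.det_transpose B]
  refine (Matrix.det_eq_of_forall_row_eq_smul_add_const (Fin.cons 0 fun _ => 1) 0 rfl
    fun k i => ?_).symm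
  refine Fin.cases ?_ (fun k => ?_) k
  · simp [hB]
  · simp [hB]

/-- Stokes' theorem on the simplex. -/
theorem integralForm_dForm {n : ℕ} (x : Forms (n + 1)) : integralForm (n + 1) (dForm (n + 1) x) =
    ∑ i : Fin (n + 2), (-1 : ℝ) ^ (i : ℕ) * integralForm n (pullForm (face i) x) := by
  induction x using fTmul_induction with
  | h0 => simp
  | hadd x y hx hy => simp only [map_add, hx, hy, mul_add, Finset.sum_add_distrib]
  | h f l =>
    -- By linearity `l` is a product of `p` covectors. If `p ≠ n`, both sides vanish for reasons of
    -- degree. If `p = n`, the `j`-th minor collects the integral over face `0` with sign `(-1)^j`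
    -- and that over face `j + 1` with the opposite sign.
    have hl : l ∈ Submodule.span ℝ
        (Set.range fun x : Σ p, (Fin p → Fin (n + 1) → ℝ) => ExteriorAlgebra.ιMulti ℝ x.1 x.2) := by
      rw [ExteriorAlgebra.ιMulti_span]; trivial
    rw [dForm_fTmul, map_sum]
    simp_rw [pullForm_fTmul, integralForm_fTmul]
    induction hl using Submodule.span_induction with
    | zero => simp
    | add a b _ _ ha hb => simp only [map_add, mul_add, Finset.sum_add_distrib, ha, hb]
    | smul r a _ ha =>
      simp only [map_smul, mul_smul_comm, ← Finset.smul_sum, ha]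
    | mem x hx =>
      obtain ⟨⟨p, v⟩, rfl⟩ := hx
      simp only
      have hm : ExteriorAlgebra.ιMulti ℝ p v ∈ ⋀[ℝ]^p (Fin (n + 1) → ℝ) :=
        ExteriorAlgebra.ιMulti_range ℝ p ⟨v, rfl⟩
      by_cases hp : p = n
      · subst hp
        rw [Fin.sum_univ_succ (n := p + 1)]
        simp_rw [topCoeff_single_mul, topCoeff_face_succ, topCoeff_face_zero,
          integralFn_partialDeriv]
        rw [Fin.val_zero, pow_zero, one_mul, Finset.mul_sum, ← Finset.sum_add_distrib]
        refine Finset.sum_congr rfl fun j _ => ?_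
        rw [Fin.val_succ, pow_succ]
        ring
      · rw [Finset.sum_eq_zero, Finset.sum_eq_zero]
        · intro i _
          rw [topCoeff_of_mem hp (map_mem_exteriorPower _ hm), mul_zero, mul_zero]
        · intro i _
          have : ExteriorAlgebra.ι ℝ (Pi.single i (1 : ℝ)) * ExteriorAlgebra.ιMulti ℝ p v ∈
              ⋀[ℝ]^(p + 1) (Fin (n + 1) → ℝ) := by
            change _ ∈ LinearMap.range (ExteriorAlgebra.ι ℝ) ^ (p + 1)
            rw [pow_succ']
            exact Submodule.mul_mem_mul ⟨_, rfl⟩ hm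
          rw [topCoeff_of_mem (by omega) this, mul_zero]

theorem integralForm_dForm_zero (x : Forms 0) : integralForm 0 (dForm 0 x) = 0 := by
  simp [dForm]

theorem integralForm_parity {n : ℕ} (x : Forms n) :
    integralForm n (parity (formDeg n) x) = (-1) ^ n * integralForm n x := by
  refine DirectSum.Decomposition.inductionOn (formDeg n) (by simp) (fun {p} x => ?_)
    (fun x y hx hy => by simp only [map_add, hx, hy, mul_add]) x
  rw [parity_of_mem _ x.2, map_smul, smul_eq_mul]
  by_cases h : p = n
  · subst h; rfl
  · rw [integralForm_of_mem h x.2]; simp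

end ChernWeil
end

/-! ### The Poincaré lemma on the simplex with an explicit homotopy. -/

noncomputable section

namespace ChernWeil

open MeasureTheory

/-! ### Radial averages -/

section Radial

variable {n : ℕ} {V : Type*} [NormedAddCommGroup V] [NormedSpace ℝ V]

/-- The radial average `∫_0^1 t^k F(t x) dt`. -/
def radialAverage (k : ℕ) (F : (Fin n → ℝ) → V) (x : Fin n → ℝ) : V :=
  ∫ t in (0 : ℝ)..1, t ^ k • F (t • x)

theorem continuous_radialAverage (k : ℕ) {F : (Fin n → ℝ) → V} (hF : Continuous F) :
    Continuous (radialAverage k F) := by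
  refine intervalIntegral.continuous_parametric_intervalIntegral_of_continuous' ?_ 0 1
  fun_prop

/-- Differentiation under the integral sign; the derivative of `y ↦ t y` raises the weight from `k`
to `k + 1`. The dominating constant comes from the compactness of a closed ball times `[0, 1]`. -/
theorem hasFDerivAt_radialAverage (k : ℕ) {F : (Fin n → ℝ) → V} (hF : ContDiff ℝ 1 F)
    (x : Fin n → ℝ) : HasFDerivAt (radialAverage k F) (radialAverage (k + 1) (fderiv ℝ F) x) x := by
  have hF' : Continuous (fderiv ℝ F) := hF.continuous_fderiv (by simp)
  have hc : Continuous fun p : (Fin n → ℝ) × ℝ => p.2 ^ (k + 1) • fderiv ℝ F (p.2 • p.1) := by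
    fun_prop
  obtain ⟨C, hC⟩ := ((isCompact_closedBall x 1).prod (isCompact_Icc (a := (0 : ℝ)) (b := 1)))
    |>.exists_bound_of_continuousOn hc.continuousOn
  refine intervalIntegral.hasFDerivAt_integral_of_dominated_of_fderiv_le (𝕜 := ℝ)
    (F := fun x t => t ^ k • F (t • x)) (F' := fun x t => t ^ (k + 1) • fderiv ℝ F (t • x))
    (bound := fun _ => C) (Metric.ball_mem_nhds x one_pos) ?_ ?_ ?_ ?_ ?_ ?_
  · refine Filter.Eventually.of_forall fun y => Continuous.aestronglyMeasurable ?_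
    have := hF.continuous
    fun_prop
  · refine Continuous.intervalIntegrable ?_ _ _
    have := hF.continuous
    fun_prop
  · have : SecondCountableTopologyEither ℝ ((Fin n → ℝ) →L[ℝ] V) :=
      secondCountableTopologyEither_of_left _ _
    refine Continuous.aestronglyMeasurable ?_
    fun_prop
  · refine Filter.Eventually.of_forall fun t ht y hy => ?_
    rw [Set.uIoc_of_le zero_le_one] at ht
    exact hC (y, t) ⟨Metric.ball_subset_closedBall hy, ht.1.le, ht.2⟩
  · exact intervalIntegrable_const
  · refine Filter.Eventually.of_forall fun t _ y _ => ?_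
    have h1 : HasFDerivAt (fun y : Fin n → ℝ => t • y) (t • ContinuousLinearMap.id ℝ (Fin n → ℝ)) y :=
      (hasFDerivAt_id y).const_smul t
    have h2 := (((hF.differentiable (by simp)) (t • y)).hasFDerivAt.comp y h1).const_smul (t ^ k)
    refine h2.congr_fderiv ?_
    ext1 v
    simp [pow_succ, mul_smul]

/-- The derivative of an average is the average of the derivative, with weight `k + 1` and values in
a space of linear maps, so the induction has to vary both `k` and `V`. -/
theorem contDiff_radialAverage (m k : ℕ) {V : Type} [NormedAddCommGroup V] [NormedSpace ℝ V]
    {F : (Fin n → ℝ) → V} (hF : ContDiff ℝ m F) : ContDiff ℝ m (radialAverage k F) := by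
  induction m generalizing k V with
  | zero => exact contDiff_zero.2 (continuous_radialAverage k (contDiff_zero.1 hF))
  | succ m ih =>
    have h1 : ContDiff ℝ 1 F := hF.of_le (by norm_cast; omega)
    rw [Nat.cast_add, Nat.cast_one, contDiff_succ_iff_fderiv] at hF ⊢
    refine ⟨fun x => (hasFDerivAt_radialAverage k h1 x).differentiableAt, by simp, ?_⟩
    rw [show fderiv ℝ (radialAverage k F) = radialAverage (k + 1) (fderiv ℝ F) from
      funext fun x => (hasFDerivAt_radialAverage k h1 x).fderiv]
    exact ih _ hF.2.2

theorem contDiff_infty_radialAverage (k : ℕ) {F : (Fin n → ℝ) → ℝ} (hF : ContDiff ℝ ∞ F) :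
    ContDiff ℝ ∞ (radialAverage k F) :=
  contDiff_infty.2 fun m => contDiff_radialAverage m k (contDiff_infty.1 hF m)

/-- Integrate the derivative of `t^k F(t x)` over `[0, 1]`. The truncated `k - 1` at `k = 0` has
coefficient `0`, and `0 ^ k` keeps the value at the origin only for `k = 0`. -/
theorem sum_mul_radialAverage {F : (Fin n → ℝ) → ℝ} (hF : ContDiff ℝ ∞ F) (k : ℕ)
    (x : Fin n → ℝ) :
    ∑ i, x i * radialAverage k (fun y => fderiv ℝ F y (Pi.single i 1)) x +
      k * radialAverage (k - 1) F x = F x - (0 : ℝ) ^ k * F 0 := by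
  have hF' : Continuous (fderiv ℝ F) := hF.continuous_fderiv (by simp)
  have hc := hF.continuous
  have hd : ∀ t : ℝ, HasDerivAt (fun t : ℝ => t ^ k * F (t • x))
      (k * t ^ (k - 1) * F (t • x) + t ^ k * fderiv ℝ F (t • x) x) t := fun t => by
    have h1 : HasDerivAt (fun t : ℝ => t • x) x t := by
      simpa using (hasDerivAt_id' t).smul_const x
    exact (hasDerivAt_pow k t).mul
      ((hF.differentiable (by simp) _).hasFDerivAt.comp_hasDerivAt t h1)
  have h := intervalIntegral.integral_eq_sub_of_hasDerivAt (a := 0) (b := 1) (fun t _ => hd t)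
    (Continuous.intervalIntegrable (by fun_prop) _ _)
  simp only [one_pow, one_mul, one_smul, zero_smul] at h
  rw [← h, intervalIntegral.integral_add (Continuous.intervalIntegrable (by fun_prop) _ _)
    (Continuous.intervalIntegrable (by fun_prop) _ _), add_comm]
  congr 1
  · rw [radialAverage, ← intervalIntegral.integral_const_mul]
    simp only [smul_eq_mul, mul_assoc]
  · simp only [radialAverage, ← intervalIntegral.integral_const_mul]
    rw [← intervalIntegral.integral_finsetSum]
    · refine intervalIntegral.integral_congr fun t _ => ?_
      simp only [smul_eq_mul]
      conv_rhs => rw [covector_eq_sum x, map_sum, Finset.mul_sum]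
      refine Finset.sum_congr rfl fun i _ => ?_
      rw [← covector_eq_sum, map_smul, smul_eq_mul]
      ring
    · intro i _
      exact Continuous.intervalIntegrable (by fun_prop) _ _

end Radial

theorem smul_mem_simplex {n : ℕ} {t : ℝ} (h0 : 0 ≤ t) (h1 : t ≤ 1) {x : Fin n → ℝ}
    (hx : x ∈ Simplex n) : t • x ∈ Simplex n := by
  refine ⟨fun i => mul_nonneg h0 (hx.1 i), ?_⟩
  simp only [Pi.smul_apply, smul_eq_mul, ← Finset.mul_sum]
  nlinarith [Finset.sum_nonneg fun (i : Fin n) (_ : i ∈ Finset.univ) => hx.1 i, hx.2]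

/-- The simplex is star-shaped about `0`, so averages at its points use only values on the simplex
and do not depend on the extension. -/
theorem radialAverage_extendZero {n : ℕ} (k : ℕ) {f : Simplex n → ℝ} {F : (Fin n → ℝ) → ℝ}
    (hf : ∀ x, f x = F x) (x : Simplex n) :
    radialAverage k (extendZero f) x = radialAverage k F x := by
  refine intervalIntegral.integral_congr fun t ht => ?_
  rw [Set.uIcc_of_le zero_le_one] at ht
  have := extendZero_coe f ⟨t • x.1, smul_mem_simplex ht.1 ht.2 x.2⟩
  simp only at this
  simp only [this, hf]

/-- The operator `f ↦ ∫_0^1 t^k f(t x) dt` on smooth functions on the simplex. -/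
def radial (n k : ℕ) : SmoothFn n →ₗ[ℝ] SmoothFn n where
  toFun f := ⟨fun x => radialAverage k (extendZero f.1) x, by
    obtain ⟨F, hF, hf⟩ := f.2
    exact ⟨radialAverage k F, contDiff_infty_radialAverage k hF, radialAverage_extendZero k hf⟩⟩
  map_add' f g := by
    obtain ⟨F, hF, hf⟩ := f.2
    obtain ⟨K, hK, hg⟩ := g.2
    ext x
    have hFK : ∀ x, (f + g).1 x = (F + K) x := fun x => by simp [hf, hg]
    change radialAverage k (extendZero (f + g).1) x = radialAverage k (extendZero f.1) x +
      radialAverage k (extendZero g.1) x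
    rw [radialAverage_extendZero k hFK, radialAverage_extendZero k hf,
      radialAverage_extendZero k hg, radialAverage, radialAverage, radialAverage,
      ← intervalIntegral.integral_add]
    · simp [mul_add]
    · have := hF.continuous
      exact Continuous.intervalIntegrable (by fun_prop) _ _
    · have := hK.continuous
      exact Continuous.intervalIntegrable (by fun_prop) _ _
  map_smul' r f := by
    obtain ⟨F, hF, hf⟩ := f.2
    ext x
    have hrF : ∀ x, (r • f).1 x = (r • F) x := fun x => by simp [hf]
    change radialAverage k (extendZero (r • f).1) x = r * radialAverage k (extendZero f.1) x
    rw [radialAverage_extendZero k hrF, radialAverage_extendZero k hf, radialAverage, radialAverage,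
      ← intervalIntegral.integral_const_mul]
    refine intervalIntegral.integral_congr fun t _ => ?_
    simp only [Pi.smul_apply, smul_eq_mul]
    ring

theorem radial_apply {n k : ℕ} {f : SmoothFn n} {F : (Fin n → ℝ) → ℝ} (hf : ∀ x, f.1 x = F x)
    (x : Simplex n) : (radial n k f).1 x = radialAverage k F x :=
  radialAverage_extendZero k hf x

theorem partialDeriv_radial {n k : ℕ} (i : Fin n) (f : SmoothFn n) :
    partialDeriv i (radial n k f) = radial n (k + 1) (partialDeriv i f) := by
  obtain ⟨F, hF, hf⟩ := f.2
  have hF' : Continuous (fderiv ℝ F) := hF.continuous_fderiv (by simp)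
  ext x
  refine (partialDeriv_apply i (contDiff_infty_radialAverage k hF) (radial_apply hf) x).trans ?_
  rw [(hasFDerivAt_radialAverage k (hF.of_le (by simp)) x.1).fderiv]
  refine Eq.trans ?_ (radial_apply (F := fun y => fderiv ℝ F y (Pi.single i 1))
    (partialDeriv_apply i hF hf) x).symm
  rw [radialAverage, ContinuousLinearMap.intervalIntegral_apply]
  · rfl
  · exact Continuous.intervalIntegrable (by fun_prop) _ _

/-- The vertex `0` of the simplex. -/
def vertexZero (n : ℕ) : Simplex n := ⟨0, fun _ => le_rfl, by simp⟩

theorem sum_coord_mul_radial {n : ℕ} (k : ℕ) (f : SmoothFn n) :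
    ∑ i : Fin n, coord i.succ * radial n k (partialDeriv i f) + (k : ℝ) • radial n (k - 1) f =
      f - ((0 : ℝ) ^ k * f.1 (vertexZero n)) • 1 := by
  obtain ⟨F, hF, hf⟩ := f.2
  ext x
  have h := sum_mul_radialAverage hF k x.1
  have e : ∀ i, (radial n k (partialDeriv i f)).1 x =
      radialAverage k (fun y => fderiv ℝ F y (Pi.single i 1)) x.1 :=
    fun i => radial_apply (partialDeriv_apply i hF hf) x
  have e1 : (∑ i : Fin n, coord i.succ * radial n k (partialDeriv i f)).1 x =
      ∑ i : Fin n, x.1 i * (radial n k (partialDeriv i f)).1 x := by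
    rw [AddSubmonoidClass.coe_finsetSum, Finset.sum_apply]
    rfl
  change (∑ i : Fin n, coord i.succ * radial n k (partialDeriv i f)).1 x +
    k * (radial n (k - 1) f).1 x = f.1 x - ((0 : ℝ) ^ k * f.1 (vertexZero n)) * 1
  rw [e1, radial_apply hf, hf, hf (vertexZero n), mul_one]
  simp_rw [e]
  exact h

/-! ### Contractions of the exterior algebra -/

/-- The contraction with the `i`-th coordinate vector field. -/
def coContr {n : ℕ} (i : Fin n) : Covectors n →ₗ[ℝ] Covectors n :=
  CliffordAlgebra.contractLeft (Q := (0 : QuadraticForm ℝ (Fin n → ℝ)))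
    (LinearMap.proj (R := ℝ) (φ := fun _ : Fin n => ℝ) i)

theorem coContr_ι_mul {n : ℕ} (i : Fin n) (v : Fin n → ℝ) (l : Covectors n) :
    coContr i (ExteriorAlgebra.ι ℝ v * l) = v i • l - ExteriorAlgebra.ι ℝ v * coContr i l :=
  CliffordAlgebra.contractLeft_ι_mul _ v l

theorem coContr_of_mem_zero {n : ℕ} (i : Fin n) {l : Covectors n} (hl : l ∈ ⋀[ℝ]^0 (Fin n → ℝ)) :
    coContr i l = 0 := by
  change l ∈ LinearMap.range (ExteriorAlgebra.ι ℝ) ^ 0 at hl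
  rw [pow_zero] at hl
  obtain ⟨r, rfl⟩ := Submodule.mem_one.1 hl
  exact CliffordAlgebra.contractLeft_algebraMap (0 : QuadraticForm ℝ (Fin n → ℝ)) _ r

theorem ι_mul_mem {n p : ℕ} (v : Fin n → ℝ) {l : Covectors n} (hl : l ∈ ⋀[ℝ]^p (Fin n → ℝ)) :
    ExteriorAlgebra.ι ℝ v * l ∈ ⋀[ℝ]^(p + 1) (Fin n → ℝ) := by
  change _ ∈ LinearMap.range (ExteriorAlgebra.ι ℝ) ^ (p + 1)
  rw [pow_succ']
  exact Submodule.mul_mem_mul ⟨_, rfl⟩ hl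

@[elab_as_elim]
theorem exteriorPower_induction {n : ℕ} {P : ℕ → Covectors n → Prop}
    (hadd : ∀ p x y, P p x → P p y → P p (x + y)) (halg : ∀ r, P 0 (algebraMap ℝ _ r))
    (hmul : ∀ p v, ∀ l ∈ ⋀[ℝ]^p (Fin n → ℝ), P p l → P (p + 1) (ExteriorAlgebra.ι ℝ v * l))
    {p : ℕ} {l : Covectors n} (hl : l ∈ ⋀[ℝ]^p (Fin n → ℝ)) : P p l := by
  induction hl using Submodule.pow_induction_on_left' with
  | algebraMap r => exact halg r
  | add x y i hx hy ihx ihy => exact hadd _ _ _ ihx ihy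
  | mem_mul x hx i y hy ih =>
    obtain ⟨v, rfl⟩ := hx
    exact hmul i v y hy ih

theorem coContr_mem {n p : ℕ} (i : Fin n) {l : Covectors n} (hl : l ∈ ⋀[ℝ]^(p + 1) (Fin n → ℝ)) :
    coContr i l ∈ ⋀[ℝ]^p (Fin n → ℝ) := by
  suffices ∀ q, ∀ l ∈ ⋀[ℝ]^q (Fin n → ℝ), ∀ p, q = p + 1 → coContr i l ∈ ⋀[ℝ]^p (Fin n → ℝ) from
    this _ l hl p rfl
  intro q l hl
  refine exteriorPower_induction (P := fun q l => ∀ p, q = p + 1 →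
    coContr i l ∈ ⋀[ℝ]^p (Fin n → ℝ)) ?_ ?_ ?_ hl
  · intro q x y hx hy p hp
    rw [map_add]
    exact add_mem (hx p hp) (hy p hp)
  · intro r p hp
    omega
  · intro q v l hl ih p hp
    obtain rfl : q = p := by omega
    rw [coContr_ι_mul]
    refine sub_mem (Submodule.smul_mem _ _ hl) ?_
    cases q with
    | zero => rw [coContr_of_mem_zero i hl, mul_zero]; exact zero_mem _
    | succ q => exact ι_mul_mem v (ih q rfl)

/-- The left side is the operator counting covector factors: by `coContr_ι_mul`, each further factor
adds one copy of the element. -/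
theorem sum_ι_mul_coContr {n p : ℕ} {l : Covectors n} (hl : l ∈ ⋀[ℝ]^p (Fin n → ℝ)) :
    ∑ i, ExteriorAlgebra.ι ℝ (Pi.single i (1 : ℝ) : Fin n → ℝ) * coContr i l = (p : ℝ) • l := by
  let P : ℕ → Covectors n → Prop := fun p l =>
    ∑ i, ExteriorAlgebra.ι ℝ (Pi.single i (1 : ℝ) : Fin n → ℝ) * coContr i l = (p : ℝ) • l
  refine exteriorPower_induction (P := P) ?_ ?_ ?_ hl <;> simp only [P]
  · intro p x y hx hy
    simp only [map_add, mul_add, Finset.sum_add_distrib, hx, hy, smul_add]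
  · intro r
    have h : algebraMap ℝ (Covectors n) r ∈ ⋀[ℝ]^0 (Fin n → ℝ) := by
      change _ ∈ LinearMap.range (ExteriorAlgebra.ι ℝ) ^ 0
      rw [pow_zero]
      exact Submodule.mem_one.2 ⟨r, rfl⟩
    simp [coContr_of_mem_zero _ h]
  · intro p v l hl ih
    have hswap : ∀ i, ExteriorAlgebra.ι ℝ (Pi.single i (1 : ℝ) : Fin n → ℝ) *
        (ExteriorAlgebra.ι ℝ v * coContr i l) =
        -(ExteriorAlgebra.ι ℝ v * (ExteriorAlgebra.ι ℝ (Pi.single i (1 : ℝ)) * coContr i l)) :=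
      fun i => by
        rw [← mul_assoc, eq_neg_of_add_eq_zero_left (ExteriorAlgebra.ι_add_mul_swap (R := ℝ)
          (Pi.single i (1 : ℝ) : Fin n → ℝ) v), neg_mul, mul_assoc]
    have hterm : ∀ i, ExteriorAlgebra.ι ℝ (Pi.single i (1 : ℝ) : Fin n → ℝ) *
        coContr i (ExteriorAlgebra.ι ℝ v * l) =
        (v i • ExteriorAlgebra.ι ℝ (Pi.single i (1 : ℝ) : Fin n → ℝ)) * l +
          ExteriorAlgebra.ι ℝ v * (ExteriorAlgebra.ι ℝ (Pi.single i (1 : ℝ)) * coContr i l) :=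
      fun i => by
        rw [coContr_ι_mul, mul_sub, hswap, sub_neg_eq_add, mul_smul_comm, smul_mul_assoc]
    have hv : ∑ i, v i • ExteriorAlgebra.ι ℝ (Pi.single i (1 : ℝ) : Fin n → ℝ) =
        ExteriorAlgebra.ι ℝ v := by
      conv_rhs => rw [covector_eq_sum v, map_sum]
      exact Finset.sum_congr rfl fun i _ => (map_smul _ _ _).symm
    rw [Finset.sum_congr rfl fun i _ => hterm i, Finset.sum_add_distrib, ← Finset.sum_mul, hv,
      ← Finset.mul_sum, ih, mul_smul_comm, Nat.cast_add, Nat.cast_one, add_smul, one_smul, add_comm]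

/-! ### The Poincaré homotopy -/

/-- The homotopy operator on forms of degree `k`. -/
def poincareDeg (n k : ℕ) : Forms n →ₗ[ℝ] Forms n :=
  (formEquiv n).toLinearMap ∘ₗ
    (∑ i : Fin n, TensorProduct.map (LinearMap.mulLeft ℝ (coord i.succ) ∘ₗ radial n (k - 1))
      (coContr i)) ∘ₗ (formEquiv n).symm.toLinearMap

theorem poincareDeg_fTmul {n k : ℕ} (f : SmoothFn n) (l : Covectors n) :
    poincareDeg n k (fTmul f l) =
      ∑ i : Fin n, fTmul (coord i.succ * radial n (k - 1) f) (coContr i l) := by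
  rw [poincareDeg, LinearMap.comp_apply, LinearMap.comp_apply, LinearMap.sum_apply, map_sum]
  rfl

/-- The homotopy operator of the Poincaré lemma, for the contraction to the vertex `0`. -/
def poincare (n : ℕ) : Forms n →ₗ[ℝ] Forms n :=
  (DirectSum.toModule ℝ ℕ (Forms n) fun k => poincareDeg n k ∘ₗ (formDeg n k).subtype) ∘ₗ
    (DirectSum.decomposeLinearEquiv (formDeg n)).toLinearMap

theorem poincare_of_mem {n k : ℕ} {x : Forms n} (hx : x ∈ formDeg n k) :
    poincare n x = poincareDeg n k x := by
  lift x to formDeg n k using hx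
  simp only [poincare, LinearMap.comp_apply, LinearEquiv.coe_coe,
    DirectSum.decomposeLinearEquiv_apply, DirectSum.decompose_coe]
  rw [← DirectSum.lof_eq_of ℝ, DirectSum.toModule_lof]
  rfl

/-- At `k = 0` the truncated weight `k - 1` does no harm, since the contractions vanish on degree
`0`. -/
theorem poincare_fTmul {n k : ℕ} (f : SmoothFn n) {l : Covectors n}
    (hl : l ∈ ⋀[ℝ]^k (Fin n → ℝ)) : poincare n (fTmul f l) =
      ∑ i : Fin n, fTmul (coord i.succ * radial n (k - 1) f) (coContr i l) := by
  rw [poincare_of_mem (fTmul_mem f hl), poincareDeg_fTmul]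

theorem poincare_of_mem_zero {n : ℕ} {x : Forms n} (hx : x ∈ formDeg n 0) : poincare n x = 0 := by
  refine formDeg_induction (P := fun x => poincare n x = 0) ?_ ?_ ?_ hx
  · simp
  · intro x y hx hy
    rw [map_add, hx, hy, add_zero]
  · intro f l hl
    rw [poincare_fTmul f hl]
    refine Finset.sum_eq_zero fun i _ => ?_
    rw [coContr_of_mem_zero i hl]
    exact map_zero (fTmulRight _)

theorem poincare_mem {n k : ℕ} {x : Forms n} (hx : x ∈ formDeg n (k + 1)) :
    poincare n x ∈ formDeg n k := by
  refine formDeg_induction (P := fun x => poincare n x ∈ formDeg n k) ?_ ?_ ?_ hx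
  · simp
  · intro x y hx hy
    rw [map_add]
    exact add_mem hx hy
  · intro f l hl
    rw [poincare_fTmul f hl]
    exact Submodule.sum_mem _ fun i _ => fTmul_mem _ (coContr_mem i hl)

theorem parity_poincare {n : ℕ} (x : Forms n) :
    parity (formDeg n) (poincare n x) = -poincare n (parity (formDeg n) x) := by
  refine graded_induction (formDeg n) ?_ ?_ ?_ x
  · simp
  · intro x y hx hy
    simp only [map_add, hx, hy, neg_add]
  · intro p x hx
    cases p with
    | zero => rw [parity_of_mem _ hx, map_smul, poincare_of_mem_zero hx]; simp
    | succ p =>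
      rw [parity_of_mem _ hx, parity_of_mem _ (poincare_mem hx), map_smul, pow_succ, mul_neg_one,
        neg_smul, neg_neg]

/-- The value at the vertex `0` of the component of degree `0`. -/
def augment (n : ℕ) : Forms n →ₗ[ℝ] ℝ :=
  (TensorProduct.lid ℝ ℝ).toLinearMap ∘ₗ TensorProduct.map
    (LinearMap.proj (R := ℝ) (φ := fun _ : Simplex n => ℝ) (vertexZero n) ∘ₗ
      (Subalgebra.toSubmodule (SmoothFn n)).subtype)
    (ExteriorAlgebra.algebraMapInv : Covectors n →ₐ[ℝ] ℝ).toLinearMap ∘ₗ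
      (formEquiv n).symm.toLinearMap

theorem augment_fTmul {n : ℕ} (f : SmoothFn n) (l : Covectors n) :
    augment n (fTmul f l) = f.1 (vertexZero n) * ExteriorAlgebra.algebraMapInv l := rfl

theorem algebraMapInv_of_mem {n p : ℕ} {l : Covectors n} (hl : l ∈ ⋀[ℝ]^(p + 1) (Fin n → ℝ)) :
    ExteriorAlgebra.algebraMapInv l = 0 := by
  suffices ∀ q, ∀ l ∈ ⋀[ℝ]^q (Fin n → ℝ), ∀ p, q = p + 1 → ExteriorAlgebra.algebraMapInv l = 0 from
    this _ l hl p rfl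
  intro q l hl
  refine exteriorPower_induction (P := fun q l => ∀ p, q = p + 1 →
    ExteriorAlgebra.algebraMapInv l = 0) ?_ ?_ ?_ hl
  · intro q x y hx hy p hp
    rw [map_add, hx p hp, hy p hp, add_zero]
  · intro r p hp
    omega
  · intro q v l hl ih p hp
    rw [map_mul]
    simp [ExteriorAlgebra.algebraMapInv]

theorem augment_of_mem {n p : ℕ} {x : Forms n} (hx : x ∈ formDeg n (p + 1)) : augment n x = 0 := by
  refine formDeg_induction (P := fun x => augment n x = 0) ?_ ?_ ?_ hx
  · simp
  · intro x y hx hy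
    rw [map_add, hx, hy, add_zero]
  · intro f l hl
    rw [augment_fTmul, algebraMapInv_of_mem hl, mul_zero]

theorem augment_parity {n : ℕ} (x : Forms n) : augment n (parity (formDeg n) x) = augment n x := by
  refine graded_induction (formDeg n) ?_ ?_ ?_ x
  · simp
  · intro x y hx hy
    simp only [map_add, hx, hy]
  · intro p x hx
    cases p with
    | zero => rw [parity_of_mem _ hx]; simp
    | succ p => rw [parity_of_mem _ hx, map_smul, augment_of_mem hx, smul_zero]

theorem augment_dForm {n : ℕ} (x : Forms n) : augment n (dForm n x) = 0 := by
  refine graded_induction (formDeg n) ?_ ?_ ?_ x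
  · simp
  · intro x y hx hy
    simp only [map_add, hx, hy, add_zero]
  · intro p x hx
    exact augment_of_mem (Mixed.dForm_mem hx)

/-- The Poincaré lemma. -/
theorem dForm_poincare {n : ℕ} (x : Forms n) :
    dForm n (poincare n x) + poincare n (dForm n x) = x - augment n x • 1 := by
  refine graded_induction (formDeg n) ?_ ?_ ?_ x
  · simp
  · intro x y hx hy
    simp only [map_add, add_smul]
    rw [add_add_add_comm, hx, hy]
    abel
  · intro p x hx
    refine formDeg_induction (P := fun x => dForm n (poincare n x) + poincare n (dForm n x) =
      x - augment n x • 1) ?_ ?_ ?_ hx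
    · simp
    · intro x y hx hy
      simp only [map_add, add_smul]
      rw [add_add_add_comm, hx, hy]
      abel
    · intro f l hl
      -- In `d h` the derivative hits either the factor `t_i`, which yields the counting operator,
      -- or the average. The second kind forms a double sum that occurs in `h d` with the opposite
      -- sign.
      have h1 : dForm n (poincare n (fTmul f l)) = fTmul ((p : ℝ) • radial n (p - 1) f) l +
          ∑ i : Fin n, ∑ j : Fin n, fTmul (coord i.succ * radial n p (partialDeriv j f))
            (ExteriorAlgebra.ι ℝ (Pi.single j (1 : ℝ)) * coContr i l) := by
        rw [poincare_fTmul f hl, map_sum]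
        simp_rw [dForm_fTmul, partialDeriv_mul, partialDeriv_coord, partialDeriv_radial,
          fTmul_add_left, Finset.sum_add_distrib]
        congr 1
        · rw [fTmul_smul_left, ← fTmul_smul_right, ← sum_ι_mul_coContr hl, fTmul_sum_right]
          refine Finset.sum_congr rfl fun i _ => ?_
          rw [Finset.sum_eq_single i]
          · simp [dbary]
          · intro j _ hj
            simp only [dbary, Fin.cons_succ, Pi.single_eq_of_ne hj, zero_smul, zero_mul]
            exact map_zero (fTmulLeft _)
          · simp
        · refine Finset.sum_congr rfl fun i _ => Finset.sum_congr rfl fun j _ => ?_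
          -- The weight obtained is `p - 1 + 1`, which differs from `p` only at `p = 0`, where the
          -- contraction vanishes.
          cases p with
          | zero =>
            rw [coContr_of_mem_zero i hl, mul_zero]
            exact (map_zero (fTmulRight _)).trans (map_zero (fTmulRight _)).symm
          | succ p => rfl
      have h2 : poincare n (dForm n (fTmul f l)) =
          ∑ i : Fin n, fTmul (coord i.succ * radial n p (partialDeriv i f)) l -
          ∑ i : Fin n, ∑ j : Fin n, fTmul (coord i.succ * radial n p (partialDeriv j f))
            (ExteriorAlgebra.ι ℝ (Pi.single j (1 : ℝ)) * coContr i l) := by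
        rw [dForm_fTmul, map_sum]
        simp_rw [poincare_fTmul _ (ι_mul_mem _ hl), coContr_ι_mul]
        rw [Finset.sum_comm, ← Finset.sum_sub_distrib]
        refine Finset.sum_congr rfl fun i _ => ?_
        have hs : ∀ (g : SmoothFn n) (a b : Covectors n), fTmul g (a - b) = fTmul g a - fTmul g b :=
          fun g a b => map_sub (fTmulRight g) a b
        simp_rw [hs, Finset.sum_sub_distrib]
        congr 1
        rw [Finset.sum_eq_single i]
        · simp
        · intro j _ hj
          rw [Pi.single_eq_of_ne hj.symm, zero_smul]
          exact map_zero (fTmulRight _)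
        · simp
      -- Once the double sums have cancelled, the coefficient of `l` is the left side of
      -- `sum_coord_mul_radial` with weight `p`.
      rw [h1, h2, add_add_sub_cancel, ← fTmul_sum_left, ← fTmul_add_left, add_comm,
        sum_coord_mul_radial]
      have hs : ∀ (a b : SmoothFn n), fTmul (a - b) l = fTmul a l - fTmul b l :=
        fun a b => map_sub (fTmulLeft l) a b
      rw [hs, augment_fTmul]
      congr 1
      cases p with
      | zero =>
        change l ∈ LinearMap.range (ExteriorAlgebra.ι ℝ) ^ 0 at hl
        rw [pow_zero] at hl
        obtain ⟨r, rfl⟩ := Submodule.mem_one.1 hl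
        rw [ExteriorAlgebra.algebraMap_leftInverse, fTmul_smul_left,
          Algebra.algebraMap_eq_smul_one, fTmul_smul_right, fTmul_one, pow_zero, one_mul, smul_smul]
      | succ p =>
        rw [algebraMapInv_of_mem hl, zero_pow (Nat.succ_ne_zero p), zero_mul, mul_zero, zero_smul,
          zero_smul]
        exact map_zero (fTmulLeft _)

end ChernWeil
end

/-! ### Functoriality of forms and null homotopies from acyclic models. -/

noncomputable section

namespace ChernWeil

open GDiffSimplicialAlg

/-! ### Functoriality of the pull-back of forms -/

theorem bary_injective {n : ℕ} {x y : Fin n → ℝ} (h : bary x = bary y) : x = y := by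
  ext i
  simpa [bary] using congrFun h i.succ

/-- Barycentric coordinates treat all vertices alike; in these both sides sum `t_i` over the fibres
of the composite. -/
theorem simplexMap_comp {l m n : ℕ} (ψ : Fin (m + 1) →o Fin (n + 1)) (φ : Fin (l + 1) →o Fin (m + 1))
    (x : Fin l → ℝ) : simplexMap (ψ.comp φ) x = simplexMap ψ (simplexMap φ x) := by
  refine bary_injective (funext fun j => ?_)
  simp_rw [bary_simplexMap, Finset.sum_filter]
  rw [← Finset.sum_fiberwise (s := Finset.univ) (g := φ)]
  refine Finset.sum_congr rfl fun k _ => ?_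
  rw [Finset.sum_filter, ← Finset.sum_filter]
  by_cases h : ψ k = j
  · rw [if_pos h, Finset.sum_filter]
    refine Finset.sum_congr rfl fun i _ => ?_
    by_cases hi : φ i = k
    · rw [if_pos hi, if_pos hi, if_pos]
      simp [hi, h]
    · rw [if_neg hi, if_neg hi]
  · rw [if_neg h]
    refine Finset.sum_eq_zero fun i hi => ?_
    rw [if_neg]
    simpa [(Finset.mem_filter.1 hi).2] using h

theorem sum_dbary (n : ℕ) : ∑ i, dbary (n := n) i = 0 := by
  rw [Fin.sum_univ_succ]
  ext k
  simp [dbary, Finset.sum_apply, Pi.single_apply]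

/-- For `j = 0`, which has no basis covector of its own, the formula follows from the other ones
because the `dt_i` sum to zero on both simplices. -/
theorem pullCovector_dbary {m n : ℕ} (φ : Fin (m + 1) →o Fin (n + 1)) (j : Fin (n + 1)) :
    pullCovector φ (dbary j) = ∑ i with φ i = j, dbary i := by
  have hs : ∀ j : Fin n, pullCovector φ (dbary j.succ) = ∑ i with φ i = j.succ, dbary i := fun j =>
    pullCovector_single φ j
  refine Fin.cases ?_ hs j
  have h1 := congrArg (pullCovector φ) (sum_dbary n)
  rw [map_zero, map_sum, Fin.sum_univ_succ] at h1
  have h2 := sum_dbary m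
  rw [← Finset.sum_fiberwise (s := Finset.univ) (g := φ), Fin.sum_univ_succ] at h2
  simp_rw [hs] at h1
  exact add_right_cancel (h1.trans h2.symm)

theorem pullCovector_comp {l m n : ℕ} (ψ : Fin (m + 1) →o Fin (n + 1))
    (φ : Fin (l + 1) →o Fin (m + 1)) :
    pullCovector (ψ.comp φ) = pullCovector φ ∘ₗ pullCovector ψ := by
  refine LinearMap.pi_ext' fun j => LinearMap.ext_ring ?_
  change pullCovector _ (Pi.single j 1) = pullCovector φ (pullCovector ψ (Pi.single j 1))
  rw [pullCovector_single, pullCovector_single, map_sum]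
  simp_rw [pullCovector_dbary, Finset.sum_filter]
  rw [← Finset.sum_fiberwise (s := Finset.univ) (g := φ)]
  refine Finset.sum_congr rfl fun k _ => ?_
  by_cases h : ψ k = j.succ
  · rw [if_pos h, Finset.sum_filter]
    refine Finset.sum_congr rfl fun i _ => ?_
    by_cases hi : φ i = k
    · rw [if_pos hi, if_pos hi, if_pos]
      simp [hi, h]
    · rw [if_neg hi, if_neg hi]
  · rw [if_neg h]
    refine Finset.sum_eq_zero fun i hi => ?_
    rw [if_neg]
    simpa [(Finset.mem_filter.1 hi).2] using h

theorem pullForm_comp {l m n : ℕ} (ψ : Fin (m + 1) →o Fin (n + 1)) (φ : Fin (l + 1) →o Fin (m + 1))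
    (x : Forms n) : pullForm (ψ.comp φ) x = pullForm φ (pullForm ψ x) := by
  induction x using fTmul_induction with
  | h0 => simp
  | hadd x y hx hy => simp only [map_add, hx, hy]
  | h f l =>
    simp only [pullForm_fTmul]
    congr 1
    · ext x
      exact congrArg f.1 (Subtype.ext (simplexMap_comp ψ φ x.1))
    · rw [pullCovector_comp, ← ExteriorAlgebra.map_comp_map]
      rfl

/-! ### Acyclic models -/

/-- The terms with `j ≤ i` cancel against those with `i < j` under `(i, j) ↦ (j, i + 1)`, which
reverses the sign: the usual argument for `∂∂ = 0`. -/
theorem sum_sum_alternating {M : Type*} [AddCommGroup M] [Module ℝ M] (n : ℕ)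
    (g : Fin (n + 2) → Fin (n + 3) → M)
    (hg : ∀ i j : Fin (n + 2), i ≤ j → g i j.succ = g j i.castSucc) :
    ∑ j : Fin (n + 3), (-1 : ℝ) ^ (j : ℕ) • ∑ i : Fin (n + 2), (-1 : ℝ) ^ (i : ℕ) • g i j = 0 := by
  simp_rw [Finset.smul_sum, smul_smul, ← pow_add]
  rw [Finset.sum_comm, ← Fintype.sum_prod_type' fun (i : Fin (n + 2)) (j : Fin (n + 3)) =>
    (-1 : ℝ) ^ ((j : ℕ) + (i : ℕ)) • g i j]
  let S : Finset (Fin (n + 2) × Fin (n + 3)) := {ij | (ij.2 : ℕ) ≤ (ij.1 : ℕ)}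
  rw [← Finset.sum_add_sum_compl S, ← eq_neg_iff_add_eq_zero, ← Finset.sum_neg_distrib]
  let φ : ∀ ij : Fin (n + 2) × Fin (n + 3), ij ∈ S → Fin (n + 2) × Fin (n + 3) := fun ij hij =>
    (Fin.castLT ij.2 (lt_of_le_of_lt (Finset.mem_filter.mp hij).right (Fin.is_lt ij.1)), ij.1.succ)
  apply Finset.sum_bij φ
  · intro ij hij
    simp_rw [S, φ, Finset.compl_filter, Finset.mem_filter_univ, Fin.val_succ,
      Fin.val_castLT] at hij ⊢
    omega
  · rintro ⟨i, j⟩ hij ⟨i', j'⟩ hij' h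
    rw [Prod.mk_inj]
    exact ⟨by simpa [φ] using! congr_arg Prod.snd h,
      by simpa [φ, Fin.castSucc_castLT] using! congr_arg Fin.castSucc (congr_arg Prod.fst h)⟩
  · rintro ⟨i', j'⟩ hij'
    simp_rw [S, Finset.compl_filter, Finset.mem_filter_univ, not_le] at hij'
    refine ⟨(j'.pred <| ?_, Fin.castSucc i'), ?_, ?_⟩
    · rintro rfl
      simp only [Fin.val_zero, not_lt_zero] at hij'
    · simpa [S] using! Nat.le_sub_one_of_lt hij'
    · simp only [φ, Fin.castLT_castSucc, Fin.succ_pred]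
  · rintro ⟨i, j⟩ hij
    have hle : (j : ℕ) ≤ (i : ℕ) := (Finset.mem_filter.mp hij).right
    simp only [φ, ← neg_smul]
    rw [hg _ i (by rw [Fin.le_def]; exact hle), Fin.castSucc_castLT, Fin.val_succ, Fin.val_castLT]
    congr 1
    ring

/-- A simplicial complex of vector spaces `V_n`, with a differential `D`, a parity involution `P`
and a contracting homotopy `h` of `V_n` onto the line spanned by `u_n`. -/
structure AcyclicModel where
  V : ℕ → Type
  [grp : ∀ n, AddCommGroup (V n)]
  [mod : ∀ n, Module ℝ (V n)]
  /-- elements of a given degree -/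
  F : ∀ n, ℕ → Submodule ℝ (V n)
  pull : ∀ {m n : ℕ}, (Fin (m + 1) →o Fin (n + 1)) → V n →ₗ[ℝ] V m
  pull_comp : ∀ {l m n : ℕ} (ψ : Fin (m + 1) →o Fin (n + 1)) (φ : Fin (l + 1) →o Fin (m + 1)),
    pull (ψ.comp φ) = pull φ ∘ₗ pull ψ
  pull_mem : ∀ {m n : ℕ} (φ : Fin (m + 1) →o Fin (n + 1)) {k : ℕ} {x : V n}, x ∈ F n k →
    pull φ x ∈ F m k
  D : ∀ n, V n →ₗ[ℝ] V n
  P : ∀ n, V n →ₗ[ℝ] V n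
  h : ∀ n, V n →ₗ[ℝ] V n
  u : ∀ n, V n
  e : ∀ n, V n →ₗ[ℝ] ℝ
  pull_D : ∀ {m n : ℕ} (φ : Fin (m + 1) →o Fin (n + 1)) (x : V n), pull φ (D n x) = D m (pull φ x)
  pull_P : ∀ {m n : ℕ} (φ : Fin (m + 1) →o Fin (n + 1)) (x : V n), pull φ (P n x) = P m (pull φ x)
  homotopy : ∀ n x, D n (h n x) + h n (D n x) = x - e n x • u n
  P_h : ∀ n x, P n (h n x) = -h n (P n x)
  h_mem : ∀ n k x, x ∈ F n (k + 1) → h n x ∈ F n k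
  h_zero : ∀ n x, x ∈ F n 0 → h n x = 0
  u_mem : ∀ n, u n ∈ F n 0

namespace AcyclicModel

attribute [instance] grp mod

variable (Q : AcyclicModel)

/-- The alternating sum of the face maps. -/
def bdry (n : ℕ) : Q.V (n + 1) →ₗ[ℝ] Q.V n :=
  ∑ i : Fin (n + 2), (-1 : ℝ) ^ (i : ℕ) • Q.pull (face i)

theorem bdry_apply (n : ℕ) (x : Q.V (n + 1)) :
    Q.bdry n x = ∑ i : Fin (n + 2), (-1 : ℝ) ^ (i : ℕ) • Q.pull (face i) x := by
  simp [bdry, LinearMap.sum_apply]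

theorem bdry_bdry (n : ℕ) (x : Q.V (n + 2)) : Q.bdry n (Q.bdry (n + 1) x) = 0 := by
  simp only [bdry_apply, map_sum, map_smul]
  refine sum_sum_alternating n (fun i j => Q.pull (face i) (Q.pull (face j) x)) fun i j hij => ?_
  simp only [← LinearMap.comp_apply, ← Q.pull_comp]
  exact congrArg (fun φ : SimplexCategory.mk n ⟶ SimplexCategory.mk (n + 2) =>
    Q.pull φ.toOrderHom x) (SimplexCategory.δ_comp_δ hij)

theorem bdry_D (n : ℕ) (x : Q.V (n + 1)) : Q.bdry n (Q.D (n + 1) x) = Q.D n (Q.bdry n x) := by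
  simp only [bdry_apply, map_sum, map_smul, Q.pull_D]

theorem bdry_P (n : ℕ) (x : Q.V (n + 1)) : Q.bdry n (Q.P (n + 1) x) = Q.P n (Q.bdry n x) := by
  simp only [bdry_apply, map_sum, map_smul, Q.pull_P]

theorem bdry_mem {n k : ℕ} {x : Q.V (n + 1)} (hx : x ∈ Q.F (n + 1) k) : Q.bdry n x ∈ Q.F n k := by
  rw [bdry_apply]
  exact Submodule.sum_mem _ fun i _ => Submodule.smul_mem _ _ (Q.pull_mem _ hx)

/-- A chain map from an acyclic model to the ground field. -/
structure Functional where
  T : ∀ n, Q.V n →ₗ[ℝ] ℝ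
  T_D_zero : ∀ x, T 0 (Q.D 0 x) = 0
  T_D : ∀ n x, T (n + 1) (Q.D (n + 1) x) = T n (Q.bdry n x)
  T_u : T 0 (Q.u 0) = 0
  T_P : ∀ n x, T n (Q.P n x) = (-1 : ℝ) ^ n * T n x
  T_low : ∀ n k, k < n → ∀ x ∈ Q.F n k, T n x = 0

namespace Functional

variable {Q} (S : Q.Functional)

/-- The null homotopy of a chain map. -/
def K : ∀ n, Q.V n →ₗ[ℝ] ℝ
  | 0 => S.T 0 ∘ₗ Q.h 0
  | n + 1 => (S.T (n + 1) - K n ∘ₗ Q.bdry n) ∘ₗ Q.h (n + 1)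

theorem K_zero_apply (x : Q.V 0) : S.K 0 x = S.T 0 (Q.h 0 x) := rfl

theorem K_succ_apply (n : ℕ) (x : Q.V (n + 1)) :
    S.K (n + 1) x = S.T (n + 1) (Q.h (n + 1) x) - S.K n (Q.bdry n (Q.h (n + 1) x)) := rfl

/-- The homotopy `h` lowers the degree by one and `∂` lowers the level by one, so the vanishing of
`T n` below degree `n` propagates to `K n` in degrees up to `n`. -/
theorem K_low (n k : ℕ) (hk : k ≤ n) (x : Q.V n) (hx : x ∈ Q.F n k) : S.K n x = 0 := by
  induction n generalizing k with
  | zero =>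
    obtain rfl : k = 0 := by omega
    rw [K_zero_apply, Q.h_zero _ _ hx, map_zero]
  | succ n ih =>
    rw [K_succ_apply]
    cases k with
    | zero => rw [Q.h_zero _ _ hx, map_zero, map_zero, map_zero, sub_zero]
    | succ k =>
      have h := Q.h_mem _ _ _ hx
      rw [S.T_low _ k (by omega) _ h, ih k (by omega) _ (Q.bdry_mem h), sub_zero]

/-- Since `h` anticommutes with `P`, the functional `K n` carries one sign more than `T n`. This
accounts for the `P` that accompanies contractions and differentials of `A_n`. -/
theorem K_P (n : ℕ) (x : Q.V n) : S.K n (Q.P n x) = (-1 : ℝ) ^ (n + 1) * S.K n x := by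
  have hP : ∀ n x, Q.h n (Q.P n x) = -Q.P n (Q.h n x) := fun n x => by rw [Q.P_h, neg_neg]
  induction n with
  | zero =>
    rw [K_zero_apply, hP, map_neg, S.T_P, K_zero_apply]
    ring
  | succ n ih =>
    rw [K_succ_apply, hP, map_neg, S.T_P, K_succ_apply, map_neg, map_neg, Q.bdry_P, ih]
    ring

theorem K_D_zero (x : Q.V 0) : S.K 0 (Q.D 0 x) = S.T 0 x := by
  rw [K_zero_apply, eq_sub_of_add_eq' (Q.homotopy 0 x), map_sub, map_sub, S.T_D_zero, map_smul,
    S.T_u]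
  simp

/-- Substitute `h D x = x - e(x) u - D h x` in the definition of `K`. The unit contributes nothing
by `T_low` and `K_low`, and the two contributions of `D h x` cancel once `K D = T` is known on `∂ h
x`. -/
theorem K_D_succ (n : ℕ) (x : Q.V (n + 1)) :
    S.K (n + 1) (Q.D (n + 1) x) + S.K n (Q.bdry n x) = S.T (n + 1) x := by
  -- One level down, the `∂` term of the identity disappears on `∂ h x` because `∂∂ = 0`. This is
  -- the only recursive use.
  have key : S.K n (Q.D n (Q.bdry n (Q.h (n + 1) x))) = S.T n (Q.bdry n (Q.h (n + 1) x)) := by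
    cases n with
    | zero => exact S.K_D_zero _
    | succ n =>
      have h := K_D_succ n (Q.bdry (n + 1) (Q.h (n + 2) x))
      rw [Q.bdry_bdry, map_zero, add_zero] at h
      exact h
  have hu : S.T (n + 1) (Q.u (n + 1)) = 0 := S.T_low _ 0 (by omega) _ (Q.u_mem _)
  have hu' : S.K n (Q.bdry n (Q.u (n + 1))) = 0 :=
    S.K_low n 0 (by omega) _ (Q.bdry_mem (Q.u_mem _))
  rw [K_succ_apply, eq_sub_of_add_eq' (Q.homotopy (n + 1) x)]
  simp only [map_sub, map_smul, hu, hu', Q.bdry_D, S.T_D, key, smul_zero]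
  ring
termination_by n

end Functional

end AcyclicModel

/-- The partial evaluation `v ⊗ b ↦ φ(v) b`. -/
def slant {V B : Type*} [AddCommGroup V] [Module ℝ V] [AddCommGroup B] [Module ℝ B]
    (φ : V →ₗ[ℝ] ℝ) : V ⊗[ℝ] B →ₗ[ℝ] B :=
  (TensorProduct.lid ℝ B).toLinearMap ∘ₗ TensorProduct.map φ LinearMap.id

section Slant

variable {V V' B B' : Type*} [AddCommGroup V] [Module ℝ V] [AddCommGroup B] [Module ℝ B]
  [AddCommGroup V'] [Module ℝ V'] [AddCommGroup B'] [Module ℝ B']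

theorem slant_tmul (φ : V →ₗ[ℝ] ℝ) (v : V) (b : B) : slant φ (v ⊗ₜ[ℝ] b) = φ v • b := by
  simp [slant]

theorem slant_map (φ : V' →ₗ[ℝ] ℝ) (f : V →ₗ[ℝ] V') (g : B →ₗ[ℝ] B') (x : V ⊗[ℝ] B) :
    slant φ (TensorProduct.map f g x) = g (slant (φ ∘ₗ f) x) := by
  induction x using TensorProduct.induction_on with
  | zero => simp
  | add x y hx hy => simp only [map_add, hx, hy]
  | tmul v b => simp [slant_tmul]

theorem slant_add (φ ψ : V →ₗ[ℝ] ℝ) (x : V ⊗[ℝ] B) :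
    slant (φ + ψ) x = slant φ x + slant ψ x := by
  induction x using TensorProduct.induction_on with
  | zero => simp
  | add x y hx hy => simp only [map_add, hx, hy]; abel
  | tmul v b => simp [slant_tmul, add_smul]

theorem slant_smul (r : ℝ) (φ : V →ₗ[ℝ] ℝ) (x : V ⊗[ℝ] B) :
    slant (r • φ) x = r • slant φ x := by
  induction x using TensorProduct.induction_on with
  | zero => simp
  | add x y hx hy => simp only [map_add, hx, hy, smul_add]
  | tmul v b => simp [slant_tmul, smul_smul]

theorem slant_sum {ι : Type*} (s : Finset ι) (φ : ι → V →ₗ[ℝ] ℝ) (x : V ⊗[ℝ] B) :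
    slant (∑ i ∈ s, φ i) x = ∑ i ∈ s, slant (φ i) x := by
  induction s using Finset.cons_induction with
  | empty => simpa using slant_smul 0 (0 : V →ₗ[ℝ] ℝ) x
  | cons a s ha ih => rw [Finset.sum_cons, Finset.sum_cons, slant_add, ih]

end Slant

namespace AcyclicModel

variable {d : ℕ} {G : Type v} [TopologicalSpace G] [ChartedSpace (EuclideanSpace ℝ (Fin d)) G]
  [Group G] {A : GDiffSimplicialAlg.{u} d G} {Q : AcyclicModel}

/-- Compatible closed basic elements of `V_n ⊗ A_n`. -/
structure BasicCycle (A : GDiffSimplicialAlg.{u} d G) (Q : AcyclicModel) where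
  w : ∀ n, Q.V n ⊗[ℝ] lvl A n
  closed : ∀ n, TensorProduct.map (Q.D n) LinearMap.id (w n) +
    TensorProduct.map (Q.P n) (lvl A n).diff (w n) = 0
  contr : ∀ n X, TensorProduct.map (Q.P n) ((lvl A n).contr X) (w n) = 0
  lie : ∀ n X, TensorProduct.map LinearMap.id ((lvl A n).lie X) (w n) = 0
  compat : ∀ n (i : Fin (n + 2)), TensorProduct.map (Q.pull (face i)) LinearMap.id (w (n + 1)) =
    TensorProduct.map LinearMap.id (GDiffAlg.homAlg (CosimplicialObject.δ A i)).toLinearMap (w n)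
  bounded : ∃ N, ∀ n, N < n → ∀ φ : Q.V n →ₗ[ℝ] ℝ, (∀ k < n, ∀ x ∈ Q.F n k, φ x = 0) →
    slant φ (w n) = 0

/-- The primitive is `c_n = K_n(w_n)`. Applying `K_n` to `closed` turns `(-1)^n d c_n` into `(K_n
D)(w_n)`, `compat` turns the face sum of `c` into `(K_{n-1} ∂)(w_n)`, and the two add up to
`T_n(w_n)`. Finite length comes from `bounded` and `K_low`. -/
theorem BasicCycle.exists_totalDiff (S : Q.Functional) (W : BasicCycle A Q) :
    ∃ c ∈ basicCochains A, ∀ n, totalDiff A c n = slant (S.T n) (W.w n) := by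
  refine ⟨fun n => slant (S.K n) (W.w n), ⟨fun n => ?_, ?_⟩, fun n => ?_⟩
  · rw [GDiffAlg.basic, Submodule.mem_iInf]
    refine fun X => ⟨?_, ?_⟩
    · have h := congrArg (slant (S.K n)) (W.lie n X)
      rw [slant_map, map_zero, LinearMap.comp_id] at h
      exact h
    · have h := congrArg (slant (S.K n)) (W.contr n X)
      have e : S.K n ∘ₗ Q.P n = (-1 : ℝ) ^ (n + 1) • S.K n := LinearMap.ext (S.K_P n)
      rw [slant_map, map_zero, e, slant_smul, map_smul] at h
      exact (smul_eq_zero.1 h).resolve_left (pow_ne_zero _ (by norm_num))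
  · obtain ⟨N, hN⟩ := W.bounded
    exact ⟨N, fun n hn => hN n hn _ fun k hk x hx => S.K_low n k hk.le x hx⟩
  · have h := congrArg (slant (S.K n)) (W.closed n)
    have e : S.K n ∘ₗ Q.P n = (-1 : ℝ) ^ (n + 1) • S.K n := LinearMap.ext (S.K_P n)
    rw [map_add, slant_map, slant_map, map_zero, e, slant_smul, map_smul, LinearMap.id_apply] at h
    have h1 : (-1 : ℝ) ^ n • (lvl A n).diff (slant (S.K n) (W.w n)) =
        slant (S.K n ∘ₗ Q.D n) (W.w n) := by
      rw [eq_neg_of_add_eq_zero_left h, pow_succ]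
      simp
    change (-1 : ℝ) ^ n • (lvl A n).diff (slant (S.K n) (W.w n)) + faceSum A n _ = _
    rw [h1]
    cases n with
    | zero =>
      have e : S.K 0 ∘ₗ Q.D 0 = S.T 0 := LinearMap.ext S.K_D_zero
      rw [e]
      exact add_zero _
    | succ n =>
      have e : S.T (n + 1) = S.K (n + 1) ∘ₗ Q.D (n + 1) +
          ∑ i : Fin (n + 2), (-1 : ℝ) ^ (i : ℕ) • (S.K n ∘ₗ Q.pull (face i)) := by
        refine LinearMap.ext fun x => ?_
        rw [← S.K_D_succ n x, bdry_apply]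
        simp [LinearMap.sum_apply, map_sum]
      rw [e, slant_add, slant_sum]
      congr 1
      rw [faceSum, LinearMap.sum_apply]
      refine Finset.sum_congr rfl fun i _ => ?_
      rw [slant_smul]
      have h3 := congrArg (slant (S.K n)) (W.compat n i)
      rw [slant_map, slant_map, LinearMap.comp_id, LinearMap.id_apply] at h3
      rw [h3]
      rfl

end AcyclicModel

end ChernWeil
end

/-! ### Independence of the pseudo-connection by means of joins. -/

noncomputable section

namespace ChernWeil

open GDiffSimplicialAlg

/-! ### Joins of simplices -/

/-- The map of vertices of joins induced by `φ`. -/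
def joinFun {m n : ℕ} (φ : Fin (m + 1) →o Fin (n + 1)) :
    Fin (m + 1 + m + 1) → Fin (n + 1 + n + 1) :=
  Fin.append (m := m + 1) (n := m + 1) (fun i => Fin.castAdd (n + 1) (φ i))
    fun i => Fin.natAdd (n + 1) (φ i)

theorem joinFun_castAdd {m n : ℕ} (φ : Fin (m + 1) →o Fin (n + 1)) (i : Fin (m + 1)) :
    joinFun φ (Fin.castAdd (m + 1) i) = Fin.castAdd (n + 1) (φ i) :=
  Fin.append_left (m := m + 1) (n := m + 1) _ _ i

theorem joinFun_natAdd {m n : ℕ} (φ : Fin (m + 1) →o Fin (n + 1)) (i : Fin (m + 1)) :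
    joinFun φ (Fin.natAdd (m + 1) i) = Fin.natAdd (n + 1) (φ i) :=
  Fin.append_right (m := m + 1) (n := m + 1) _ _ i

/-- The map of joins `Δ_m * Δ_m → Δ_n * Δ_n` induced by `φ`. -/
def joinMap {m n : ℕ} (φ : Fin (m + 1) →o Fin (n + 1)) :
    Fin (m + 1 + m + 1) →o Fin (n + 1 + n + 1) where
  toFun := joinFun φ
  monotone' := by
    intro i j
    refine Fin.addCases (m := m + 1) (n := m + 1) (fun i => ?_) (fun i => ?_) i <;>
      refine Fin.addCases (m := m + 1) (n := m + 1) (fun j => ?_) (fun j => ?_) j <;> intro h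
    · refine (joinFun_castAdd φ i).trans_le (le_of_le_of_eq ?_ (joinFun_castAdd φ j).symm)
      exact φ.monotone h
    · refine (joinFun_castAdd φ i).trans_le (le_of_le_of_eq ?_ (joinFun_natAdd φ j).symm)
      have := (φ i).2
      simp only [Fin.le_def, Fin.val_castAdd, Fin.val_natAdd]
      omega
    · have := j.2
      simp only [Fin.le_def, Fin.val_castAdd, Fin.val_natAdd] at h
      omega
    · refine (joinFun_natAdd φ i).trans_le (le_of_le_of_eq ?_ (joinFun_natAdd φ j).symm)
      have := φ.monotone (a := i) (b := j) (by
        simp only [Fin.le_def, Fin.val_natAdd] at h ⊢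
        omega)
      simp only [Fin.le_def, Fin.val_natAdd] at this ⊢
      omega

/-- The first factor of the join. -/
def joinFront (n : ℕ) : Fin (n + 1) →o Fin (n + 1 + n + 1) where
  toFun i := Fin.castAdd (n + 1) i
  monotone' _ _ h := h

/-- The second factor of the join. -/
def joinBack (n : ℕ) : Fin (n + 1) →o Fin (n + 1 + n + 1) where
  toFun i := Fin.natAdd (n + 1) i
  monotone' i j h := by
    simp only [Fin.le_def, Fin.val_natAdd] at h ⊢
    omega

section Join

variable {l m n : ℕ} (φ : Fin (m + 1) →o Fin (n + 1))

theorem joinMap_castAdd (i : Fin (m + 1)) :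
    joinMap φ (Fin.castAdd (m + 1) i) = Fin.castAdd (n + 1) (φ i) :=
  joinFun_castAdd φ i

theorem joinMap_natAdd (i : Fin (m + 1)) :
    joinMap φ (Fin.natAdd (m + 1) i) = Fin.natAdd (n + 1) (φ i) :=
  joinFun_natAdd φ i

theorem joinMap_comp (ψ : Fin (l + 1) →o Fin (m + 1)) :
    joinMap (φ.comp ψ) = (joinMap φ).comp (joinMap ψ) := by
  refine OrderHom.ext _ _ (funext fun i => ?_)
  refine Fin.addCases (m := l + 1) (n := l + 1) (fun i => ?_) (fun i => ?_) i
  · refine (joinMap_castAdd _ i).trans (Eq.symm ?_)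
    exact (congrArg (joinMap φ) (joinMap_castAdd ψ i)).trans (joinMap_castAdd φ _)
  · refine (joinMap_natAdd _ i).trans (Eq.symm ?_)
    exact (congrArg (joinMap φ) (joinMap_natAdd ψ i)).trans (joinMap_natAdd φ _)

theorem joinMap_comp_front : (joinMap φ).comp (joinFront m) = (joinFront n).comp φ :=
  OrderHom.ext _ _ (funext fun i => joinMap_castAdd φ i)

theorem joinMap_comp_back : (joinMap φ).comp (joinBack m) = (joinBack n).comp φ :=
  OrderHom.ext _ _ (funext fun i => joinMap_natAdd φ i)

end Join

theorem parity_pullForm {m n : ℕ} (φ : Fin (m + 1) →o Fin (n + 1)) (x : Forms n) :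
    parity (formDeg m) (pullForm φ x) = pullForm φ (parity (formDeg n) x) :=
  parity_of_even_map (formDeg n) (formDeg m) (f := (pullForm φ).toLinearMap)
    (fun _ _ h => pullForm_mem φ h) x

/-! ### Independence of the pseudo-connection -/

/-- The acyclic model of forms on joins. -/
def joinModel : AcyclicModel where
  V n := Forms (n + 1 + n)
  grp n := inferInstance
  mod n := inferInstance
  F n := formDeg (n + 1 + n)
  pull φ := (pullForm (joinMap φ)).toLinearMap
  pull_comp ψ φ := LinearMap.ext fun x => by
    rw [joinMap_comp]
    exact pullForm_comp _ _ x
  pull_mem φ _ _ h := pullForm_mem _ h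
  D n := dForm _
  P n := parity (formDeg _)
  h n := poincare _
  u n := 1
  e n := augment _
  pull_D φ x := (dForm_pullForm _ x).symm
  pull_P φ x := (parity_pullForm _ x).symm
  homotopy n x := dForm_poincare x
  P_h n x := parity_poincare x
  h_mem n k x hx := poincare_mem hx
  h_zero n x hx := poincare_of_mem_zero hx
  u_mem n := SetLike.one_mem_graded (formDeg (n + 1 + n))

/-- Integration over a subsimplex. -/
def integralAlong {m n : ℕ} (φ : Fin (m + 1) →o Fin (n + 1)) : Forms n →ₗ[ℝ] ℝ :=
  integralForm m ∘ₗ (pullForm φ).toLinearMap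

theorem integralAlong_apply {m n : ℕ} (φ : Fin (m + 1) →o Fin (n + 1)) (x : Forms n) :
    integralAlong φ x = integralForm m (pullForm φ x) := rfl

theorem integralAlong_pullForm {l m n : ℕ} (ψ : Fin (m + 1) →o Fin (n + 1))
    (φ : Fin (l + 1) →o Fin (m + 1)) (x : Forms n) :
    integralAlong φ (pullForm ψ x) = integralAlong (ψ.comp φ) x := by
  rw [integralAlong_apply, integralAlong_apply, pullForm_comp]

theorem integralAlong_dForm_zero {n : ℕ} (φ : Fin (0 + 1) →o Fin (n + 1)) (x : Forms n) :
    integralAlong φ (dForm n x) = 0 := by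
  rw [integralAlong_apply, ← dForm_pullForm, integralForm_dForm_zero]

theorem integralAlong_dForm {m n : ℕ} (φ : Fin (m + 1 + 1) →o Fin (n + 1)) (x : Forms n) :
    integralAlong φ (dForm n x) =
      ∑ i : Fin (m + 2), (-1 : ℝ) ^ (i : ℕ) * integralAlong (φ.comp (face i)) x := by
  rw [integralAlong_apply, ← dForm_pullForm, integralForm_dForm]
  simp_rw [integralAlong_apply, pullForm_comp]

theorem integralAlong_parity {m n : ℕ} (φ : Fin (m + 1) →o Fin (n + 1)) (x : Forms n) :
    integralAlong φ (parity (formDeg n) x) = (-1) ^ m * integralAlong φ x := by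
  rw [integralAlong_apply, ← parity_pullForm, integralForm_parity, integralAlong_apply]

theorem integralAlong_of_mem {m n p : ℕ} (φ : Fin (m + 1) →o Fin (n + 1)) (h : p ≠ m) {x : Forms n}
    (hx : x ∈ formDeg n p) : integralAlong φ x = 0 :=
  integralForm_of_mem h (pullForm_mem φ hx)

/-- The difference of the integrals over the two factors of the join. -/
def joinDiff (n : ℕ) : Forms (n + 1 + n) →ₗ[ℝ] ℝ :=
  integralAlong (joinBack n) - integralAlong (joinFront n)

theorem joinDiff_apply (n : ℕ) (x : Forms (n + 1 + n)) :
    joinDiff n x = integralAlong (joinBack n) x - integralAlong (joinFront n) x := rfl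

theorem joinDiff_dForm_zero (x : Forms (0 + 1 + 0)) : joinDiff 0 (dForm _ x) = 0 := by
  rw [joinDiff_apply, integralAlong_dForm_zero, integralAlong_dForm_zero, sub_zero]

/-- Stokes' theorem on each factor. The faces of a factor are the factors of the joined faces, so
the difference of integrals respects boundaries. -/
theorem joinDiff_dForm (n : ℕ) (x : Forms (n + 1 + 1 + (n + 1))) :
    joinDiff (n + 1) (dForm _ x) =
      joinDiff n (∑ i : Fin (n + 2), (-1 : ℝ) ^ (i : ℕ) • pullForm (joinMap (face i)) x) := by
  rw [joinDiff_apply, integralAlong_dForm, integralAlong_dForm, ← Finset.sum_sub_distrib, map_sum]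
  refine Finset.sum_congr rfl fun i _ => ?_
  rw [map_smul, joinDiff_apply, integralAlong_pullForm, integralAlong_pullForm,
    joinMap_comp_back, joinMap_comp_front, smul_eq_mul, mul_sub]

/-- On a constant the integrals over two points agree. The single integrals do not kill the unit;
only their difference does, as a null homotopy requires. -/
theorem joinDiff_one : joinDiff 0 1 = 0 := by
  rw [joinDiff_apply, integralAlong_apply, integralAlong_apply, map_one (pullForm (joinBack 0)),
    map_one (pullForm (joinFront 0)), sub_self]

theorem joinDiff_parity (n : ℕ) (x : Forms (n + 1 + n)) :
    joinDiff n (parity (formDeg _) x) = (-1) ^ n * joinDiff n x := by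
  rw [joinDiff_apply, joinDiff_apply, integralAlong_parity, integralAlong_parity, mul_sub]

theorem joinDiff_of_mem {n k : ℕ} (hk : k < n) {x : Forms (n + 1 + n)}
    (hx : x ∈ formDeg (n + 1 + n) k) : joinDiff n x = 0 := by
  rw [joinDiff_apply, integralAlong_of_mem _ hk.ne hx, integralAlong_of_mem _ hk.ne hx, sub_zero]

/-- The difference of the integrals as a functional on the join model. -/
def joinFunctional : joinModel.Functional where
  T := joinDiff
  T_D_zero := joinDiff_dForm_zero
  T_D n x := (joinDiff_dForm n x).trans (congrArg (joinDiff n) (joinModel.bdry_apply n x).symm)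
  T_u := joinDiff_one
  T_P := joinDiff_parity
  T_low _ _ hk _ hx := joinDiff_of_mem hk hx

variable {d : ℕ} {G : Type v} [TopologicalSpace G] [ChartedSpace (EuclideanSpace ℝ (Fin d)) G]
  [Group G]

namespace Mixed

variable {m n : ℕ} {B C : GDiffAlg.{u} d G}

/-- The identification with the underlying tensor product. -/
def toTensor (m : ℕ) (B : GDiffAlg.{u} d G) : Mixed m B ≃ₗ[ℝ] Forms m ⊗[ℝ] B :=
  (GradedTensorProduct.of ℝ (formDeg m) B.deg).symm

theorem toTensor_mk (w : Forms m) (a : B) : toTensor m B (mk m B w a) = w ⊗ₜ[ℝ] a := rfl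

theorem integral_eq_slant (x : Mixed m B) :
    integral m B x = slant (integralForm m) (toTensor m B x) := rfl

theorem slant_of_mem (φ : Forms m →ₗ[ℝ] ℝ) {N : ℕ} (hφ : ∀ k ≤ N, ∀ w ∈ formDeg m k, φ w = 0)
    {x : Mixed m B} (hx : x ∈ totalDeg m B N) : slant φ (toTensor m B x) = 0 := by
  induction hx using Submodule.span_induction with
  | zero => simp
  | add a b _ _ ha hb => rw [map_add, map_add, ha, hb, add_zero]
  | smul s a _ ha => rw [map_smul, map_smul, ha, smul_zero]
  | mem x hx =>
    obtain ⟨p, q, hpq, w, hw, a, ha, rfl⟩ := hx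
    rw [← mk_apply, toTensor_mk, slant_tmul, hφ p (by omega) w hw, zero_smul]

theorem slant_integralAlong (φ : Fin (m + 1) →o Fin (n + 1)) (x : Mixed n B) :
    slant (integralAlong φ) (toTensor n B x) = integral m B (pullAlg φ B x) :=
  (slant_map (integralForm m) (pullForm φ).toLinearMap LinearMap.id _).symm

end Mixed

namespace GDiffSimplicialAlg

variable [LieGroup (𝓡 d) ∞ G] [T2Space G] {A : GDiffSimplicialAlg.{u} d G}

/-- The connections on the vertices of the joins induced by two pseudo-connections. -/
def joinConnection (θ θ' : PseudoConnection A) (n : ℕ) :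
    Fin (n + 1 + n + 1) → Connection (lvl A n) :=
  Fin.append (m := n + 1) (n := n + 1) (vertexConnection θ n) (vertexConnection θ' n)

-- Both sides are family forms over the same join, and `joinMap` keeps the two factors apart, so the
-- connections from `θ` and `θ'` are reindexed separately.
omit [T2Space G] in
theorem pullAlg_joinMap_famChernWeil (θ θ' : PseudoConnection A) (f : SymDual d G) (n : ℕ)
    (i : Fin (n + 2)) :
    Mixed.pullAlg (joinMap (face i)) (lvl A (n + 1))
        (famChernWeil (joinConnection θ θ' (n + 1)) f) =
      Mixed.pushAlg (n + 1 + n) (CosimplicialObject.δ A i)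
        (famChernWeil (joinConnection θ θ' n) f) := by
  rw [pullAlg_famChernWeil, pushAlg_famChernWeil]
  congr 2
  refine funext fun j => ?_
  refine Fin.addCases (m := n + 1) (n := n + 1) (fun j => ?_) (fun j => ?_) j
  · rw [Function.comp_apply, joinMap_castAdd, joinConnection, Fin.append_left, joinConnection,
      Fin.append_left]
    exact (vertexConnection_map θ (SimplexCategory.δ i) j).symm
  · rw [Function.comp_apply, joinMap_natAdd, joinConnection, Fin.append_right, joinConnection,
      Fin.append_right]
    exact (vertexConnection_map θ' (SimplexCategory.δ i) j).symm

-- An element of total degree at most `2N` has form degree at most `2N`, so functionals vanishing in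
-- these form degrees annihilate it. This makes the cochains finite.
omit [T2Space G] in
theorem exists_slant_famChernWeil (f : SymDual d G) :
    ∃ N, ∀ (m : ℕ) (B : GDiffAlg.{u} d G) (c : Fin (m + 1) → Connection B) (φ : Forms m →ₗ[ℝ] ℝ),
      (∀ k ≤ N, ∀ w ∈ formDeg m k, φ w = 0) →
      slant φ (Mixed.toTensor m B (famChernWeil c f)) = 0 := by
  obtain ⟨N, hN⟩ := exists_bound_famChernWeil (d := d) (G := G) f
  refine ⟨2 * N, fun m B c φ hφ => ?_⟩
  exact (iSup₂_le fun k hk x hx => Mixed.slant_of_mem φ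
    (fun j hj w hw => hφ j (by omega) w hw) hx : _ ≤ LinearMap.ker
      (slant φ ∘ₗ (Mixed.toTensor m B).toLinearMap)) (hN m B c)

/-- The cycle comparing the Chern-Weil forms of two pseudo-connections. -/
def joinCycle (θ θ' : PseudoConnection A) (f : invariantPolys d G) :
    AcyclicModel.BasicCycle A joinModel where
  w n := Mixed.toTensor _ _ (famChernWeil (joinConnection θ θ' n) f)
  closed n := congrArg (Mixed.toTensor _ _) (diff_famChernWeil (joinConnection θ θ' n) f.2)
  contr n X := congrArg (Mixed.toTensor _ _) (contr_famChernWeil (joinConnection θ θ' n) X f)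
  lie n X := by
    have h := lie_famChernWeil (joinConnection θ θ' n) X f.2
    rw [Mixed.lie_eq_map] at h
    exact congrArg (Mixed.toTensor _ _) h
  compat n i := congrArg (Mixed.toTensor _ _) (pullAlg_joinMap_famChernWeil θ θ' f.1 n i)
  bounded := by
    obtain ⟨N, hN⟩ := exists_slant_famChernWeil.{u} f.1
    exact ⟨N, fun n hn φ hφ => hN _ _ _ φ fun k hk w hw => hφ k (hk.trans_lt hn) w hw⟩

-- Restricting the family on the join to one factor recovers the vertex connections of `θ` or `θ'`,
-- hence the Chern–Weil form of that pseudo-connection.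
omit [T2Space G] in
theorem slant_joinDiff (θ θ' : PseudoConnection A) (f : SymDual d G) (n : ℕ) :
    slant (joinDiff n) (Mixed.toTensor _ _ (famChernWeil (joinConnection θ θ' n) f)) =
      integrate A (fatChernWeil θ' f) n - integrate A (fatChernWeil θ f) n := by
  have key : ∀ (φ : Fin (n + 1) →o Fin (n + 1 + n + 1)) (ζ : PseudoConnection A),
      joinConnection θ θ' n ∘ φ = vertexConnection ζ n →
      slant (integralAlong φ) (Mixed.toTensor _ _ (famChernWeil (joinConnection θ θ' n) f)) =
        integrate A (fatChernWeil ζ f) n := by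
    intro φ ζ hφ
    change _ = Mixed.integral n (lvl A n) (fatChernWeil ζ f n)
    rw [fatChernWeil_apply, ← hφ, ← pullAlg_famChernWeil, Mixed.slant_integralAlong]
  rw [joinDiff, sub_eq_add_neg, ← neg_one_smul ℝ (integralAlong (joinFront n)), slant_add,
    slant_smul, neg_one_smul, ← sub_eq_add_neg, key _ θ', key _ θ]
  · exact funext fun i => Fin.append_left (m := n + 1) (n := n + 1) _ _ i
  · exact funext fun i => Fin.append_right (m := n + 1) (n := n + 1) _ _ i

theorem exists_totalDiff_eq_sub (θ θ' : PseudoConnection A) (f : invariantPolys d G) :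
    ∃ c ∈ basicCochains A,
      totalDiff A c = integrate A (fatChernWeil θ' f) - integrate A (fatChernWeil θ f) := by
  obtain ⟨c, hc, h⟩ := (joinCycle θ θ' f).exists_totalDiff joinFunctional
  exact ⟨c, hc, funext fun n => (h n).trans (slant_joinDiff θ θ' f n)⟩

end GDiffSimplicialAlg

end ChernWeil
end

noncomputable section

namespace ChernWeil

open GDiffSimplicialAlg
open scoped Simplicial

/-! ### The Alexander-Whitney product -/

section AlexanderWhitney

open SimplexCategory (subinterval)

variable {R : Type*} [Ring R] [Algebra ℝ R]

/-- `U i` and `V i` stand for the front and back parts of the `i`-th face. The front part ignores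
faces beyond `r`, the back part is the same for all faces up to `r`, and the last term of the first
sum cancels the first term of the second. -/
theorem alexanderWhitney_sum (r K : ℕ) (U V : ℕ → R) (hU : ∀ i, r < i → U i = U (r + 1))
    (hV : ∀ i, i ≤ r → V i = V 0) :
    (∑ j ∈ Finset.range (r + 2), (-1 : ℝ) ^ j • U j) * V 0 +
        (-1 : ℝ) ^ r • (U (r + 1) * ∑ j ∈ Finset.range (K + 2), (-1 : ℝ) ^ j • V (r + j)) =
      ∑ i ∈ Finset.range (r + K + 2), (-1 : ℝ) ^ i • (U i * V i) := by
  have e : r + K + 2 = (r + 1) + (K + 1) := by omega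
  rw [e, Finset.sum_range_add _ (r + 1) (K + 1), Finset.sum_range_succ _ (r + 1),
    Finset.sum_range_succ' _ (K + 1), add_mul, Finset.sum_mul, mul_add, Finset.mul_sum, smul_add,
    Finset.smul_sum]
  have h1 : ∀ j ∈ Finset.range (r + 1), (-1 : ℝ) ^ j • U j * V 0 = (-1 : ℝ) ^ j • (U j * V j) :=
    fun j hj => by rw [hV j (by simpa [Nat.lt_succ_iff] using hj), smul_mul_assoc]
  have h2 : ∀ j ∈ Finset.range (K + 1), (-1 : ℝ) ^ r • (U (r + 1) *
      ((-1 : ℝ) ^ (j + 1) • V (r + (j + 1)))) =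
      (-1 : ℝ) ^ (r + 1 + j) • (U (r + 1 + j) * V (r + 1 + j)) := fun j _ => by
    rw [hU (r + 1 + j) (by omega), mul_smul_comm, smul_smul, ← pow_add,
      show r + (j + 1) = r + 1 + j by omega]
  rw [Finset.sum_congr rfl h1, Finset.sum_congr rfl h2, pow_zero, one_smul, add_zero,
    hV r le_rfl, smul_mul_assoc, pow_succ]
  module

variable {N M : ℕ}

/-- The simplicial boundary of a function on the simplices of `Δ_N`, in terms of its values on
faces. -/
def altFaces (u : ∀ p, (⦋p⦌ ⟶ ⦋N⦌) → R) : ∀ p, (⦋p⦌ ⟶ ⦋N⦌) → R := fun p => match p with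
  | 0 => fun _ => 0
  | p + 1 => fun φ => ∑ j : Fin (p + 2), (-1 : ℝ) ^ (j : ℕ) • u p (SimplexCategory.δ j ≫ φ)

omit [Ring R] [Algebra ℝ R] in
theorem apply_subinterval_congr (u : ∀ p, (⦋p⦌ ⟶ ⦋N⦌) → R) {j j' p p' : ℕ} (h : j + p ≤ N)
    (hj : j = j') (hp : p = p') :
    u p (subinterval j p h) = u p' (subinterval j' p' (by omega)) := by
  subst hj hp
  rfl

theorem subinterval_apply {n : ℕ} (j l : ℕ) (h : j + l ≤ n) (i : Fin (l + 1)) :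
    ((subinterval j l h).toOrderHom i : ℕ) = i + j := rfl

theorem hom_ext_val {p q : ℕ} {φ ψ : ⦋p⦌ ⟶ ⦋q⦌}
    (h : ∀ i : Fin (p + 1), (φ.toOrderHom i : ℕ) = ψ.toOrderHom i) : φ = ψ :=
  SimplexCategory.Hom.ext _ _ (OrderHom.ext _ _ (funext fun i => Fin.ext (h i)))

theorem δ_apply_val {n : ℕ} (i : Fin (n + 2)) (k : Fin (n + 1)) :
    ((SimplexCategory.δ i).toOrderHom k : ℕ) = if (k : ℕ) < i then (k : ℕ) else k + 1 := by
  change ((Fin.succAbove i k : Fin (n + 2)) : ℕ) = _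
  rw [Fin.succAbove]
  simp only [Fin.lt_def, Fin.val_castSucc]
  split_ifs <;> rfl

theorem comp_apply_val {p q r : ℕ} (φ : ⦋p⦌ ⟶ ⦋q⦌) (ψ : ⦋q⦌ ⟶ ⦋r⦌) (i : Fin (p + 1)) :
    ((φ ≫ ψ).toOrderHom i : ℕ) = ψ.toOrderHom (φ.toOrderHom i) := rfl

theorem δ_comp_subinterval {j l : ℕ} (h : j + l ≤ M) (h' : j + (l + 1) ≤ M + 1) (k : Fin (l + 2))
    (i : Fin (M + 2)) (hi : (i : ℕ) = j + k) :
    SimplexCategory.δ k ≫ subinterval j (l + 1) h' = subinterval j l h ≫ SimplexCategory.δ i := by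
  refine hom_ext_val fun x => ?_
  rw [comp_apply_val, comp_apply_val, δ_apply_val, subinterval_apply, δ_apply_val,
    subinterval_apply]
  split_ifs <;> omega

theorem subinterval_comp_δ_of_lt {j l : ℕ} (h : j + l ≤ M) (h' : j + l ≤ M + 1) (i : Fin (M + 2))
    (hi : j + l < i) : subinterval j l h ≫ SimplexCategory.δ i = subinterval j l h' := by
  refine hom_ext_val fun x => ?_
  have := x.2
  rw [comp_apply_val, δ_apply_val, subinterval_apply, subinterval_apply]
  split_ifs <;> omega

theorem subinterval_comp_δ_of_le {j l : ℕ} (h : j + l ≤ M) (h' : j + 1 + l ≤ M + 1)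
    (i : Fin (M + 2)) (hi : (i : ℕ) ≤ j) :
    subinterval j l h ≫ SimplexCategory.δ i = subinterval (j + 1) l h' := by
  refine hom_ext_val fun x => ?_
  have := x.2
  rw [comp_apply_val, δ_apply_val, subinterval_apply, subinterval_apply]
  split_ifs <;> omega

/-- The Alexander-Whitney product of functions on the simplices of `Δ_N`. -/
def awSum (u v : ∀ p, (⦋p⦌ ⟶ ⦋N⦌) → R) : R :=
  ∑ p : Fin (N + 1), u p (subinterval 0 p (by have := p.2; omega)) *
    v (N - p) (subinterval p (N - p) (by have := p.2; omega))

theorem awSum_altFaces_zero (u v : ∀ p, (⦋p⦌ ⟶ ⦋0⦌) → R) :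
    awSum (altFaces u) v + awSum (fun p φ => (-1 : ℝ) ^ p • u p φ) (altFaces v) = 0 := by
  simp [awSum, altFaces]

/-- The Leibniz rule for the Alexander–Whitney product. Stated for functions on the simplices of
`Δ_N`, it serves both for cochains (`faceSum_cup`) and for integrals of forms
(`cupIntegral_pairDiff_succ`). -/
theorem awSum_altFaces (u v : ∀ p, (⦋p⦌ ⟶ ⦋M + 1⦌) → R) :
    awSum (altFaces u) v + awSum (fun p φ => (-1 : ℝ) ^ p • u p φ) (altFaces v) =
      ∑ i : Fin (M + 2), (-1 : ℝ) ^ (i : ℕ) •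
        awSum (fun p φ => u p (φ ≫ SimplexCategory.δ i)) fun p φ => v p (φ ≫ SimplexCategory.δ i) := by
  have e1 : awSum (altFaces u) v = ∑ r : Fin (M + 1),
      (∑ j : Fin (r + 2), (-1 : ℝ) ^ (j : ℕ) •
        u r (SimplexCategory.δ j ≫ subinterval 0 (r + 1) (by have := r.2; omega))) *
        v (M - r) (subinterval (r + 1) (M - r) (by have := r.2; omega)) := by
    rw [awSum, Fin.sum_univ_succ]
    have h0 : altFaces u (0 : Fin (M + 1 + 1)) (subinterval 0 (0 : Fin (M + 1 + 1)) (by simp)) = 0 :=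
      rfl
    rw [h0, zero_mul, zero_add]
    refine Finset.sum_congr rfl fun r _ => ?_
    congr 1
    exact apply_subinterval_congr v _ (Fin.val_succ r) (by rw [Fin.val_succ]; omega)
  have e2 : awSum (fun p φ => (-1 : ℝ) ^ p • u p φ) (altFaces v) = ∑ r : Fin (M + 1),
      (-1 : ℝ) ^ (r : ℕ) • (u r (subinterval 0 r (by have := r.2; omega)) *
      ∑ j : Fin (M - r + 2), (-1 : ℝ) ^ (j : ℕ) •
        v (M - r) (SimplexCategory.δ j ≫ subinterval r (M - r + 1) (by have := r.2; omega))) := by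
    rw [awSum, Fin.sum_univ_castSucc]
    have h0 : altFaces v (M + 1 - (Fin.last (M + 1) : Fin (M + 2)))
        (subinterval (Fin.last (M + 1) : Fin (M + 2)) (M + 1 - (Fin.last (M + 1) : Fin (M + 2)))
          (by simp)) = 0 :=
      apply_subinterval_congr (altFaces v) _ rfl (p' := 0) (by simp)
    rw [h0, mul_zero, add_zero]
    refine Finset.sum_congr rfl fun r _ => ?_
    rw [smul_mul_assoc]
    congr 2
    exact apply_subinterval_congr (altFaces v) _ rfl (p' := M - r + 1)
      (by have := r.2; rw [Fin.val_castSucc]; omega)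
  rw [e1, e2, ← Finset.sum_add_distrib]
  simp_rw [awSum, Finset.smul_sum]
  rw [Finset.sum_comm]
  refine Finset.sum_congr rfl fun r _ => ?_
  obtain ⟨r, hr⟩ := r
  obtain ⟨K, rfl⟩ : ∃ K, M = r + K := ⟨M - r, by omega⟩
  -- Out of range, `U` takes the value it has beyond the front part, so that it is constant for all
  -- `i > r` as `alexanderWhitney_sum` demands; the out-of-range value of `V` is immaterial.
  let U : ℕ → R := fun i => if h : i < r + K + 2 then
    u r (subinterval 0 r (by omega) ≫ SimplexCategory.δ (⟨i, h⟩ : Fin (r + K + 2))) else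
    u r (subinterval 0 r (by omega))
  let V : ℕ → R := fun i => if h : i < r + K + 2 then
    v (r + K - r) (subinterval r (r + K - r) (by omega) ≫
      SimplexCategory.δ (⟨i, h⟩ : Fin (r + K + 2))) else 0
  have hU : ∀ i, r < i → U i = u r (subinterval 0 r (by omega)) := fun i hi => by
    simp only [U]
    split_ifs with h
    · rw [subinterval_comp_δ_of_lt (h' := by omega)]
      simpa using hi
    · rfl
  have hV : ∀ i, i ≤ r → V i = v (r + K - r) (subinterval (r + 1) (r + K - r) (by omega)) :=
    fun i hi => by
      simp only [V]
      rw [dif_pos (by omega), subinterval_comp_δ_of_le (h' := by omega)]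
      exact hi
  have key := alexanderWhitney_sum r (r + K - r) U V
    (fun i hi => (hU i hi).trans (hU _ (by omega)).symm)
    (fun i hi => (hV i hi).trans (hV _ (by omega)).symm)
  rw [show r + (r + K - r) = r + K by omega, Finset.sum_range, Finset.sum_range, Finset.sum_range,
    hU (r + 1) (by omega), hV 0 (by omega)] at key
  refine Eq.trans ?_ (key.trans ?_)
  · congr 2
    · refine Finset.sum_congr rfl fun j _ => ?_
      have hj := j.2
      congr 1
      simp only [U]
      rw [dif_pos (by omega)]
      exact congrArg (u r) (δ_comp_subinterval _ _ _ _ (by simp))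
    · congr 1
      refine Finset.sum_congr rfl fun j _ => ?_
      have hj : (j : ℕ) < r + K - r + 2 := j.2
      congr 1
      simp only [V]
      rw [dif_pos (by omega)]
      exact congrArg (v _) (δ_comp_subinterval _ _ _ _ (by simp))
  · refine Finset.sum_congr rfl fun j _ => ?_
    simp only [U, V]
    rw [dif_pos j.2, dif_pos j.2]

end AlexanderWhitney

end ChernWeil
end

noncomputable section

namespace ChernWeil

open GDiffSimplicialAlg
open scoped Simplicial

/-! ### The cup product -/

section

variable {d : ℕ} {G : Type v} [TopologicalSpace G] [ChartedSpace (EuclideanSpace ℝ (Fin d)) G]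
  [Group G]

namespace GDiffAlg

variable {B C : GDiffAlg.{u} d G} (f : B ⟶ C)

theorem homAlg_diff (a : B) : homAlg f (B.diff a) = C.diff (homAlg f a) := f.map_diff a

theorem homAlg_contr (X : LieAlg d G) (a : B) : homAlg f (B.contr X a) = C.contr X (homAlg f a) :=
  f.map_contr X a

theorem parity_homAlg (a : B) : parity C.deg (homAlg f a) = homAlg f (parity B.deg a) :=
  parity_of_even_map B.deg C.deg (f := (homAlg f).toLinearMap) (fun _ _ h => f.map_deg h) a

theorem homAlg_parity_pow (k : ℕ) (a : B) :
    homAlg f ((parity B.deg ^ k) a) = (parity C.deg ^ k) (homAlg f a) := by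
  induction k generalizing a with
  | zero => rfl
  | succ k ih =>
    rw [pow_succ, pow_succ, Module.End.mul_apply, Module.End.mul_apply, ih, parity_homAlg]

theorem parity_pow_diff (k : ℕ) (a : B) :
    (parity B.deg ^ k) (B.diff a) = (-1 : ℝ) ^ k • B.diff ((parity B.deg ^ k) a) := by
  induction k with
  | zero => simp
  | succ k ih =>
    rw [pow_succ', pow_succ', Module.End.mul_apply, Module.End.mul_apply, ih, map_smul, parity_diff,
      smul_neg, neg_one_mul, neg_smul]

theorem parity_pow_contr (X : LieAlg d G) (k : ℕ) (a : B) :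
    (parity B.deg ^ k) (B.contr X a) = (-1 : ℝ) ^ k • B.contr X ((parity B.deg ^ k) a) := by
  induction k with
  | zero => simp
  | succ k ih =>
    rw [pow_succ', pow_succ', Module.End.mul_apply, Module.End.mul_apply, ih, map_smul, parity_contr,
      smul_neg, neg_one_mul, neg_smul]

theorem parity_pow_add_two (k : ℕ) (a : B) :
    (parity B.deg ^ (k + 2)) a = (parity B.deg ^ k) a := by
  rw [pow_add, Module.End.mul_apply, pow_two, Module.End.mul_apply, parity_parity]

theorem homAlg_lie (X : LieAlg d G) (a : B) : homAlg f (B.lie X a) = C.lie X (homAlg f a) := by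
  change homAlg f (B.contr X (B.diff a) + B.diff (B.contr X a)) = 
    C.contr X (C.diff (homAlg f a)) + C.diff (C.contr X (homAlg f a))
  rw [map_add, homAlg_contr, homAlg_diff, homAlg_diff, homAlg_contr]

theorem mem_basic {a : B} : a ∈ B.basic ↔ ∀ X, B.lie X a = 0 ∧ B.contr X a = 0 := by
  rw [basic, Submodule.mem_iInf]
  rfl

theorem homAlg_mem_basic {a : B} (ha : a ∈ B.basic) : homAlg f a ∈ C.basic := by
  rw [mem_basic] at ha ⊢
  refine fun X => ⟨?_, ?_⟩
  · rw [← homAlg_lie, (ha X).1, map_zero]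
  · rw [← homAlg_contr, (ha X).2, map_zero]

theorem parity_mem_basic {a : B} (ha : a ∈ B.basic) : parity B.deg a ∈ B.basic := by
  rw [mem_basic] at ha ⊢
  refine fun X => ⟨?_, ?_⟩
  · rw [← parity_of_even_map B.deg B.deg (fun _ _ h => B.lie_mem X h) a, (ha X).1, map_zero]
  · rw [← neg_eq_zero, ← parity_contr, (ha X).2, map_zero]

theorem parity_pow_mem_basic (k : ℕ) {a : B} (ha : a ∈ B.basic) :
    (parity B.deg ^ k) a ∈ B.basic := by
  induction k with
  | zero => exact ha
  | succ k ih =>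
    rw [pow_succ', Module.End.mul_apply]
    exact parity_mem_basic ih

theorem mul_mem_basic {a b : B} (ha : a ∈ B.basic) (hb : b ∈ B.basic) : a * b ∈ B.basic := by
  rw [mem_basic] at ha hb ⊢
  refine fun X => ⟨?_, ?_⟩
  · rw [lie_mul, (ha X).1, (hb X).1, zero_mul, mul_zero, add_zero]
  · rw [contr_mul', (ha X).2, (hb X).2, zero_mul, mul_zero, add_zero]

end GDiffAlg

namespace GDiffSimplicialAlg

variable {A : GDiffSimplicialAlg.{u} d G}

/-- The values of a cochain on the faces of `Δ_N`. -/
def cochainFam (a : Cochain A) (N : ℕ) : ∀ p, (⦋p⦌ ⟶ ⦋N⦌) → lvl A N :=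
  fun p φ => GDiffAlg.homAlg (A.map φ) (a p)

/-- The cochain `(P^{k - p} a_p)_p`, with `P` the parity involution. -/
def twist (k : ℕ) (a : Cochain A) : Cochain A := fun p => (parity (lvl A p).deg ^ (k - p)) (a p)

theorem cup_apply (a b : Cochain A) (N : ℕ) :
    cup A a b N = awSum (cochainFam (twist N a) N) (cochainFam b N) := rfl

theorem homAlg_map_comp {l m n : ℕ} (φ : ⦋l⦌ ⟶ ⦋m⦌) (ψ : ⦋m⦌ ⟶ ⦋n⦌) (a : lvl A l) :
    GDiffAlg.homAlg (A.map (φ ≫ ψ)) a =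
      GDiffAlg.homAlg (A.map ψ) (GDiffAlg.homAlg (A.map φ) a) := by
  rw [A.map_comp]
  rfl

theorem faceSum_succ (n : ℕ) (c : Cochain A) : faceSum A (n + 1) c =
    ∑ i : Fin (n + 2), (-1 : ℝ) ^ (i : ℕ) •
      GDiffAlg.homAlg (A.map (SimplexCategory.δ i)) (c n) := by
  rw [faceSum, LinearMap.sum_apply]
  rfl

theorem altFaces_cochainFam (a : Cochain A) (N : ℕ) :
    altFaces (cochainFam a N) = cochainFam (fun p => faceSum A p a) N := by
  funext p φ
  cases p with
  | zero => exact (map_zero (GDiffAlg.homAlg (A.map φ))).symm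
  | succ p =>
    change _ = GDiffAlg.homAlg (A.map φ) (faceSum A (p + 1) a)
    rw [faceSum_succ, map_sum]
    refine Finset.sum_congr rfl fun i _ => ?_
    rw [map_smul]
    congr 1
    exact homAlg_map_comp _ _ _

theorem faceSum_parity_pow (k p : ℕ) (a a' : Cochain A)
    (h : ∀ q, p = q + 1 → a' q = (parity (lvl A q).deg ^ k) (a q)) :
    faceSum A p a' = (parity (lvl A p).deg ^ k) (faceSum A p a) := by
  cases p with
  | zero => exact (map_zero (parity (lvl A 0).deg ^ k)).symm
  | succ p =>
    rw [faceSum_succ, faceSum_succ, map_sum, h p rfl]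
    refine Finset.sum_congr rfl fun i _ => ?_
    rw [map_smul, GDiffAlg.homAlg_parity_pow]

/-- The parity involution for the total degree. -/
def totalParity (a : Cochain A) : Cochain A := fun p => (-1 : ℝ) ^ p • parity (lvl A p).deg (a p)

theorem awSum_congr {R : Type*} [Ring R] {N : ℕ} {u u' v v' : ∀ p, (⦋p⦌ ⟶ ⦋N⦌) → R}
    (h : ∀ p q (φ : ⦋p⦌ ⟶ ⦋N⦌) (ψ : ⦋q⦌ ⟶ ⦋N⦌), p + q = N → u p φ * v q ψ = u' p φ * v' q ψ) :
    awSum u v = awSum u' v' :=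
  Finset.sum_congr rfl fun p _ => h _ _ _ _ (by have := p.2; omega)

/-- This is `awSum_altFaces` with sign twists. In the first term the exponents agree; in the second
they differ by one, which the parity inside `totalParity` makes up for, the involution having square
one. -/
theorem faceSum_cup (a b : Cochain A) (N : ℕ) : faceSum A N (cup A a b) =
    cup A (fun p => faceSum A p a) b N + cup A (totalParity a) (fun p => faceSum A p b) N := by
  have key : faceSum A N (cup A a b) =
      awSum (altFaces (cochainFam (twist (N - 1) a) N)) (cochainFam b N) +
      awSum (fun p φ => (-1 : ℝ) ^ p • cochainFam (twist (N - 1) a) N p φ)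
        (altFaces (cochainFam b N)) := by
    cases N with
    | zero => exact (awSum_altFaces_zero _ _).symm
    | succ M =>
      rw [awSum_altFaces, faceSum_succ]
      refine Finset.sum_congr rfl fun i _ => ?_
      congr 1
      rw [cup_apply, awSum, map_sum]
      refine Finset.sum_congr rfl fun p _ => ?_
      rw [map_mul]
      simp only [cochainFam, homAlg_map_comp]
      rfl
  rw [key, cup_apply, cup_apply, altFaces_cochainFam, altFaces_cochainFam]
  congr 1
  · refine awSum_congr fun p q φ ψ hpq => ?_
    congr 1
    refine congrArg (GDiffAlg.homAlg (A.map φ)) (faceSum_parity_pow (N - p) p a _ fun r hr => ?_)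
    rw [twist, show N - 1 - r = N - p by omega]
  · refine awSum_congr fun p q φ ψ hpq => ?_
    -- For `q = 0` the truncated exponent `N - 1 - p` would be off, but the face sum of `b` vanishes
    -- at level `0`.
    cases q with
    | zero =>
      have : cochainFam (fun p => faceSum A p b) N 0 ψ = 0 :=
        map_zero (GDiffAlg.homAlg (A.map ψ))
      rw [this, mul_zero, mul_zero]
    | succ q =>
      congr 1
      simp only [cochainFam, twist, totalParity, map_smul]
      congr 2
      rw [show N - p = N - 1 - p + 1 by omega, ← Module.End.mul_apply, ← pow_succ,
        GDiffAlg.parity_pow_add_two]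

theorem totalDiff_apply (c : Cochain A) (n : ℕ) :
    totalDiff A c n = (-1 : ℝ) ^ n • (lvl A n).diff (c n) + faceSum A n c := rfl

theorem cup_add_left (a a' b : Cochain A) : cup A (a + a') b = cup A a b + cup A a' b := by
  funext N
  rw [Pi.add_apply, cup, cup, cup, ← Finset.sum_add_distrib]
  refine Finset.sum_congr rfl fun p _ => ?_
  rw [← add_mul, Pi.add_apply, map_add, map_add]

theorem cup_add_right (a b b' : Cochain A) : cup A a (b + b') = cup A a b + cup A a b' := by
  funext N
  rw [Pi.add_apply, cup, cup, cup, ← Finset.sum_add_distrib]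
  refine Finset.sum_congr rfl fun p _ => ?_
  rw [← mul_add, Pi.add_apply, map_add]

theorem cup_zero_left (b : Cochain A) : cup A 0 b = 0 := by
  simpa using cup_add_left 0 0 b

theorem cup_zero_right (a : Cochain A) : cup A a 0 = 0 := by
  simpa using cup_add_right a 0 0

theorem diff_cup (a b : Cochain A) (N : ℕ) : (-1 : ℝ) ^ N • (lvl A N).diff (cup A a b N) =
    cup A (fun p => (-1 : ℝ) ^ p • (lvl A p).diff (a p)) b N +
      cup A (totalParity a) (fun p => (-1 : ℝ) ^ p • (lvl A p).diff (b p)) N := by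
  rw [cup, cup, cup, map_sum, Finset.smul_sum, ← Finset.sum_add_distrib]
  refine Finset.sum_congr rfl fun p _ => ?_
  have hN : (-1 : ℝ) ^ N = (-1) ^ (p : ℕ) * (-1) ^ (N - p : ℕ) := by
    rw [← pow_add, Nat.add_sub_cancel' (Nat.lt_succ_iff.1 p.2)]
  have hs : (-1 : ℝ) ^ (N - p : ℕ) * (-1) ^ (N - p : ℕ) = 1 := by
    rw [← mul_pow]; norm_num
  rw [GDiffAlg.diff_mul', smul_add]
  congr 1
  · rw [map_smul, map_smul, GDiffAlg.parity_pow_diff, map_smul, GDiffAlg.homAlg_diff, smul_smul,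
      ← hN, smul_mul_assoc]
  · simp only [totalParity]
    rw [map_smul, map_smul, map_smul, GDiffAlg.homAlg_diff, smul_mul_smul_comm, ← hN,
      GDiffAlg.parity_homAlg, ← Module.End.mul_apply, ← Module.End.mul_apply, ← pow_succ, ← pow_succ']

/-- The internal and simplicial Leibniz rules carry the same sign `totalParity`, so they add up. It
follows that cup products of cocycles are cocycles and depend only on the classes, up to
coboundaries. -/
theorem totalDiff_cup (a b : Cochain A) : totalDiff A (cup A a b) =
    cup A (totalDiff A a) b + cup A (totalParity a) (totalDiff A b) := by
  funext N
  have ea : totalDiff A a = (fun p => (-1 : ℝ) ^ p • (lvl A p).diff (a p)) +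
    fun p => faceSum A p a := rfl
  have eb : totalDiff A b = (fun p => (-1 : ℝ) ^ p • (lvl A p).diff (b p)) +
    fun p => faceSum A p b := rfl
  rw [totalDiff_apply, diff_cup, faceSum_cup, ea, eb, cup_add_left, cup_add_right, Pi.add_apply,
    Pi.add_apply, Pi.add_apply]
  abel

theorem cup_mem_basicCochains {a b : Cochain A} (ha : a ∈ basicCochains A)
    (hb : b ∈ basicCochains A) : cup A a b ∈ basicCochains A := by
  refine ⟨fun N => Submodule.sum_mem _ fun p _ => GDiffAlg.mul_mem_basic
    (GDiffAlg.homAlg_mem_basic _ (GDiffAlg.parity_pow_mem_basic _ (ha.1 _)))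
    (GDiffAlg.homAlg_mem_basic _ (hb.1 _)), ?_⟩
  obtain ⟨K, hK⟩ := ha.2
  obtain ⟨L, hL⟩ := hb.2
  refine ⟨K + L, fun N hN => Finset.sum_eq_zero fun p _ => ?_⟩
  by_cases hp : K < p
  · rw [hK p hp, map_zero, map_zero, zero_mul]
  · rw [hL (N - p) (by omega), map_zero, mul_zero]

end GDiffSimplicialAlg

end

end ChernWeil
end

/-! ### Comparison of the wedge product of forms with the cup product of integrals. -/

noncomputable section

namespace ChernWeil

open GDiffSimplicialAlg
open scoped Simplicial

/-! ### The tensor square of the forms on simplices -/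

section PairModel

variable {m n : ℕ}

/-- The elements of total degree `k` of `Ω(Δ_n) ⊗ Ω(Δ_n)`. -/
def pairDeg (n k : ℕ) : Submodule ℝ (Forms n ⊗[ℝ] Forms n) :=
  Submodule.span ℝ {x | ∃ p q, p + q = k ∧ ∃ w ∈ formDeg n p, ∃ w' ∈ formDeg n q, x = w ⊗ₜ w'}

theorem tmul_mem_pairDeg {p q k : ℕ} (h : p + q = k) {w w' : Forms n} (hw : w ∈ formDeg n p)
    (hw' : w' ∈ formDeg n q) : w ⊗ₜ w' ∈ pairDeg n k :=
  Submodule.subset_span ⟨p, q, h, w, hw, w', hw', rfl⟩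

theorem pairDeg_le {V : Type*} [AddCommGroup V] [Module ℝ V] (f : Forms n ⊗[ℝ] Forms n →ₗ[ℝ] V)
    {k : ℕ} {U : Submodule ℝ V}
    (h : ∀ p q, p + q = k → ∀ w ∈ formDeg n p, ∀ w' ∈ formDeg n q, f (w ⊗ₜ w') ∈ U)
    {x : Forms n ⊗[ℝ] Forms n} (hx : x ∈ pairDeg n k) : f x ∈ U := by
  have : pairDeg n k ≤ U.comap f := Submodule.span_le.2 (by
    rintro _ ⟨p, q, hpq, w, hw, w', hw', rfl⟩
    exact h p q hpq w hw w' hw')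
  exact this hx

/-- The differential of `Ω(Δ_n) ⊗ Ω(Δ_n)`. -/
def pairDiff (n : ℕ) : Forms n ⊗[ℝ] Forms n →ₗ[ℝ] Forms n ⊗[ℝ] Forms n :=
  TensorProduct.map (dForm n) LinearMap.id + TensorProduct.map (parity (formDeg n)) (dForm n)

theorem pairDiff_tmul (w w' : Forms n) :
    pairDiff n (w ⊗ₜ w') = dForm n w ⊗ₜ w' + parity (formDeg n) w ⊗ₜ dForm n w' := rfl

/-- The parity involution of `Ω(Δ_n) ⊗ Ω(Δ_n)`. -/
def pairParity (n : ℕ) : Forms n ⊗[ℝ] Forms n →ₗ[ℝ] Forms n ⊗[ℝ] Forms n :=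
  TensorProduct.map (parity (formDeg n)) (parity (formDeg n))

theorem pairParity_tmul (w w' : Forms n) :
    pairParity n (w ⊗ₜ w') = parity (formDeg n) w ⊗ₜ parity (formDeg n) w' := rfl

/-- The projection to the constants `ℝ ⊆ Ω(Δ_n)`. -/
def augmentForm (n : ℕ) : Forms n →ₗ[ℝ] Forms n := (augment n).smulRight 1

/-- The contracting homotopy of `Ω(Δ_n) ⊗ Ω(Δ_n)`. -/
def pairPoincare (n : ℕ) : Forms n ⊗[ℝ] Forms n →ₗ[ℝ] Forms n ⊗[ℝ] Forms n :=
  TensorProduct.map (poincare n) LinearMap.id + TensorProduct.map (augmentForm n) (poincare n)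

theorem pairPoincare_tmul (w w' : Forms n) : pairPoincare n (w ⊗ₜ w') =
    poincare n w ⊗ₜ w' + (augment n w • (1 : Forms n)) ⊗ₜ poincare n w' := rfl

/-- The linear form `φ ⊗ ψ` on `Ω(Δ_n) ⊗ Ω(Δ_n)`. -/
def tensorForm (φ ψ : Forms n →ₗ[ℝ] ℝ) : Forms n ⊗[ℝ] Forms n →ₗ[ℝ] ℝ :=
  LinearMap.mul' ℝ ℝ ∘ₗ TensorProduct.map φ ψ

theorem tensorForm_tmul (φ ψ : Forms n →ₗ[ℝ] ℝ) (w w' : Forms n) :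
    tensorForm φ ψ (w ⊗ₜ w') = φ w * ψ w' := rfl

/-- The map induced on `Ω(Δ_n) ⊗ Ω(Δ_n)` by a map of simplices. -/
def pairPull (φ : Fin (m + 1) →o Fin (n + 1)) :
    Forms n ⊗[ℝ] Forms n →ₗ[ℝ] Forms m ⊗[ℝ] Forms m :=
  TensorProduct.map (pullForm φ).toLinearMap (pullForm φ).toLinearMap

theorem pairPull_tmul (φ : Fin (m + 1) →o Fin (n + 1)) (w w' : Forms n) :
    pairPull φ (w ⊗ₜ w') = pullForm φ w ⊗ₜ pullForm φ w' := rfl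

/-- With `e` the projection to constants, `h ⊗ 1` contracts the left factor and `e ⊗ h` then the
right one. The mixed terms cancel because `h` anticommutes with the parity, `e d = 0` and `d 1 = 0`.
-/
theorem pairDiff_pairPoincare (x : Forms n ⊗[ℝ] Forms n) :
    pairDiff n (pairPoincare n x) + pairPoincare n (pairDiff n x) =
      x - tensorForm (augment n) (augment n) x • ((1 : Forms n) ⊗ₜ[ℝ] (1 : Forms n)) := by
  induction x using TensorProduct.induction_on with
  | zero => simp
  | add x y hx hy =>
    simp only [map_add, add_smul]
    rw [add_sub_add_comm, ← hx, ← hy]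
    abel
  | tmul w w' =>
    have h1 : parity (formDeg n) 1 = 1 := parity_one _
    have h2 := eq_sub_of_add_eq' (dForm_poincare w)
    have h3 := eq_sub_of_add_eq' (dForm_poincare w')
    have h4 : poincare n (parity (formDeg n) w) = -parity (formDeg n) (poincare n w) := by
      rw [parity_poincare, neg_neg]
    simp only [pairPoincare_tmul, pairDiff_tmul, map_add, TensorProduct.smul_tmul', map_smul,
      tensorForm_tmul, h1, augment_dForm, augment_parity, h4, dForm_one, smul_zero, zero_smul,
      TensorProduct.zero_tmul, h2, h3, TensorProduct.sub_tmul, TensorProduct.tmul_sub,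
      TensorProduct.tmul_smul, TensorProduct.neg_tmul, mul_smul]
    rw [smul_comm (augment n w) (augment n w')]
    abel

theorem pairParity_pairPoincare (x : Forms n ⊗[ℝ] Forms n) :
    pairParity n (pairPoincare n x) = -pairPoincare n (pairParity n x) := by
  induction x using TensorProduct.induction_on with
  | zero => simp
  | add x y hx hy => simp only [map_add, hx, hy, neg_add]
  | tmul w w' =>
    have h1 : parity (formDeg n) 1 = 1 := parity_one _
    simp only [pairPoincare_tmul, pairParity_tmul, map_add, map_smul, h1, parity_poincare,
      augment_parity, TensorProduct.neg_tmul, TensorProduct.tmul_neg, neg_add]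

theorem pairPoincare_mem {k : ℕ} {x : Forms n ⊗[ℝ] Forms n} (hx : x ∈ pairDeg n (k + 1)) :
    pairPoincare n x ∈ pairDeg n k := by
  refine pairDeg_le _ (fun p q hpq w hw w' hw' => ?_) hx
  rw [pairPoincare_tmul]
  cases p with
  | zero =>
    obtain rfl : q = k + 1 := by omega
    rw [poincare_of_mem_zero hw, TensorProduct.zero_tmul, zero_add]
    exact tmul_mem_pairDeg (zero_add k) (Submodule.smul_mem _ _ (SetLike.one_mem_graded (formDeg n)))
      (poincare_mem hw')
  | succ p =>
    rw [augment_of_mem hw, zero_smul, TensorProduct.zero_tmul, add_zero]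
    exact tmul_mem_pairDeg (by omega) (poincare_mem hw) hw'

theorem pairPoincare_of_mem_zero {x : Forms n ⊗[ℝ] Forms n} (hx : x ∈ pairDeg n 0) :
    pairPoincare n x = 0 := by
  refine (Submodule.mem_bot ℝ).1 (pairDeg_le _ (fun p q hpq w hw w' hw' => ?_) hx)
  obtain rfl : p = 0 := by omega
  obtain rfl : q = 0 := by omega
  rw [pairPoincare_tmul, poincare_of_mem_zero hw, poincare_of_mem_zero hw']
  simp

theorem pairPull_mem (φ : Fin (m + 1) →o Fin (n + 1)) {k : ℕ} {x : Forms n ⊗[ℝ] Forms n}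
    (hx : x ∈ pairDeg n k) : pairPull φ x ∈ pairDeg m k :=
  pairDeg_le _ (fun _ _ hpq _ hw _ hw' =>
    tmul_mem_pairDeg hpq (pullForm_mem φ hw) (pullForm_mem φ hw')) hx

theorem pairPull_comp {l : ℕ} (ψ : Fin (m + 1) →o Fin (n + 1)) (φ : Fin (l + 1) →o Fin (m + 1)) :
    pairPull (ψ.comp φ) = pairPull φ ∘ₗ pairPull ψ :=
  TensorProduct.ext' fun w w' => by
    rw [pairPull_tmul, pullForm_comp, pullForm_comp, LinearMap.comp_apply, pairPull_tmul,
      pairPull_tmul]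

theorem pairPull_pairDiff (φ : Fin (m + 1) →o Fin (n + 1)) (x : Forms n ⊗[ℝ] Forms n) :
    pairPull φ (pairDiff n x) = pairDiff m (pairPull φ x) := by
  induction x using TensorProduct.induction_on with
  | zero => simp
  | add x y hx hy => simp only [map_add, hx, hy]
  | tmul w w' =>
    rw [pairDiff_tmul, map_add, pairPull_tmul, pairPull_tmul, pairPull_tmul, pairDiff_tmul,
      dForm_pullForm, dForm_pullForm, parity_pullForm]

theorem pairPull_pairParity (φ : Fin (m + 1) →o Fin (n + 1)) (x : Forms n ⊗[ℝ] Forms n) :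
    pairPull φ (pairParity n x) = pairParity m (pairPull φ x) := by
  induction x using TensorProduct.induction_on with
  | zero => simp
  | add x y hx hy => simp only [map_add, hx, hy]
  | tmul w w' =>
    rw [pairParity_tmul, pairPull_tmul, pairPull_tmul, pairParity_tmul, parity_pullForm,
      parity_pullForm]

theorem one_tmul_one_mem (n : ℕ) : (1 : Forms n) ⊗ₜ[ℝ] (1 : Forms n) ∈ pairDeg n 0 :=
  tmul_mem_pairDeg (p := 0) (q := 0) rfl (SetLike.one_mem_graded (formDeg n))
    (SetLike.one_mem_graded (formDeg n))

/-- The acyclic model `Ω(Δ_n) ⊗ Ω(Δ_n)`. -/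
def pairModel : AcyclicModel where
  V n := Forms n ⊗[ℝ] Forms n
  grp _ := inferInstance
  mod _ := inferInstance
  F := pairDeg
  pull := pairPull
  pull_comp := pairPull_comp
  pull_mem := pairPull_mem
  D := pairDiff
  P := pairParity
  h := pairPoincare
  u _ := 1 ⊗ₜ 1
  e n := tensorForm (augment n) (augment n)
  pull_D := pairPull_pairDiff
  pull_P := pairPull_pairParity
  homotopy _ := pairDiff_pairPoincare
  P_h _ := pairParity_pairPoincare
  h_mem _ _ _ := pairPoincare_mem
  h_zero _ _ := pairPoincare_of_mem_zero
  u_mem := one_tmul_one_mem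

/-! ### Comparison of the wedge and cup products -/

/-- The integral of the wedge product. -/
def wedgeIntegral (n : ℕ) : Forms n ⊗[ℝ] Forms n →ₗ[ℝ] ℝ :=
  integralForm n ∘ₗ LinearMap.mul' ℝ (Forms n)

theorem wedgeIntegral_tmul (w w' : Forms n) :
    wedgeIntegral n (w ⊗ₜ w') = integralForm n (w * w') := rfl

/-- The values of a form on faces. -/
def integralFam (w : Forms n) : ∀ p, (⦋p⦌ ⟶ ⦋n⦌) → ℝ := fun _ φ => integralAlong φ.toOrderHom w

/-- The cup product of the integrals. -/
def cupIntegral (n : ℕ) : Forms n ⊗[ℝ] Forms n →ₗ[ℝ] ℝ :=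
  ∑ p : Fin (n + 1), tensorForm
    (integralAlong (SimplexCategory.subinterval (n := n) 0 p (by have := p.2; omega)).toOrderHom)
    (integralAlong
      (SimplexCategory.subinterval (n := n) p (n - p) (by have := p.2; omega)).toOrderHom)

theorem cupIntegral_tmul (w w' : Forms n) :
    cupIntegral n (w ⊗ₜ w') = awSum (integralFam w) (integralFam w') := by
  rw [cupIntegral, LinearMap.sum_apply]
  rfl

theorem altFaces_integralFam (w : Forms n) :
    altFaces (integralFam w) = integralFam (dForm n w) := by
  funext p φ
  cases p with
  | zero => exact (integralAlong_dForm_zero _ w).symm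
  | succ p => exact (integralAlong_dForm φ.toOrderHom w).symm

theorem integralFam_parity (w : Forms n) :
    integralFam (parity (formDeg n) w) = fun p φ => (-1 : ℝ) ^ p • integralFam w p φ := by
  funext p φ
  exact integralAlong_parity _ w


/-- By Stokes' theorem, integrals of `dw` over simplices are alternating face sums of integrals of
`w`, which brings both terms into the shape of `awSum_altFaces`. -/
theorem cupIntegral_pairDiff (w w' : Forms n) : cupIntegral n (pairDiff n (w ⊗ₜ w')) =
    awSum (altFaces (integralFam w)) (integralFam w') +
      awSum (fun p φ => (-1 : ℝ) ^ p • integralFam w p φ) (altFaces (integralFam w')) := by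
  rw [pairDiff_tmul, map_add, cupIntegral_tmul, cupIntegral_tmul, altFaces_integralFam,
    altFaces_integralFam, integralFam_parity]

theorem cupIntegral_pairDiff_zero (x : Forms 0 ⊗[ℝ] Forms 0) : cupIntegral 0 (pairDiff 0 x) = 0 := by
  induction x using TensorProduct.induction_on with
  | zero => simp
  | add x y hx hy => rw [map_add, map_add, hx, hy, add_zero]
  | tmul w w' => rw [cupIntegral_pairDiff, awSum_altFaces_zero]

theorem cupIntegral_pairDiff_succ (x : Forms (n + 1) ⊗[ℝ] Forms (n + 1)) :
    cupIntegral (n + 1) (pairDiff (n + 1) x) =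
      cupIntegral n (∑ i : Fin (n + 2), (-1 : ℝ) ^ (i : ℕ) • pairPull (face i) x) := by
  rw [map_sum]
  induction x using TensorProduct.induction_on with
  | zero => simp
  | add x y hx hy => simp only [map_add, hx, hy, smul_add, Finset.sum_add_distrib]
  | tmul w w' =>
    rw [cupIntegral_pairDiff, awSum_altFaces]
    refine Finset.sum_congr rfl fun i _ => ?_
    rw [map_smul, pairPull_tmul, cupIntegral_tmul]
    congr 2
    · funext p φ
      exact (integralAlong_pullForm (face i) φ.toOrderHom w).symm
    · funext p φ
      exact (integralAlong_pullForm (face i) φ.toOrderHom w').symm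

/-- Multiplication of forms is a chain map, so Stokes' theorem can be applied to the product form.
-/
theorem wedgeIntegral_pairDiff (x : Forms n ⊗[ℝ] Forms n) :
    wedgeIntegral n (pairDiff n x) = integralForm n (dForm n (LinearMap.mul' ℝ (Forms n) x)) := by
  induction x using TensorProduct.induction_on with
  | zero => simp
  | add x y hx hy => simp only [map_add, hx, hy]
  | tmul w w' =>
    rw [pairDiff_tmul, map_add, wedgeIntegral_tmul, wedgeIntegral_tmul, LinearMap.mul'_apply,
      dForm_mul', map_add]

theorem wedgeIntegral_pairDiff_succ (x : Forms (n + 1) ⊗[ℝ] Forms (n + 1)) :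
    wedgeIntegral (n + 1) (pairDiff (n + 1) x) =
      wedgeIntegral n (∑ i : Fin (n + 2), (-1 : ℝ) ^ (i : ℕ) • pairPull (face i) x) := by
  rw [wedgeIntegral_pairDiff, integralForm_dForm, map_sum]
  refine Finset.sum_congr rfl fun i _ => ?_
  rw [map_smul, smul_eq_mul]
  congr 1
  induction x using TensorProduct.induction_on with
  | zero => simp
  | add x y hx hy => simp only [map_add, hx, hy]
  | tmul w w' => rw [pairPull_tmul, wedgeIntegral_tmul, LinearMap.mul'_apply, map_mul]

theorem integralForm_zero_one : integralForm 0 1 = 1 := by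
  have h1 : integralFn 0 1 = 1 := by
    rw [integralFn_eq (F := fun _ => 1) fun _ => rfl]
    have : Simplex 0 = Set.univ := Set.eq_univ_of_forall fun x => by
      rw [Subsingleton.elim x (vertexZero 0).1]
      exact (vertexZero 0).2
    rw [this, MeasureTheory.Measure.restrict_univ, MeasureTheory.volume_pi,
      MeasureTheory.Measure.pi_of_empty _ 0, MeasureTheory.integral_dirac]
  have h2 : topCoeff 0 1 = 1 := by
    have := topCoeff_ιMulti 0 Fin.elim0
    rw [ExteriorAlgebra.ιMulti_zero_apply] at this
    rw [this, Matrix.det_isEmpty]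
  exact (integralForm_fTmul 1 1).trans (by rw [h1, h2, one_mul])

theorem wedgeIntegral_pairParity (x : Forms n ⊗[ℝ] Forms n) :
    wedgeIntegral n (pairParity n x) = (-1) ^ n * wedgeIntegral n x := by
  induction x using TensorProduct.induction_on with
  | zero => simp
  | add x y hx hy => simp only [map_add, hx, hy, mul_add]
  | tmul w w' => rw [pairParity_tmul, wedgeIntegral_tmul, wedgeIntegral_tmul, ← parity_mul,
      integralForm_parity]

theorem cupIntegral_pairParity (x : Forms n ⊗[ℝ] Forms n) :
    cupIntegral n (pairParity n x) = (-1) ^ n * cupIntegral n x := by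
  induction x using TensorProduct.induction_on with
  | zero => simp
  | add x y hx hy => simp only [map_add, hx, hy, mul_add]
  | tmul w w' =>
    rw [pairParity_tmul, cupIntegral_tmul, cupIntegral_tmul, integralFam_parity, integralFam_parity,
      awSum, awSum, Finset.mul_sum]
    refine Finset.sum_congr rfl fun p _ => ?_
    rw [smul_mul_smul_comm, ← pow_add, Nat.add_sub_cancel' (Nat.lt_succ_iff.1 p.2), smul_eq_mul]

/-- The difference of the integral of the wedge product and the cup product of the integrals. -/
def pairFunctional : pairModel.Functional where
  T n := wedgeIntegral n - cupIntegral n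
  T_D_zero x := (congrArg₂ (· - ·) ((wedgeIntegral_pairDiff x).trans (integralForm_dForm_zero _))
    (cupIntegral_pairDiff_zero x)).trans (sub_zero _)
  T_D n x := (congrArg₂ (· - ·) (wedgeIntegral_pairDiff_succ x)
    (cupIntegral_pairDiff_succ x)).trans
      (congrArg (wedgeIntegral n - cupIntegral n) (pairModel.bdry_apply n x).symm)
  T_u := by
    change wedgeIntegral 0 (1 ⊗ₜ 1) - cupIntegral 0 (1 ⊗ₜ 1) = 0
    have h : ∀ φ : ⦋0⦌ ⟶ ⦋0⦌, integralFam (1 : Forms 0) 0 φ = 1 := fun φ =>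
      (congrArg (integralForm 0) (map_one (pullForm φ.toOrderHom))).trans integralForm_zero_one
    rw [wedgeIntegral_tmul, mul_one, integralForm_zero_one, cupIntegral_tmul, awSum]
    simp [h]
  T_P n x := (congrArg₂ (· - ·) (wedgeIntegral_pairParity x)
    (cupIntegral_pairParity x)).trans (mul_sub _ _ _).symm
  T_low n k hk x hx := (Submodule.mem_bot ℝ).1 (pairDeg_le (wedgeIntegral n - cupIntegral n)
    (fun p q hpq w hw w' hw' => by
      rw [Submodule.mem_bot, LinearMap.sub_apply, wedgeIntegral_tmul,
        integralForm_of_mem (by omega) (SetLike.mul_mem_graded hw hw'), zero_sub, neg_eq_zero,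
        cupIntegral_tmul]
      refine Finset.sum_eq_zero fun r _ => ?_
      -- As `p + q < n`, the degrees cannot equal `r` and `n - r` at once, so one of the two
      -- integrals vanishes.
      by_cases hr : p = r
      · have hq : q ≠ n - r := by omega
        exact mul_eq_zero_of_right _ (integralAlong_of_mem _ hq hw')
      · exact mul_eq_zero_of_left (integralAlong_of_mem _ hr hw) _) hx)

end PairModel

end ChernWeil
end

/-! ### The external product of two forms with values in `B`. -/

noncomputable section

namespace ChernWeil

open GDiffSimplicialAlg
open scoped Simplicial

/-! ### The external product -/

variable {d : ℕ} {G : Type v} [TopologicalSpace G] [ChartedSpace (EuclideanSpace ℝ (Fin d)) G]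
  [Group G]

namespace GDiffAlg

variable (B : GDiffAlg.{u} d G)

theorem parity_pow_of_even {q : ℕ} (hq : Even q) (a : B) : (parity B.deg ^ q) a = a := by
  obtain ⟨r, rfl⟩ := hq
  have h : parity B.deg ^ 2 = 1 := LinearMap.ext fun a => by
    rw [pow_two, Module.End.mul_apply, parity_parity, Module.End.one_apply]
  rw [← two_mul, pow_mul, h, one_pow, Module.End.one_apply]

theorem parity_pow_of_odd {q : ℕ} (hq : Odd q) (a : B) :
    (parity B.deg ^ q) a = parity B.deg a := by
  obtain ⟨r, rfl⟩ := hq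
  rw [pow_succ, Module.End.mul_apply, B.parity_pow_of_even (even_two_mul r)]

theorem parity_pow_of_mem (k : ℕ) {q : ℕ} {a : B} (ha : a ∈ B.deg q) :
    (parity B.deg ^ k) a = (-1 : ℝ) ^ (q * k) • a := by
  induction k with
  | zero => simp
  | succ k ih =>
    rw [pow_succ', Module.End.mul_apply, ih, map_smul, parity_of_mem _ ha, smul_smul, ← pow_add,
      Nat.mul_succ]

theorem parity_pow_lie (X : LieAlg d G) (k : ℕ) (a : B) :
    (parity B.deg ^ k) (B.lie X a) = B.lie X ((parity B.deg ^ k) a) := by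
  induction k with
  | zero => rfl
  | succ k ih =>
    rw [pow_succ', Module.End.mul_apply, Module.End.mul_apply, ih,
      parity_of_even_map B.deg B.deg fun _ _ h => B.lie_mem X h]

end GDiffAlg

namespace Mixed

variable {m n : ℕ} {B C : GDiffAlg.{u} d G}

/-- The bilinear map `(ω ⊗ a, ω' ⊗ a') ↦ (ω ⊗ ω') ⊗ a a'`. -/
def tensorMul (m : ℕ) (B : GDiffAlg.{u} d G) :
    Mixed m B →ₗ[ℝ] Mixed m B →ₗ[ℝ] (Forms m ⊗[ℝ] Forms m) ⊗[ℝ] B :=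
  (TensorProduct.map₂ (TensorProduct.mk ℝ (Forms m) (Forms m)) (LinearMap.mul ℝ B)).compl₁₂
    (toTensor m B).toLinearMap (toTensor m B).toLinearMap

/-- The external product `(ω ⊗ a) ⊙ (ω' ⊗ a') = (-1)^{|a||ω'|} (ω ⊗ ω') ⊗ a a'`. -/
def extMul (m : ℕ) (B : GDiffAlg.{u} d G) :
    Mixed m B →ₗ[ℝ] Mixed m B →ₗ[ℝ] (Forms m ⊗[ℝ] Forms m) ⊗[ℝ] B :=
  -- Half the sum and half the difference with the parity of `ω'` project to its even and odd parts;
  -- on the odd part `a` is replaced by its parity. This makes the Koszul sign bilinear without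
  -- decomposing into degrees.
  (1 / 2 : ℝ) • (tensorMul m B + (tensorMul m B).compl₂ (map (parity (formDeg m)) LinearMap.id) +
    tensorMul m B ∘ₗ map LinearMap.id (parity B.deg) +
    (-1 : ℝ) • (tensorMul m B ∘ₗ map LinearMap.id (parity B.deg)).compl₂
      (map (parity (formDeg m)) LinearMap.id))

theorem extMul_mk {q : ℕ} (w : Forms m) {w' : Forms m} (a a' : B) (hw : w' ∈ formDeg m q) :
    extMul m B (mk m B w a) (mk m B w' a') =
      (w ⊗ₜ[ℝ] w') ⊗ₜ[ℝ] ((parity B.deg ^ q) a * a') := by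
  have h : extMul m B (mk m B w a) (mk m B w' a') = (1 / 2 : ℝ) •
      ((w ⊗ₜ[ℝ] w') ⊗ₜ[ℝ] (a * a') + (w ⊗ₜ[ℝ] parity (formDeg m) w') ⊗ₜ[ℝ] (a * a') +
      (w ⊗ₜ[ℝ] w') ⊗ₜ[ℝ] (parity B.deg a * a') +
      (-1 : ℝ) • (w ⊗ₜ[ℝ] parity (formDeg m) w') ⊗ₜ[ℝ] (parity B.deg a * a')) := rfl
  rw [h, parity_of_mem _ hw, TensorProduct.tmul_smul, ← TensorProduct.smul_tmul',
    ← TensorProduct.smul_tmul']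
  rcases Nat.even_or_odd q with hq | hq
  · rw [B.parity_pow_of_even hq, hq.neg_one_pow]
    module
  · rw [B.parity_pow_of_odd hq, Odd.neg_one_pow (α := ℝ) hq]
    module

@[elab_as_elim]
theorem extMul_induction {P : Mixed m B → Mixed m B → Prop} (h0 : ∀ y, P 0 y) (h0' : ∀ x, P x 0)
    (hadd : ∀ x x' y, P x y → P x' y → P (x + x') y)
    (hadd' : ∀ x y y', P x y → P x y' → P x (y + y'))
    (h : ∀ p, ∀ w ∈ formDeg m p, ∀ a, ∀ p', ∀ w' ∈ formDeg m p', ∀ a',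
      P (mk m B w a) (mk m B w' a')) (x y : Mixed m B) : P x y :=
  hom_induction (P := fun x => P x y) (h0 y) (fun x x' => hadd x x' y)
    (fun p _ w hw a _ => hom_induction (P := fun y => P (mk m B w a) y) (h0' _)
      (fun y y' => hadd' _ y y') (fun p' _ w' hw' a' _ => h p w hw a p' w' hw' a') y) x

/-- A Leibniz rule across the external product, by which products of closed elements are closed. The
identities after it play the same role for the other conditions of a `BasicCycle`. -/
theorem map_pairDiff_extMul (x y : Mixed m B) :
    TensorProduct.map (pairDiff m) LinearMap.id (extMul m B x y) +
        TensorProduct.map (pairParity m) B.diff (extMul m B x y) =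
      extMul m B (diff m B x) y + extMul m B (par m B x) (diff m B y) := by
  refine extMul_induction ?_ ?_ ?_ ?_ ?_ x y
  · intro y; simp
  · intro x; simp
  · intro x x' y hx hx'
    simp only [map_add, LinearMap.add_apply]
    rw [add_add_add_comm, hx, hx', add_add_add_comm]
  · intro x y y' hy hy'
    simp only [map_add]
    rw [add_add_add_comm, hy, hy', add_add_add_comm]
  · intro p w hw a p' w' hw' a'
    rw [extMul_mk w a a' hw', diff_mk hw, diff_mk hw', par, map_mk, map_add, map_add,
      LinearMap.add_apply, map_smul, map_smul, LinearMap.smul_apply, extMul_mk _ _ _ hw',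
      extMul_mk _ _ _ hw', extMul_mk _ _ _ (dForm_mem hw'), extMul_mk _ _ _ hw']
    simp only [TensorProduct.map_tmul, pairDiff_tmul, pairParity_tmul, LinearMap.id_apply]
    rw [B.diff_mul', GDiffAlg.parity_pow_diff, parity_of_mem _ hw, parity_of_mem _ hw', pow_succ,
      Module.End.mul_apply, parity_parity]
    have e : parity B.deg ((parity B.deg ^ p') a) = (parity B.deg ^ p') (parity B.deg a) := by
      rw [← Module.End.mul_apply, ← Module.End.mul_apply, ← pow_succ', ← pow_succ]
    rw [e]
    simp only [TensorProduct.add_tmul, TensorProduct.tmul_add, TensorProduct.tmul_smul,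
      ← TensorProduct.smul_tmul', smul_mul_assoc]
    module

theorem map_pairParity_extMul (X : LieAlg d G) (x y : Mixed m B) :
    TensorProduct.map (pairParity m) (B.contr X) (extMul m B x y) =
      extMul m B (contr m B X x) y + extMul m B (par m B x) (contr m B X y) := by
  refine extMul_induction ?_ ?_ ?_ ?_ ?_ x y
  · intro y; simp
  · intro x; simp
  · intro x x' y hx hx'
    simp only [map_add, LinearMap.add_apply]
    rw [hx, hx', add_add_add_comm]
  · intro x y y' hy hy'
    simp only [map_add]
    rw [hy, hy', add_add_add_comm]
  · intro p w hw a p' w' hw' a'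
    rw [extMul_mk w a a' hw', contr_mk X hw, contr_mk X hw', par, map_mk,
      map_smul, map_smul, LinearMap.smul_apply, extMul_mk _ _ _ hw', extMul_mk _ _ _ hw']
    simp only [TensorProduct.map_tmul, pairParity_tmul]
    rw [B.contr_mul', GDiffAlg.parity_pow_contr, parity_of_mem _ hw, parity_of_mem _ hw']
    have e : parity B.deg ((parity B.deg ^ p') a) = (parity B.deg ^ p') (parity B.deg a) := by
      rw [← Module.End.mul_apply, ← Module.End.mul_apply, ← pow_succ', ← pow_succ]
    rw [e]
    simp only [TensorProduct.tmul_add, TensorProduct.tmul_smul, ← TensorProduct.smul_tmul',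
      smul_mul_assoc]
    module

theorem map_lie_extMul (X : LieAlg d G) (x y : Mixed m B) :
    TensorProduct.map LinearMap.id (B.lie X) (extMul m B x y) =
      extMul m B (lie m B X x) y + extMul m B x (lie m B X y) := by
  rw [lie_eq_map]
  refine extMul_induction ?_ ?_ ?_ ?_ ?_ x y
  · intro y; simp
  · intro x; simp
  · intro x x' y hx hx'
    simp only [map_add, LinearMap.add_apply]
    rw [hx, hx', add_add_add_comm]
  · intro x y y' hy hy'
    simp only [map_add]
    rw [hy, hy', add_add_add_comm]
  · intro p w hw a p' w' hw' a'
    rw [extMul_mk w a a' hw', map_mk, map_mk, extMul_mk _ _ _ hw', LinearMap.id_apply,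
      LinearMap.id_apply, extMul_mk _ _ _ hw', B.parity_pow_lie, TensorProduct.map_tmul, B.lie_mul,
      TensorProduct.tmul_add]
    rfl

theorem map_pairPull_extMul (φ : Fin (m + 1) →o Fin (n + 1)) (x y : Mixed n B) :
    TensorProduct.map (pairPull φ) LinearMap.id (extMul n B x y) =
      extMul m B (pullAlg φ B x) (pullAlg φ B y) := by
  refine extMul_induction ?_ ?_ ?_ ?_ ?_ x y
  · intro y; simp
  · intro x; simp
  · intro x x' y hx hx'
    simp only [map_add, LinearMap.add_apply, hx, hx']
  · intro x y y' hy hy'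
    simp only [map_add, hy, hy']
  · intro p w hw a p' w' hw' a'
    rw [extMul_mk w a a' hw', pullAlg_mk, pullAlg_mk, extMul_mk _ _ _ (pullForm_mem φ hw')]
    rfl

theorem map_homAlg_extMul (f : B ⟶ C) (x y : Mixed m B) :
    TensorProduct.map LinearMap.id (GDiffAlg.homAlg f).toLinearMap (extMul m B x y) =
      extMul m C (pushAlg m f x) (pushAlg m f y) := by
  refine extMul_induction ?_ ?_ ?_ ?_ ?_ x y
  · intro y; simp
  · intro x; simp
  · intro x x' y hx hx'
    simp only [map_add, LinearMap.add_apply, hx, hx']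
  · intro x y y' hy hy'
    simp only [map_add, hy, hy']
  · intro p w hw a p' w' hw' a'
    rw [extMul_mk w a a' hw', pushAlg_mk, pushAlg_mk, extMul_mk _ _ _ hw',
      ← GDiffAlg.homAlg_parity_pow, ← map_mul]
    rfl

theorem slant_wedgeIntegral_extMul (x y : Mixed m B) :
    slant (wedgeIntegral m) (extMul m B x y) = integral m B (x * y) := by
  refine extMul_induction ?_ ?_ ?_ ?_ ?_ x y
  · intro y; simp
  · intro x; simp
  · intro x x' y hx hx'
    simp only [map_add, LinearMap.add_apply, hx, hx', add_mul]
  · intro x y y' hy hy'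
    simp only [map_add, hy, hy', mul_add]
  · intro p w hw a p' w' hw' a'
    refine graded_induction B.deg ?_ ?_ ?_ a
    · simp
    · intro a b ha hb
      simp only [map_add, LinearMap.add_apply, ha, hb, add_mul]
    · intro q a ha
      rw [extMul_mk w a a' hw', mk_mul_mk w a' ha hw', slant_tmul, integral_eq_slant, map_smul,
        map_smul, toTensor_mk, slant_tmul, wedgeIntegral_tmul]
      rw [B.parity_pow_of_mem p' ha, smul_mul_assoc, smul_comm]

/-- `ψ` sees only forms of degree `k`, for which the Koszul sign is the `k`-th power of the parity
of `a`. This is the sign in the definition of `cup`. -/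
theorem slant_tensorForm_extMul {k : ℕ} (φ ψ : Forms m →ₗ[ℝ] ℝ)
    (hψ : ∀ p ≠ k, ∀ w ∈ formDeg m p, ψ w = 0) (x y : Mixed m B) :
    slant (tensorForm φ ψ) (extMul m B x y) =
      (parity B.deg ^ k) (slant φ (toTensor m B x)) * slant ψ (toTensor m B y) := by
  refine extMul_induction ?_ ?_ ?_ ?_ ?_ x y
  · intro y; simp
  · intro x; simp
  · intro x x' y hx hx'
    simp only [map_add, LinearMap.add_apply, hx, hx', add_mul]
  · intro x y y' hy hy'
    simp only [map_add, hy, hy', mul_add]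
  · intro p w hw a p' w' hw' a'
    rw [extMul_mk w a a' hw', toTensor_mk, toTensor_mk, slant_tmul, slant_tmul, slant_tmul,
      tensorForm_tmul]
    by_cases h : p' = k
    · rw [h, map_smul, smul_mul_smul_comm]
    · rw [hψ p' h w' hw', mul_zero, zero_smul, zero_smul, mul_zero]

theorem slant_extMul_eq_zero {M N : ℕ} (φ : Forms m ⊗[ℝ] Forms m →ₗ[ℝ] ℝ)
    (hφ : ∀ k ≤ M + N, ∀ v ∈ pairDeg m k, φ v = 0) {x y : Mixed m B}
    (hx : x ∈ totalDeg m B M) (hy : y ∈ totalDeg m B N) : slant φ (extMul m B x y) = 0 := by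
  induction hx using Submodule.span_induction with
  | zero => simp
  | add a b _ _ ha hb => rw [map_add, LinearMap.add_apply, map_add, ha, hb, add_zero]
  | smul s a _ ha => rw [map_smul, LinearMap.smul_apply, map_smul, ha, smul_zero]
  | mem x hx =>
    obtain ⟨p, q, hpq, w, hw, a, ha, rfl⟩ := hx
    induction hy using Submodule.span_induction with
    | zero => simp
    | add b c _ _ hb hc => rw [map_add, map_add, hb, hc, add_zero]
    | smul s b _ hb => rw [map_smul, map_smul, hb, smul_zero]
    | mem y hy =>
      obtain ⟨p', q', hpq', w', hw', a', ha', rfl⟩ := hy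
      rw [← mk_apply, ← mk_apply, extMul_mk w a a' hw', slant_tmul,
        hφ (p + p') (by omega) _ (tmul_mem_pairDeg rfl hw hw'), zero_smul]

end Mixed

end ChernWeil
end

/-! ### The Chern–Weil cocycle, its degree and its cup products. -/

noncomputable section

namespace ChernWeil

open GDiffSimplicialAlg
open scoped Simplicial

/-! ### Multiplicativity -/

variable {d : ℕ} {G : Type v} [TopologicalSpace G] [ChartedSpace (EuclideanSpace ℝ (Fin d)) G]
  [Group G]

namespace Mixed

variable {m n : ℕ} {B C : GDiffAlg.{u} d G}

theorem integral_pushAlg (f : B ⟶ C) (x : Mixed m B) :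
    integral m C (pushAlg m f x) = GDiffAlg.homAlg f (integral m B x) :=
  slant_map (integralForm m) LinearMap.id (GDiffAlg.homAlg f).toLinearMap _

theorem integral_mk (w : Forms m) (a : B) : integral m B (mk m B w a) = integralForm m w • a := by
  rw [integral_eq_slant, toTensor_mk, slant_tmul]

theorem integral_mem {N : ℕ} {x : Mixed m B} (hx : x ∈ totalDeg m B N) :
    (m ≤ N → integral m B x ∈ B.deg (N - m)) ∧ (N < m → integral m B x = 0) := by
  refine ⟨fun h => ?_, fun h => ?_⟩
  · have : totalDeg m B N ≤ (B.deg (N - m)).comap (integral m B) := Submodule.span_le.2 (by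
      rintro _ ⟨p, q, hpq, w, hw, a, ha, rfl⟩
      change integral m B (mk m B w a) ∈ B.deg (N - m)
      rw [integral_mk]
      by_cases hp : p = m
      · obtain rfl : q = N - m := by omega
        exact Submodule.smul_mem _ _ ha
      · rw [integralForm_of_mem hp hw, zero_smul]
        exact Submodule.zero_mem _)
    exact this hx
  · rw [integral_eq_slant]
    exact slant_of_mem _ (fun k hk w hw => integralForm_of_mem (by omega) hw) hx

/-- Integration sees only forms of degree `m`, where the parity is `(-1)^m`; this is the origin of
the sign in `totalDiff`. -/
theorem integral_map_parity (g : B →ₗ[ℝ] C) (x : Mixed m B) :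
    integral m C (map (parity (formDeg m)) g x) = (-1 : ℝ) ^ m • g (integral m B x) := by
  have e : integralForm m ∘ₗ parity (formDeg m) = (-1 : ℝ) ^ m • integralForm m :=
    LinearMap.ext fun w => integralForm_parity w
  refine (slant_map (integralForm m) (parity (formDeg m)) g (toTensor m B x)).trans ?_
  rw [e, slant_smul, map_smul, integral_eq_slant]

theorem integral_lie [LieGroup (𝓡 d) ∞ G] [T2Space G] (X : LieAlg d G) (x : Mixed m B) :
    integral m B (lie m B X x) = B.lie X (integral m B x) := by
  rw [lie_eq_map]
  exact slant_map (integralForm m) LinearMap.id (B.lie X) _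

theorem integral_diff (x : Mixed m B) : integral m B (diff m B x) =
    slant (integralForm m ∘ₗ dForm m) (toTensor m B x) +
      (-1 : ℝ) ^ m • B.diff (integral m B x) := by
  rw [diff, LinearMap.add_apply, map_add, integral_map_parity]
  congr 1
  exact slant_map (integralForm m) (dForm m) LinearMap.id (toTensor m B x)

theorem slant_stokes (x : Mixed (m + 1) B) :
    slant (integralForm (m + 1) ∘ₗ dForm (m + 1)) (toTensor (m + 1) B x) =
      ∑ i : Fin (m + 2), (-1 : ℝ) ^ (i : ℕ) • integral m B (pullAlg (face i) B x) := by
  have e : integralForm (m + 1) ∘ₗ dForm (m + 1) =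
      ∑ i : Fin (m + 2), (-1 : ℝ) ^ (i : ℕ) • integralAlong (face i) := by
    refine LinearMap.ext fun w => ?_
    rw [LinearMap.sum_apply, LinearMap.comp_apply, integralForm_dForm]
    rfl
  rw [e, slant_sum]
  refine Finset.sum_congr rfl fun i _ => ?_
  rw [slant_smul, slant_integralAlong]

theorem slant_stokes_zero (x : Mixed 0 B) :
    slant (integralForm 0 ∘ₗ dForm 0) (toTensor 0 B x) = 0 := by
  have e : integralForm 0 ∘ₗ dForm 0 = (0 : ℝ) • integralForm 0 := by
    refine LinearMap.ext fun w => ?_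
    rw [zero_smul]
    exact integralForm_dForm_zero w
  rw [e, slant_smul, zero_smul]

theorem integral_one_zero : integral 0 B 1 = 1 := by
  rw [one_eq, integral_mk, integralForm_zero_one, one_smul]

theorem integral_one_succ : integral (m + 1) B 1 = 0 := by
  rw [one_eq, integral_mk, integralForm_of_mem (Nat.succ_ne_zero m).symm
    (SetLike.one_mem_graded (formDeg (m + 1))), zero_smul]

end Mixed

namespace GDiffSimplicialAlg

variable [LieGroup (𝓡 d) ∞ G] [T2Space G] {A : GDiffSimplicialAlg.{u} d G}

omit [T2Space G] in
theorem pullAlg_fatChernWeil (θ : PseudoConnection A) (f : SymDual d G) {m n : ℕ} (φ : ⦋m⦌ ⟶ ⦋n⦌) :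
    Mixed.pullAlg φ.toOrderHom (lvl A n) (fatChernWeil θ f n) =
      Mixed.pushAlg m (A.map φ) (fatChernWeil θ f m) := by
  rw [fatChernWeil_apply, fatChernWeil_apply, pullAlg_famChernWeil, pushAlg_famChernWeil]
  congr 2
  exact funext fun i => (vertexConnection_map θ φ i).symm

omit [T2Space G] in
theorem integral_pullAlg_fatChernWeil (θ : PseudoConnection A) (f : SymDual d G) {m n : ℕ}
    (φ : ⦋m⦌ ⟶ ⦋n⦌) :
    Mixed.integral m (lvl A n) (Mixed.pullAlg φ.toOrderHom (lvl A n) (fatChernWeil θ f n)) =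
      GDiffAlg.homAlg (A.map φ) (integrate A (fatChernWeil θ f) m) := by
  rw [pullAlg_fatChernWeil, Mixed.integral_pushAlg]
  rfl

theorem diff_fatChernWeil (θ : PseudoConnection A) (f : invariantPolys d G) (n : ℕ) :
    Mixed.diff n (lvl A n) (fatChernWeil θ f n) = 0 := by
  rw [fatChernWeil_apply, diff_famChernWeil _ f.2]

theorem contr_fatChernWeil (θ : PseudoConnection A) (f : SymDual d G) (X : LieAlg d G) (n : ℕ) :
    Mixed.contr n (lvl A n) X (fatChernWeil θ f n) = 0 := by
  rw [fatChernWeil_apply, contr_famChernWeil]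

theorem lie_fatChernWeil (θ : PseudoConnection A) (f : invariantPolys d G) (X : LieAlg d G)
    (n : ℕ) : Mixed.lie n (lvl A n) X (fatChernWeil θ f n) = 0 := by
  rw [fatChernWeil_apply, lie_famChernWeil _ _ f.2]

theorem fatChernWeil_mem_fatBasic (θ : PseudoConnection A) (f : invariantPolys d G) :
    fatChernWeil θ f ∈ fatBasic A := by
  refine ⟨⟨?_, fun n i => ?_, fun n i => ?_⟩, ?_⟩
  · obtain ⟨N, hN⟩ := exists_bound_famChernWeil.{u} (f : SymDual d G)
    refine ⟨2 * N, fun n => ?_⟩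
    rw [fatChernWeil_apply]
    exact (iSup₂_le fun k hk => le_iSup₂_of_le (2 * k) (by omega) le_rfl :
      (⨆ k ≤ N, Mixed.totalDeg n (lvl A n) (2 * k)) ≤ _) (hN n _ _)
  · exact pullAlg_fatChernWeil θ f (SimplexCategory.δ i)
  · exact pullAlg_fatChernWeil θ f (SimplexCategory.σ i)
  · rw [SetLike.mem_coe, Submodule.mem_iInf]
    intro X
    rw [Submodule.mem_iInf]
    exact fun n => ⟨lie_fatChernWeil θ f X n, contr_fatChernWeil θ f X n⟩

/-- The cochain `z_θ(f)`. -/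
def chernWeilCochain (θ : PseudoConnection A) : SymDual d G →ₗ[ℝ] Cochain A :=
  integrate A ∘ₗ (fatChernWeil θ).toLinearMap

omit [T2Space G] in
theorem chernWeilCochain_apply (θ : PseudoConnection A) (f : SymDual d G) (n : ℕ) :
    chernWeilCochain θ f n = Mixed.integral n (lvl A n) (fatChernWeil θ f n) := rfl

/-- Integrate `d f(Ω_n) = 0`. By Stokes' theorem and compatibility with faces, the form part of `d`
gives the face sum, and the part from `A_n` gives `(-1)^n d` of the integral. -/
theorem totalDiff_chernWeilCochain (θ : PseudoConnection A) (f : invariantPolys d G) :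
    totalDiff A (chernWeilCochain θ f) = 0 := by
  funext n
  have h := congrArg (Mixed.integral n (lvl A n)) (diff_fatChernWeil θ f n)
  rw [Mixed.integral_diff, map_zero] at h
  rw [totalDiff_apply, Pi.zero_apply, ← h, add_comm]
  refine congrArg₂ (· + ·) ?_ rfl
  cases n with
  | zero => exact (Mixed.slant_stokes_zero _).symm
  | succ n =>
    rw [Mixed.slant_stokes, faceSum_succ]
    exact Finset.sum_congr rfl fun i _ => congrArg _
      (integral_pullAlg_fatChernWeil θ f.1 (SimplexCategory.δ i)).symm

theorem chernWeilCochain_mem_basicCochains (θ : PseudoConnection A) (f : invariantPolys d G) :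
    chernWeilCochain θ f ∈ basicCochains A := by
  refine ⟨fun n => GDiffAlg.mem_basic.2 fun X => ⟨?_, ?_⟩, ?_⟩
  · rw [chernWeilCochain_apply, ← Mixed.integral_lie, lie_fatChernWeil, map_zero]
  · have h := Mixed.integral_map_parity ((lvl A n).contr X) (fatChernWeil θ f n)
    change Mixed.integral n _ (Mixed.contr n _ X _) = _ at h
    rw [contr_fatChernWeil, map_zero] at h
    exact (smul_eq_zero.1 h.symm).resolve_left (pow_ne_zero _ (by norm_num))
  · obtain ⟨N, hN⟩ := exists_slant_famChernWeil.{u} (f : SymDual d G)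
    refine ⟨N, fun n hn => ?_⟩
    rw [chernWeilCochain_apply, fatChernWeil_apply, Mixed.integral_eq_slant]
    exact hN n _ _ _ fun k hk w hw => integralForm_of_mem (by omega) hw

theorem chernWeilCochain_mem_basicCocycles (θ : PseudoConnection A) (f : invariantPolys d G) :
    chernWeilCochain θ f ∈ basicCocycles A :=
  ⟨chernWeilCochain_mem_basicCochains θ f, totalDiff_chernWeilCochain θ f⟩

omit [T2Space G] in
theorem chernWeilCochain_mem_cochainDeg (θ : PseudoConnection A) {k : ℕ} {f : SymDual d G}
    (hf : f ∈ symDeg d G k) : chernWeilCochain θ f ∈ cochainDeg A (2 * k) := fun n =>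
  Mixed.integral_mem (x := fatChernWeil θ f n) (by
    rw [fatChernWeil_apply]
    exact famChernWeil_mem _ hf)

omit [T2Space G] in
theorem chernWeilCochain_one (θ : PseudoConnection A) : chernWeilCochain θ 1 = unitCochain A := by
  funext n
  rw [chernWeilCochain_apply, map_one (fatChernWeil θ), Pi.one_apply]
  cases n with
  | zero =>
    exact (Mixed.integral_one_zero (B := lvl A 0)).trans
      (Pi.single_eq_same (M := fun n => lvl A n) 0 1).symm
  | succ n =>
    exact (Mixed.integral_one_succ (B := lvl A (n + 1))).trans
      (Pi.single_eq_of_ne (M := fun n => lvl A n) (Nat.succ_ne_zero n) 1).symm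

-- `f(Ω)` has even total degree, so the parity involution fixes it and Chern–Weil cochains enter the
-- Leibniz rule without sign.
omit [T2Space G] in
theorem totalParity_chernWeilCochain (θ : PseudoConnection A) (f : SymDual d G) :
    totalParity (chernWeilCochain θ f) = chernWeilCochain θ f := by
  funext n
  rw [totalParity, chernWeilCochain_apply, ← Mixed.integral_map_parity]
  change Mixed.integral n (lvl A n) (Mixed.par n (lvl A n) (fatChernWeil θ f n)) = _
  refine congrArg (Mixed.integral n (lvl A n)) ?_
  obtain ⟨N, hN⟩ := exists_bound_famChernWeil.{u} f
  rw [fatChernWeil_apply]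
  have h := hN n _ (vertexConnection θ n)
  have h' : (⨆ k ≤ N, Mixed.totalDeg n (lvl A n) (2 * k)) ≤
      LinearMap.eqLocus (Mixed.par n (lvl A n)) LinearMap.id := iSup₂_le fun k _ x hx => by
    rw [LinearMap.mem_eqLocus, Mixed.par_of_mem hx, (even_two_mul k).neg_one_pow, one_smul,
      LinearMap.id_apply]
  exact h' h

/-- The cycle comparing the wedge product and the cup product. -/
def pairCycle (θ : PseudoConnection A) (f f' : invariantPolys d G) :
    AcyclicModel.BasicCycle A pairModel where
  w n := Mixed.extMul n (lvl A n) (fatChernWeil θ f n) (fatChernWeil θ f' n)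
  closed n := (Mixed.map_pairDiff_extMul _ _).trans (by
    rw [diff_fatChernWeil, diff_fatChernWeil, map_zero, map_zero, LinearMap.zero_apply, add_zero]; rfl)
  contr n X := (Mixed.map_pairParity_extMul X _ _).trans (by
    rw [contr_fatChernWeil, contr_fatChernWeil, map_zero, map_zero, LinearMap.zero_apply, add_zero]; rfl)
  lie n X := (Mixed.map_lie_extMul X _ _).trans (by
    rw [lie_fatChernWeil, lie_fatChernWeil, map_zero, map_zero, LinearMap.zero_apply, add_zero]; rfl)
  compat n i := (Mixed.map_pairPull_extMul (face i) _ _).trans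
    ((congrArg₂ (fun x y => Mixed.extMul n (lvl A (n + 1)) x y)
      (pullAlg_fatChernWeil θ f.1 (SimplexCategory.δ i))
      (pullAlg_fatChernWeil θ f'.1 (SimplexCategory.δ i))).trans
      (Mixed.map_homAlg_extMul (CosimplicialObject.δ A i) _ _).symm)
  bounded := by
    obtain ⟨M, hM⟩ := exists_bound_famChernWeil.{u} (f : SymDual d G)
    obtain ⟨N, hN⟩ := exists_bound_famChernWeil.{u} (f' : SymDual d G)
    refine ⟨2 * M + 2 * N, fun n hn φ hφ => ?_⟩
    have key : ∀ x ∈ ⨆ k ≤ M, Mixed.totalDeg n (lvl A n) (2 * k),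
        ∀ y ∈ ⨆ k ≤ N, Mixed.totalDeg n (lvl A n) (2 * k),
        slant (V := Forms n ⊗[ℝ] Forms n) φ (Mixed.extMul n (lvl A n) x y) = 0 := by
      intro x hx y hy
      have h1 : ∀ k ≤ M, ∀ x ∈ Mixed.totalDeg n (lvl A n) (2 * k),
          slant (V := Forms n ⊗[ℝ] Forms n) φ (Mixed.extMul n (lvl A n) x y) = 0 :=
        fun k hk x hx => (iSup₂_le fun l hl y hy => Mixed.slant_extMul_eq_zero φ
          (fun j hj v hv => hφ j (by omega) v hv) hx hy : _ ≤ LinearMap.ker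
            (slant (V := Forms n ⊗[ℝ] Forms n) φ ∘ₗ Mixed.extMul n (lvl A n) x)) hy
      exact (iSup₂_le h1 : _ ≤ LinearMap.ker
        (slant (V := Forms n ⊗[ℝ] Forms n) φ ∘ₗ (Mixed.extMul n (lvl A n)).flip y)) hx
    rw [fatChernWeil_apply, fatChernWeil_apply]
    exact key _ (hM n _ _) _ (hN n _ _)

-- By compatibility, integrals over front and back faces are images of the integrals at lower
-- levels, which are the factors of the cup product.
omit [T2Space G] in
theorem slant_cupIntegral (θ : PseudoConnection A) (f f' : SymDual d G) (n : ℕ) :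
    slant (cupIntegral n) (Mixed.extMul n (lvl A n) (fatChernWeil θ f n) (fatChernWeil θ f' n)) =
      cup A (chernWeilCochain θ f) (chernWeilCochain θ f') n := by
  rw [cupIntegral, slant_sum, cup]
  refine Finset.sum_congr rfl fun p _ => ?_
  refine (Mixed.slant_tensorForm_extMul (k := n - p) _ _
    (fun q hq w hw => integralAlong_of_mem _ hq hw) _ _).trans ?_
  rw [GDiffAlg.homAlg_parity_pow]
  refine congrArg₂ (· * ·) (congrArg _ ?_) ?_
  · exact (Mixed.slant_integralAlong _ _).trans (integral_pullAlg_fatChernWeil θ f _)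
  · exact (Mixed.slant_integralAlong _ _).trans (integral_pullAlg_fatChernWeil θ f' _)

/-- In the pair model the wedge integral yields the cochain of `f * f'`, because `f ↦ f(Ω)` is
multiplicative, and `slant_cupIntegral` yields the cup product. -/
theorem exists_totalDiff_eq_sub_cup (θ : PseudoConnection A) (f f' : invariantPolys d G) :
    ∃ c ∈ basicCochains A, totalDiff A c = chernWeilCochain θ (f * f' : invariantPolys d G) -
      cup A (chernWeilCochain θ f) (chernWeilCochain θ f') := by
  obtain ⟨c, hc, h⟩ := (pairCycle θ f f').exists_totalDiff pairFunctional
  refine ⟨c, hc, funext fun n => (h n).trans ?_⟩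
  have e : wedgeIntegral n - cupIntegral n = wedgeIntegral n + (-1 : ℝ) • cupIntegral n := by
    rw [neg_one_smul ℝ (cupIntegral n), sub_eq_add_neg]
  change slant (wedgeIntegral n - cupIntegral n)
    (Mixed.extMul n (lvl A n) (fatChernWeil θ f n) (fatChernWeil θ f' n)) = _
  rw [e, slant_add, slant_smul, slant_cupIntegral, Mixed.slant_wedgeIntegral_extMul, neg_one_smul,
    ← sub_eq_add_neg]
  refine congrArg₂ (· - ·) ?_ rfl
  rw [chernWeilCochain_apply, Subalgebra.coe_mul, map_mul (fatChernWeil θ)]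
  rfl

/-- The Chern-Weil map at the level of cocycles. -/
def chernWeilCocycle (θ : PseudoConnection A) : invariantPolys d G →ₗ[ℝ] basicCocycles A :=
  (chernWeilCochain θ ∘ₗ (invariantPolys d G).val.toLinearMap).codRestrict _
    (chernWeilCochain_mem_basicCocycles θ)

theorem chernWeilCocycle_coe (θ : PseudoConnection A) (f : invariantPolys d G) :
    (chernWeilCocycle θ f : Cochain A) = chernWeilCochain θ f := rfl

omit [LieGroup (𝓡 d) ∞ G] [T2Space G] in
theorem cls_eq_cls {a b : basicCocycles A} :
    cls A a = cls A b ↔ ∃ c ∈ basicCochains A, totalDiff A c = (a : Cochain A) - b :=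
  Submodule.Quotient.eq _

omit [LieGroup (𝓡 d) ∞ G] [T2Space G] in
theorem cup_mem_basicCocycles (a b : basicCocycles A) : cup A a b ∈ basicCocycles A := by
  refine ⟨cup_mem_basicCochains a.2.1 b.2.1, ?_⟩
  rw [SetLike.mem_coe, LinearMap.mem_ker, totalDiff_cup, LinearMap.mem_ker.1 a.2.2,
    LinearMap.mem_ker.1 b.2.2, cup_zero_left, cup_zero_right, add_zero]

/-- With `D` the total differential, `a = z(f) + Dc` and `b = z(f') + Dc'`, the cochain `c ∨ b +
z(f) ∨ c'` bounds `a ∨ b - z(f) ∨ z(f')`, and `e` accounts for the difference between `z(f) ∨ z(f')`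
and `z(f f')`. -/
theorem cls_cup (θ : PseudoConnection A) {f f' : invariantPolys d G} {a b : basicCocycles A}
    (ha : cls A a = cls A (chernWeilCocycle θ f)) (hb : cls A b = cls A (chernWeilCocycle θ f')) :
    cls A ⟨cup A a b, cup_mem_basicCocycles a b⟩ = cls A (chernWeilCocycle θ (f * f')) := by
  obtain ⟨c, hc, hca⟩ := cls_eq_cls.1 ha
  obtain ⟨c', hc', hcb⟩ := cls_eq_cls.1 hb
  obtain ⟨e, he, hee⟩ := exists_totalDiff_eq_sub_cup θ f f'
  refine cls_eq_cls.2 ⟨cup A c b + cup A (chernWeilCochain θ f) c' - e,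
    Submodule.sub_mem _ (Submodule.add_mem _ (cup_mem_basicCochains hc b.2.1)
      (cup_mem_basicCochains (chernWeilCochain_mem_basicCochains θ f) hc')) he, ?_⟩
  have ea : (a : Cochain A) = totalDiff A c + chernWeilCochain θ f := by
    rw [hca, chernWeilCocycle_coe, sub_add_cancel]
  have eb : cup A (chernWeilCochain θ f) b = cup A (chernWeilCochain θ f) (totalDiff A c') +
      cup A (chernWeilCochain θ f) (chernWeilCochain θ f') := by
    rw [← cup_add_right, hcb, chernWeilCocycle_coe, sub_add_cancel]
  have eab : cup A a b = cup A (totalDiff A c) b + cup A (chernWeilCochain θ f) b := by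
    rw [← cup_add_left, ← ea]
  rw [map_sub, map_add, totalDiff_cup, totalDiff_cup, LinearMap.mem_ker.1 b.2.2, cup_zero_right,
    totalDiff_chernWeilCochain, cup_zero_left, totalParity_chernWeilCochain, hee, add_zero, zero_add]
  change _ = cup A a b - chernWeilCochain θ (f * f' : invariantPolys d G)
  rw [eab, eb]
  abel

theorem cls_chernWeilCocycle_eq (θ θ' : PseudoConnection A) (f : invariantPolys d G) :
    cls A (chernWeilCocycle θ f) = cls A (chernWeilCocycle θ' f) :=
  cls_eq_cls.2 (exists_totalDiff_eq_sub θ' θ f)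

end GDiffSimplicialAlg

end ChernWeil

end

/-! ### The Chern–Weil theorem for simplicial algebras. -/

open ChernWeil GDiffSimplicialAlg in
theorem mainTheorem9 {d : ℕ} {G : Type v} [TopologicalSpace G] [T2Space G]
    [ChartedSpace (EuclideanSpace ℝ (Fin d)) G] [Group G] [LieGroup (𝓡 d) ∞ G]
    (A : GDiffSimplicialAlg.{u} d G) :
    ∃ (z : PseudoConnection A → (invariantPolys d G →ₗ[ℝ] basicCocycles A))
      (w : PseudoConnection A → (invariantPolys d G →ₗ[ℝ] BasicCohomology A)),
      (∀ θ (f : invariantPolys d G), fatChernWeil θ f ∈ fatBasic A ∧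
        (z θ f : Cochain A) = integrate A (fatChernWeil θ f)) ∧
      (∀ θ f, w θ f = cls A (z θ f)) ∧
      (∀ θ k (f : invariantPolys d G), (f : SymDual d G) ∈ symDeg d G k →
        (z θ f : Cochain A) ∈ cochainDeg A (2 * k)) ∧
      (∀ θ, (z θ 1 : Cochain A) = unitCochain A) ∧
      (∀ θ f f' (a b : basicCocycles A), cls A a = w θ f → cls A b = w θ f' →
        ∃ h : cup A a b ∈ basicCocycles A, cls A ⟨cup A a b, h⟩ = w θ (f * f')) ∧
      (∀ θ θ', w θ = w θ') :=
  ⟨chernWeilCocycle, fun θ => cls A ∘ₗ chernWeilCocycle θ,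
    fun θ f => ⟨fatChernWeil_mem_fatBasic θ f, rfl⟩, fun _ _ => rfl,
    fun θ _ _ hf => chernWeilCochain_mem_cochainDeg θ hf, chernWeilCochain_one,
    fun θ _ _ a b ha hb => ⟨cup_mem_basicCocycles a b, cls_cup θ ha hb⟩,
    fun θ θ' => LinearMap.ext fun f => cls_chernWeilCocycle_eq θ θ' f⟩
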